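/- Let $d\ge 1$ and let $\mathbb H^d=\mathbb C^d\times\mathbb R$ be the Heisenberg group, with points $(z,t)$, $z=x+iy$, Lebesgue measure, Korányi norm $\rho=\rho(z,t)=(|z|^4+t^2)^{1/4}$, vector fields $X_j=\partial_{x_j}+2y_j\partial_t$, $Y_j=\partial_{y_j}-2x_j\partial_t$ ($1\le j\le d$), horizontal gradient $\nabla_{\mathbb H}=(X_1,\dots,X_d,Y_1,\dots,Y_d)$ and sublaplacian $\mathcal L=-\sum_j(X_j^2+Y_j^2)$. Write $\|\cdot\|$ for the norm of $L^2(\mathbb H^d)$, and let $H^1(\mathbb H^d)$ be the space of $u:\mathbb H^d\to\mathbb C$ with $u\in L^2$ and weak horizontal gradient $\nabla_{\mathbb H}u\in L^2$. For $\lambda=\lambda_1+i\lambda_2\in\mathbb C$ and $f\in H^{-1}(\mathbb H^d)$, a function $u\in H^1(\mathbb H^d)$ is a weak solution of $-\mathcal Lu+\lambda u=f$ if $$-\langle\nabla_{\mathbb H}v,\nabla_{\mathbb H}u\rangle+\lambda\langle v,u\rangle=\langle v,f\rangle\qquad\text{for all }v\in H^1(\mathbb H^d).$$ It is radial if $u(z,t)=u_0(\rho(z,t))$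 almost everywhere for some $u_0:[0,\infty)\to\mathbb C$. The norm $\big\|\frac{\rho^2}{|z|}f\big\|\in[0,\infty]$ is understood to be $+\infty$ if $f$ is not given by a function. Put $$u^-:=e^{-i\psi}u,\qquad \psi:=\sqrt{\tfrac d2}\,\frac{\Gamma(\frac d2)}{\Gamma(\frac{d+1}2)}\,\operatorname{sgn}(\lambda_2)\sqrt{|\lambda_1|}\;\rho,\qquad \operatorname{sgn}(w)=\tfrac{w}{|w|}\ (w\ne0),\quad \operatorname{sgn}(0)=1 .$$ Theorem. Let $u\in H^1(\mathbb H^d)$ be a radial weak solution of $-\mathcal Lu+\lambda u=f$. Then, for every $\delta>0$: (1) if $|\lambda_2|>\delta\lambda_1$, then $$\|\nabla_{\mathbb H}u\|\le\frac{1+1/\delta}{d}\,\Big\|\frac{\rho^2}{|z|}f\Big\|;$$ (2) if $|\lambda_2|\le\delta\lambda_1$, then $u^-\in H^1(\mathbb H^d)$ and $$\|\nabla_{\mathbb H}u^-\|\le K_d(\delta)\,\Big\|\frac{\rho^2}{|z|}f\Big\|,$$ where $$K_d(\delta):=\min_{\gamma>0}\left(\frac{8d+2+\gamma\sqrt\delta}{4d}+\sqrt{\frac{(8d+2+\gamma\sqrt\delta)^2}{16d^2}+\frac{\sqrt\delta}{2\gamma}}\right).$$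 In particular, uniformly in $\lambda\in\mathbb C$, $$\Big\|\frac{|z|}{\rho^2}u\Big\|\le\kappa_d\,\Big\|\frac{\rho^2}{|z|}f\Big\|,\qquad \kappa_d:=\min_{\delta>0}\max\left\{\frac{1+1/\delta}{d^2},\frac{K_d(\delta)}{d}\right\}.$$ Both minima are attained. -/

import Mathlib

open MeasureTheory Set
open scoped ENNReal ContDiff

noncomputable section

namespace Heis

/-- The index set of the `2 d` horizontal directions: `Sum.inl j` stands for `x_j` (and `X_j`),
`Sum.inr j` for `y_j` (and `Y_j`). -/
abbrev Idx (d : ℕ) : Type := Fin d ⊕ Fin d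

/-- The Heisenberg group `ℂ^d × ℝ`, with `ℂ^d` identified with `ℝ^{2d}` through `z = (x, y)`.
Its Haar measure is the Lebesgue measure `volume`; `‖p.1‖` is the Euclidean length `|z|`. -/
abbrev H (d : ℕ) : Type := EuclideanSpace ℝ (Idx d) × ℝ

/-- The Korányi norm `(|z|^4 + t^2)^{1/4}`. -/
def koranyi {d : ℕ} (p : H d) : ℝ := (‖p.1‖ ^ 4 + p.2 ^ 2) ^ (1 / 4 : ℝ)

/-- The vector `z^⊥ = (y, -x)`. -/
def perp {d : ℕ} (z : EuclideanSpace ℝ (Idx d)) : Idx d → ℝ :=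
  Sum.elim (fun j => z (Sum.inr j)) (fun j => -z (Sum.inl j))

/-- The horizontal left-invariant vector fields, as vectors at the point `p`:
`X_j = ∂_{x_j} + 2 y_j ∂_t` for the index `Sum.inl j`,
`Y_j = ∂_{y_j} - 2 x_j ∂_t` for the index `Sum.inr j`. -/
def field {d : ℕ} (i : Idx d) (p : H d) : H d :=
  (EuclideanSpace.single i (1 : ℝ), 2 * perp p.1 i)

/-- `G` is the weak (distributional) horizontal gradient `(X_1 u, …, X_d u, Y_1 u, …, Y_d u)`.
The fields are divergence free, so that their formal adjoints are their negatives. -/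
def IsWeakHGrad {d : ℕ} (u : H d → ℂ) (G : H d → EuclideanSpace ℂ (Idx d)) : Prop :=
  LocallyIntegrable u volume ∧ LocallyIntegrable G volume ∧
    ∀ φ : H d → ℝ, ContDiff ℝ ∞ φ → HasCompactSupport φ → ∀ i : Idx d,
      ∫ p, ((fderiv ℝ φ p (field i p) : ℝ) : ℂ) * u p = -∫ p, ((φ p : ℝ) : ℂ) * G p i

open scoped Classical in
/-- The weak horizontal gradient `∇_ℍ u` (determined up to null sets; `0` if there is none). -/
def hGrad {d : ℕ} (u : H d → ℂ) : H d → EuclideanSpace ℂ (Idx d) :=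
  if h : ∃ G, IsWeakHGrad u G then h.choose else 0

/-- Membership in the Sobolev space `H^1` of the Heisenberg group. -/
def MemH1 {d : ℕ} (u : H d → ℂ) : Prop :=
  MemLp u 2 volume ∧ ∃ G, IsWeakHGrad u G ∧ MemLp G 2 volume

/-- The norm `(‖u‖² + ‖∇_ℍ u‖²)^{1/2}` of `H^1`. -/
def h1Norm {d : ℕ} (u : H d → ℂ) : ℝ :=
  Real.sqrt ((eLpNorm u 2 volume).toReal ^ 2 + (eLpNorm (hGrad u) 2 volume).toReal ^ 2)

/-- `F` is an element of `H^{-1}`: a bounded antilinear functional `v ↦ ⟨v, F⟩` on `H^1`.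
Its values off `H^1` are irrelevant. -/
def IsHMinusOne {d : ℕ} (F : (H d → ℂ) → ℂ) : Prop :=
  (∀ v w, MemH1 v → MemH1 w → F (v + w) = F v + F w) ∧
    (∀ (c : ℂ) (v), MemH1 v → F (c • v) = starRingEnd ℂ c * F v) ∧
    ∃ C : ℝ, ∀ v, MemH1 v → ‖F v‖ ≤ C * h1Norm v

/-- The functional `F` is given by the function `f`: `⟨v, F⟩ = ∫ conj v f` for all `v ∈ H^1`. -/
def Represents {d : ℕ} (F : (H d → ℂ) → ℂ) (f : H d → ℂ) : Prop :=
  AEStronglyMeasurable f volume ∧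
    ∀ v, MemH1 v → Integrable (fun p => starRingEnd ℂ (v p) * f p) volume ∧
      F v = ∫ p, starRingEnd ℂ (v p) * f p

/-- The weighted norm `‖(ρ² / |z|) F‖` in `[0, ∞]`, where `ρ` is the Korányi norm: it is the
weighted `L²` norm of the function that gives `F` (unique up to null sets),
and `∞` if `F` is not a function. -/
def weightedNorm {d : ℕ} (F : (H d → ℂ) → ℂ) : ℝ≥0∞ :=
  ⨅ (f : H d → ℂ) (_ : Represents F f),
    eLpNorm (fun p => ((koranyi p ^ 2 / ‖p.1‖ : ℝ) : ℂ) * f p) 2 volume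

/-- `u` is a weak solution in `H^1` of `-𝓛 u + lam u = F`, where `𝓛 = -∑ (X_j² + Y_j²)`.
The inner products are antilinear in the first argument. -/
def IsWeakSolution {d : ℕ} (lam : ℂ) (F : (H d → ℂ) → ℂ) (u : H d → ℂ) : Prop :=
  MemH1 u ∧ ∀ v, MemH1 v →
    -(∫ p, inner ℂ (hGrad v p) (hGrad u p)) + lam * (∫ p, starRingEnd ℂ (v p) * u p) = F v

/-- Radial with respect to the Korányi norm (up to a null set). -/
def IsRadial {d : ℕ} (u : H d → ℂ) : Prop :=
  ∃ u₀ : ℝ → ℂ, ∀ᵐ p : H d, u p = u₀ (koranyi p)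

/-- The sign with the convention that the sign of `0` is `1`. -/
def sgn (w : ℝ) : ℝ := if w = 0 then 1 else w / |w|

/-- The phase `√(d/2) Γ(d/2) / Γ((d+1)/2) sgn(Im lam) √|Re lam| ρ`. -/
def phase {d : ℕ} (lam : ℂ) (p : H d) : ℝ :=
  Real.sqrt ((d : ℝ) / 2) * (Real.Gamma ((d : ℝ) / 2) / Real.Gamma (((d : ℝ) + 1) / 2)) *
    sgn lam.im * Real.sqrt |lam.re| * koranyi p

/-- The gauge transform `u^- = e^{-i ψ} u`, with `ψ` the phase. -/
def uMinus {d : ℕ} (lam : ℂ) (u : H d → ℂ) : H d → ℂ :=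
  fun p => Complex.exp (-(Complex.I * (phase lam p : ℂ))) * u p

/-- The function of `γ` whose minimum over `γ > 0` is the constant `K_d(δ)`. -/
def KFun (d : ℕ) (δ γ : ℝ) : ℝ :=
  (8 * d + 2 + γ * Real.sqrt δ) / (4 * d) +
    Real.sqrt ((8 * d + 2 + γ * Real.sqrt δ) ^ 2 / (16 * (d : ℝ) ^ 2) + Real.sqrt δ / (2 * γ))

/-- `K_d(δ)`, the minimum of `KFun d δ` over `γ > 0`. -/
def K (d : ℕ) (δ : ℝ) : ℝ := sInf (KFun d δ '' Ioi 0)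

/-- The function of `δ` whose minimum over `δ > 0` is the constant `κ_d`. -/
def kappaFun (d : ℕ) (δ : ℝ) : ℝ := max ((1 + 1 / δ) / (d : ℝ) ^ 2) (K d δ / d)

/-- `κ_d`, the minimum of `kappaFun d` over `δ > 0`. -/
def kappa (d : ℕ) : ℝ := sInf (kappaFun d '' Ioi 0)

end Heis

end

open MeasureTheory Set
open scoped ENNReal ContDiff

/-! For radial functions the problem is one-dimensional. If u = p(ρ), then ∇_ℍ u = p'(ρ) ∇_ℍ ρ, and
|∇_ℍ ρ|² = |z|²/ρ² is the weight `wt`. This weight is invariant under the dilations (z, t) ↦ (Rz,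
R²t), so ρ pushes Lebesgue measure to c₀ rⁿ dr and `wt` times Lebesgue measure to c₁ rⁿ dr, with n =
2d + 1 (`exists_polar`). The ratio c₀/c₁ = (d/2) (Γ(d/2)/Γ((d+1)/2))² is the source of the constant
in the phase: the equation becomes p'' + (n/r) p' + μ p = g/r on (0, ∞), with μ = (c₀/c₁) λ
(`exists_radial_equation`). Here g is the density of the push-forward of ρ f relative to c₁ rⁿ dr.
Since ρ f = (|z|/ρ) · (ρ²/|z|) f, the weighted norm of f controls the L² norm of g (`exists_push`).

Hardy's inequality bounds ‖p/r‖ by ‖p'‖/d (`hardy`). It involves p on the left only through |p|, so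
it also holds with y = p' - iκp in place of p', for every real κ (`hardy_gauge`). Pairing the
equation with p gives the energy identity -‖p'‖² + μ‖p‖² = ⟨p/r, g⟩. When |Im μ| > δ Re μ, its
imaginary part bounds the term Re μ ‖p‖² and its real part then bounds ‖p'‖²
(`sqrt_energy_le_of_lt`).

When |Im μ| ≤ δ Re μ, write μ = κ² + 2iεκ with ε ≥ 0 and κ of the sign of Im μ. The derivative of S
= ½ rⁿ⁺¹|y|² + (n/2) rⁿ Re(p̄ y) + ε (rⁿ⁺¹ Re(p̄ y) + ((n-1)/2) rⁿ|p|²) is rⁿ|y|²/2, plus terms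
containing g, plus ε times a nonnegative quadratic form. Since |S| ≤ rF with F integrable, S leaves
no boundary contribution, and ‖y‖² is bounded by pairings with g (`radial_multiplier`). The
remaining term 2ε‖p‖‖g‖ is controlled by the imaginary part of the energy identity and a weighted
arithmetic-geometric mean inequality with parameter γ. The larger root of the resulting quadratic
inequality in ‖y‖ is `KFun` times ‖g‖ (`le_KFun_mul`).

The reduction must start from an arbitrary, possibly nonmeasurable profile and from a weak gradient.
Measurability is recovered in `aestronglyMeasurable_profile`, absolute continuity in
`exists_profile`, and `isWeakHGrad_radial` goes back from profiles to functions on the group, across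
the origin. -/

namespace Heis

/-! ### Locally absolutely continuous functions on the half line -/

section Primitives

variable {E F : Type*} [NormedAddCommGroup E] [NormedSpace ℝ E] [NormedAddCommGroup F]
  [NormedSpace ℝ F]

/-- `u` is locally absolutely continuous on `(0, ∞)` with derivative `v`. -/
def IsPrim (u v : ℝ → E) : Prop :=
  ∀ a b : ℝ, 0 < a → 0 < b → IntervalIntegrable v volume a b ∧ u b - u a = ∫ x in a..b, v x

theorem uIcc_subset_Ioi {a b : ℝ} (ha : 0 < a) (hb : 0 < b) : uIcc a b ⊆ Ioi 0 := by
  intro x hx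
  have := hx.1
  exact lt_of_lt_of_le (lt_inf_iff.2 ⟨ha, hb⟩) this

theorem uIoc_subset_Ioi {a b : ℝ} (ha : 0 < a) (hb : 0 < b) : uIoc a b ⊆ Ioi 0 :=
  uIoc_subset_uIcc.trans (uIcc_subset_Ioi ha hb)

theorem ae_Ioi_uIoc {P : ℝ → Prop} (h : ∀ᵐ x ∂(volume.restrict (Ioi (0 : ℝ))), P x) {a b : ℝ}
    (ha : 0 < a) (hb : 0 < b) : ∀ᵐ x ∂volume, x ∈ uIoc a b → P x := by
  rw [ae_restrict_iff' measurableSet_Ioi] at h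
  filter_upwards [h] with x hx hxab using hx (uIoc_subset_Ioi ha hb hxab)

theorem IsPrim.intervalIntegrable {u v : ℝ → E} (h : IsPrim u v) {a b : ℝ} (ha : 0 < a)
    (hb : 0 < b) : IntervalIntegrable v volume a b := (h a b ha hb).1

theorem IsPrim.congr_left {u u' v : ℝ → E} (h : IsPrim u v) (hu : ∀ x, 0 < x → u x = u' x) :
    IsPrim u' v := fun a b ha hb =>
  ⟨(h a b ha hb).1, by rw [← hu a ha, ← hu b hb, (h a b ha hb).2]⟩

theorem IsPrim.congr_ae {u v v' : ℝ → E} (h : IsPrim u v)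
    (hv : v =ᵐ[volume.restrict (Ioi (0 : ℝ))] v') : IsPrim u v' := by
  intro a b ha hb
  have h1 := ae_Ioi_uIoc hv ha hb
  obtain ⟨h2, h3⟩ := h a b ha hb
  refine ⟨h2.congr_ae ((ae_restrict_iff' measurableSet_uIoc).2 h1), ?_⟩
  rw [h3]
  exact intervalIntegral.integral_congr_ae h1

theorem IsPrim.congr {u v v' : ℝ → E} (h : IsPrim u v) (hv : ∀ x, 0 < x → v x = v' x) :
    IsPrim u v' :=
  h.congr_ae ((ae_restrict_iff' measurableSet_Ioi).2 (Filter.Eventually.of_forall hv))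

theorem IsPrim.add {u v u' v' : ℝ → E} (h : IsPrim u v) (h' : IsPrim u' v') :
    IsPrim (fun x => u x + u' x) (fun x => v x + v' x) := by
  intro a b ha hb
  obtain ⟨h1, h2⟩ := h a b ha hb
  obtain ⟨h3, h4⟩ := h' a b ha hb
  refine ⟨h1.add h3, ?_⟩
  rw [intervalIntegral.integral_add h1 h3, ← h2, ← h4]
  exact add_sub_add_comm _ _ _ _

theorem IsPrim.map [CompleteSpace E] [CompleteSpace F] {u v : ℝ → E} (h : IsPrim u v)
    (L : E →L[ℝ] F) : IsPrim (fun x => L (u x)) (fun x => L (v x)) := by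
  intro a b ha hb
  obtain ⟨h1, h2⟩ := h a b ha hb
  refine ⟨⟨L.integrable_comp h1.1, L.integrable_comp h1.2⟩, ?_⟩
  rw [← map_sub, h2, L.intervalIntegral_comp_comm h1]

theorem IsPrim.of_hasDerivAt [CompleteSpace E] {u v : ℝ → E}
    (h : ∀ x, 0 < x → HasDerivAt u (v x) x) (hv : ContinuousOn v (Ioi 0)) : IsPrim u v := by
  intro a b ha hb
  have h1 : IntervalIntegrable v volume a b :=
    (hv.mono (uIcc_subset_Ioi ha hb)).intervalIntegrable
  exact ⟨h1, (intervalIntegral.integral_eq_sub_of_hasDerivAt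
    (fun x hx => h x (uIcc_subset_Ioi ha hb hx)) h1).symm⟩

theorem IsPrim.const (c : E) : IsPrim (fun _ => c) (fun _ => 0) :=
  fun a b _ _ => ⟨by simp, by simp⟩

/-- The base point 1 is any interior point: `v` need not be integrable up to 0. -/
theorem isPrim_integral {v : ℝ → E} (hv : LocallyIntegrableOn v (Ioi (0 : ℝ)) volume) :
    IsPrim (fun x => ∫ t in (1 : ℝ)..x, v t) v := by
  have key : ∀ a b : ℝ, 0 < a → 0 < b → IntervalIntegrable v volume a b := fun a b ha hb => by
    rw [intervalIntegrable_iff']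
    exact hv.integrableOn_compact_subset (uIcc_subset_Ioi ha hb) isCompact_uIcc
  exact fun a b ha hb => ⟨key a b ha hb,
    intervalIntegral.integral_interval_sub_left (key 1 b one_pos hb) (key 1 a one_pos ha)⟩

theorem IsPrim.continuousOn {u v : ℝ → E} (h : IsPrim u v) :
    ContinuousOn u (Ioi 0) := by
  intro x hx
  have hx : 0 < x := hx
  have h1 : ContinuousOn (fun y => ∫ t in (x / 2)..y, v t) (uIcc (x / 2) (2 * x)) := by
    apply intervalIntegral.continuousOn_primitive_interval'
      (h.intervalIntegrable (by linarith) (by linarith)) left_mem_uIcc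
  have hn : uIcc (x / 2) (2 * x) ∈ nhds x := by
    rw [uIcc_of_le (by linarith)]; exact Icc_mem_nhds (by linarith) (by linarith)
  have h2 : ContinuousAt (fun y => u (x / 2) + ∫ t in (x / 2)..y, v t) x :=
    continuousAt_const.add (h1.continuousAt hn)
  refine (h2.congr ?_).continuousWithinAt
  filter_upwards [lt_mem_nhds hx] with y hy
  rw [← (h (x / 2) y (by linarith) hy).2]
  abel

theorem IsPrim.locallyIntegrableOn {u v : ℝ → E} (h : IsPrim u v) :
    LocallyIntegrableOn v (Ioi 0) volume := by
  intro x hx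
  have hx : 0 < x := hx
  refine ⟨Icc (x / 2) (2 * x), mem_nhdsWithin_of_mem_nhds
    (Icc_mem_nhds (by linarith) (by linarith)), ?_⟩
  have := h.intervalIntegrable (a := x / 2) (b := 2 * x) (by linarith) (by linarith)
  rwa [intervalIntegrable_iff', uIcc_of_le (by linarith)] at this

theorem IsPrim.aestronglyMeasurable_right {u v : ℝ → E} (h : IsPrim u v) :
    AEStronglyMeasurable v (volume.restrict (Ioi (0 : ℝ))) :=
  h.locallyIntegrableOn.aestronglyMeasurable

theorem IsPrim.absolutelyContinuousOnInterval {u v : ℝ → ℝ} (h : IsPrim u v) {a b : ℝ}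
    (ha : 0 < a) (hb : 0 < b) : AbsolutelyContinuousOnInterval u a b := by
  have h1 := (h.intervalIntegrable ha hb).absolutelyContinuousOnInterval_intervalIntegral
    (c := a) left_mem_uIcc
  have h2 : AbsolutelyContinuousOnInterval (fun _ : ℝ => u a) a b :=
    (contDiff_const (c := u a)).contDiffOn.absolutelyContinuousOnInterval
  have h3 := h2.add h1
  rw [absolutelyContinuousOnInterval_iff] at h3 ⊢
  intro ε hε
  obtain ⟨δ, hδ, H⟩ := h3 ε hε
  refine ⟨δ, hδ, fun I hI hs => ?_⟩
  refine lt_of_le_of_lt (le_of_eq (Finset.sum_congr rfl fun i hi => ?_)) (H I hI hs)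
  have e : ∀ y ∈ uIcc a b, u y = ((fun _ : ℝ => u a) + fun x => ∫ t in a..x, v t) y := by
    intro y hy
    have := (h a y ha (uIcc_subset_Ioi ha hb hy)).2
    simp only [Pi.add_apply]; rw [← this]; ring
  have hm := hI.1 i hi
  rw [← e _ hm.1, ← e _ hm.2]

theorem IsPrim.ae_hasDerivAt {u v : ℝ → E} [CompleteSpace E] (h : IsPrim u v) {a b : ℝ}
    (ha : 0 < a) (hab : a ≤ b) : ∀ᵐ x, x ∈ Ioo a b → HasDerivAt u (v x) x := by
  have hb := ha.trans_le hab
  filter_upwards [(h.intervalIntegrable ha hb).ae_hasDerivAt_integral] with x hx hxab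
  have hxm : x ∈ uIcc a b := by rw [uIcc_of_le hab]; exact Ioo_subset_Icc_self hxab
  have := (hx hxm a left_mem_uIcc).const_add (u a)
  refine this.congr_of_eventuallyEq ?_
  filter_upwards [Ioo_mem_nhds hxab.1 hxab.2] with y hy
  rw [← (h a y ha (ha.trans hy.1)).2]; abel

/-- Integration by parts for absolutely continuous functions, with the derivatives identified almost
everywhere by Lebesgue differentiation. The complex product rule follows by splitting into real and
imaginary parts. -/
theorem IsPrim.mul_real {u v f g : ℝ → ℝ} (h : IsPrim u v) (h' : IsPrim f g) :
    IsPrim (fun x => u x * f x) (fun x => v x * f x + u x * g x) := by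
  have key : ∀ a b : ℝ, 0 < a → a ≤ b →
      u b * f b - u a * f a = ∫ x in a..b, (v x * f x + u x * g x) := by
    intro a b ha hab
    have hb := ha.trans_le hab
    rw [← AbsolutelyContinuousOnInterval.integral_deriv_mul_eq_sub
      (h.absolutelyContinuousOnInterval ha hb) (h'.absolutelyContinuousOnInterval ha hb)]
    apply intervalIntegral.integral_congr_ae
    -- The derivatives are known on the open interval only; the right endpoint is a null set.
    have hne : ∀ᵐ x : ℝ, x ≠ b := by simp [ae_iff]
    filter_upwards [h.ae_hasDerivAt ha hab, h'.ae_hasDerivAt ha hab, hne] with x h1 h2 h3 hx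
    rw [uIoc_of_le hab] at hx
    have hx' : x ∈ Ioo a b := ⟨hx.1, lt_of_le_of_ne hx.2 h3⟩
    rw [(h1 hx').deriv, (h2 hx').deriv]
  intro a b ha hb
  refine ⟨?_, ?_⟩
  · exact ((h.intervalIntegrable ha hb).mul_continuousOn
      (h'.continuousOn.mono (uIcc_subset_Ioi ha hb))).add
      ((h'.intervalIntegrable ha hb).continuousOn_mul
      (h.continuousOn.mono (uIcc_subset_Ioi ha hb)))
  · rcases le_total a b with hab | hab
    · exact key a b ha hab
    · rw [intervalIntegral.integral_symm, ← key b a hb hab]; ring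

theorem IsPrim.re {u v : ℝ → ℂ} (h : IsPrim u v) :
    IsPrim (fun x => (u x).re) (fun x => (v x).re) := h.map Complex.reCLM

theorem IsPrim.im {u v : ℝ → ℂ} (h : IsPrim u v) :
    IsPrim (fun x => (u x).im) (fun x => (v x).im) := h.map Complex.imCLM

theorem IsPrim.ofReal {u v : ℝ → ℝ} (h : IsPrim u v) :
    IsPrim (fun x => (u x : ℂ)) (fun x => (v x : ℂ)) := h.map Complex.ofRealCLM

theorem IsPrim.const_mul {u v : ℝ → ℂ} (h : IsPrim u v) (c : ℂ) :
    IsPrim (fun x => c * u x) (fun x => c * v x) :=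
  h.map (ContinuousLinearMap.mul ℝ ℂ c)

theorem IsPrim.const_mul_real {u v : ℝ → ℝ} (h : IsPrim u v) (c : ℝ) :
    IsPrim (fun x => c * u x) (fun x => c * v x) :=
  h.map (ContinuousLinearMap.mul ℝ ℝ c)

theorem IsPrim.of_re_im {u v : ℝ → ℂ} (hr : IsPrim (fun x => (u x).re) (fun x => (v x).re))
    (hi : IsPrim (fun x => (u x).im) (fun x => (v x).im)) : IsPrim u v := by
  have := hr.ofReal.add (hi.ofReal.const_mul Complex.I)
  refine (this.congr_left fun x _ => ?_).congr fun x _ => ?_ <;>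
    simp only [mul_comm Complex.I, Complex.re_add_im]

theorem IsPrim.mul {u v f g : ℝ → ℂ} (h : IsPrim u v) (h' : IsPrim f g) :
    IsPrim (fun x => u x * f x) (fun x => v x * f x + u x * g x) := by
  apply IsPrim.of_re_im
  · refine (((h.re.mul_real h'.re).add ((h.im.mul_real h'.im).const_mul_real (-1))).congr_left
      fun x _ => ?_).congr fun x _ => ?_ <;> simp <;> ring
  · refine (((h.re.mul_real h'.im).add (h.im.mul_real h'.re)).congr_left
      fun x _ => ?_).congr fun x _ => ?_ <;> simp <;> ring

end Primitives

/-! ### Weak derivatives on the half line -/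

section DuBoisReymond

theorem exists_Icc_of_tsupport {χ : ℝ → ℝ} (hc : HasCompactSupport χ)
    (hs : tsupport χ ⊆ Ioi 0) : ∃ a b : ℝ, 0 < a ∧ a < b ∧ tsupport χ ⊆ Ioo a b := by
  rcases (tsupport χ).eq_empty_or_nonempty with h | h
  · exact ⟨1, 2, by norm_num, by norm_num, by simp [h]⟩
  · obtain ⟨a, ha, hla⟩ := hc.exists_isLeast h
    obtain ⟨b, hb, hlb⟩ := hc.exists_isGreatest h
    have ha0 : 0 < a := hs ha
    have hab : a ≤ b := hla hb
    refine ⟨a / 2, b + 1, by linarith, by linarith, fun x hx => ⟨?_, ?_⟩⟩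
    · have := hla hx; linarith
    · have := hlb hx; linarith

theorem integral_eq_interval_of_support {f : ℝ → ℂ} {a b : ℝ} (hab : a ≤ b)
    (h : ∀ x, x ∉ Ioo a b → f x = 0) : ∫ x, f x = ∫ x in a..b, f x := by
  rw [intervalIntegral.integral_of_le hab, ← integral_indicator measurableSet_Ioc]
  congr 1; ext x
  by_cases hx : x ∈ Ioc a b
  · rw [indicator_of_mem hx]
  · rw [indicator_of_notMem hx, h x (fun h' => hx (Ioo_subset_Ioc_self h'))]

theorem eq_zero_of_notMem_Ioo {χ : ℝ → ℝ} {a b : ℝ} (h : tsupport χ ⊆ Ioo a b) {x : ℝ}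
    (hx : x ∉ Ioo a b) : χ x = 0 ∧ deriv χ x = 0 := by
  have h0 : x ∉ tsupport χ := fun h' => hx (h h')
  exact ⟨image_eq_zero_of_notMem_tsupport h0,
    image_eq_zero_of_notMem_tsupport fun h' => h0 (tsupport_deriv_subset h')⟩

theorem isPrim_of_contDiff {χ : ℝ → ℝ} (h : ContDiff ℝ ∞ χ) : IsPrim χ (deriv χ) :=
  IsPrim.of_hasDerivAt
    (fun x _ => ((h.differentiable (by simp)) x).hasDerivAt)
    (h.continuous_deriv (by simp)).continuousOn

theorem IsPrim.integral_deriv_mul {U W : ℝ → ℂ} (h : IsPrim U W) {χ : ℝ → ℝ}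
    (hd : ContDiff ℝ ∞ χ) (hc : HasCompactSupport χ) (hs : tsupport χ ⊆ Ioi 0) :
    ∫ x, ((deriv χ x : ℝ) : ℂ) * U x = -∫ x, ((χ x : ℝ) : ℂ) * W x := by
  obtain ⟨a, b, ha, hab, hsub⟩ := exists_Icc_of_tsupport hc hs
  have hb := ha.trans hab
  have hp := (isPrim_of_contDiff hd).ofReal.mul h
  rw [integral_eq_interval_of_support hab.le, integral_eq_interval_of_support hab.le,
    eq_neg_iff_add_eq_zero, ← intervalIntegral.integral_add, ← (hp a b ha hb).2]
  · simp [(eq_zero_of_notMem_Ioo hsub (x := a) (by simp)).1,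
      (eq_zero_of_notMem_Ioo hsub (x := b) (by simp)).1]
  · apply IntervalIntegrable.mul_continuousOn
    · exact (isPrim_of_contDiff hd).ofReal.intervalIntegrable ha hb
    · exact h.continuousOn.mono (uIcc_subset_Ioi ha hb)
  · apply IntervalIntegrable.continuousOn_mul (h.intervalIntegrable ha hb)
    exact (Complex.continuous_ofReal.comp hd.continuous).continuousOn
  · intro x hx; simp [(eq_zero_of_notMem_Ioo hsub hx).1]
  · intro x hx; simp [(eq_zero_of_notMem_Ioo hsub hx).2]

theorem contDiff_integral {ξ : ℝ → ℝ} (hd : ContDiff ℝ ∞ ξ) (a : ℝ) :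
    ContDiff ℝ ∞ (fun x => ∫ t in a..x, ξ t) ∧ deriv (fun x => ∫ t in a..x, ξ t) = ξ := by
  have h1 : ∀ x, HasDerivAt (fun x => ∫ t in a..x, ξ t) (ξ x) x := fun x =>
    intervalIntegral.integral_hasDerivAt_right (hd.continuous.intervalIntegrable _ _)
      (hd.continuous.stronglyMeasurableAtFilter _ _) hd.continuous.continuousAt
  have h2 : deriv (fun x => ∫ t in a..x, ξ t) = ξ := funext fun x => (h1 x).deriv
  refine ⟨?_, h2⟩
  rw [contDiff_infty_iff_deriv, h2]
  exact ⟨fun x => (h1 x).differentiableAt, hd⟩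

/-- A primitive of a test function of mean zero on `(0, ∞)` is a test function. -/
theorem exists_test_primitive {ξ : ℝ → ℝ} (hd : ContDiff ℝ ∞ ξ) (hc : HasCompactSupport ξ)
    (hs : tsupport ξ ⊆ Ioi 0) (h0 : ∫ x, ξ x = 0) :
    ∃ χ : ℝ → ℝ, ContDiff ℝ ∞ χ ∧ HasCompactSupport χ ∧ tsupport χ ⊆ Ioi 0 ∧ deriv χ = ξ := by
  obtain ⟨a, b, ha, hab, hsub⟩ := exists_Icc_of_tsupport hc hs
  obtain ⟨h1, h2⟩ := contDiff_integral hd a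
  have hz : ∀ x, x ∉ Ioo a b → ξ x = 0 := fun x hx => (eq_zero_of_notMem_Ioo hsub hx).1
  have hab0 : ∫ x in a..b, ξ x = 0 := by
    rw [← h0, intervalIntegral.integral_of_le hab.le, ← integral_indicator measurableSet_Ioc]
    congr 1; ext x
    by_cases hx : x ∈ Ioc a b
    · rw [indicator_of_mem hx]
    · rw [indicator_of_notMem hx, hz x (fun h' => hx (Ioo_subset_Ioc_self h'))]
  -- To the left of `a` the integrand vanishes; beyond `b` the full integral has been collected, and
  -- it is zero.
  have hsupp : ∀ x, x ∉ Icc a b → ∫ t in a..x, ξ t = 0 := by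
    intro x hx
    rcases lt_or_ge x a with h | h
    · rw [intervalIntegral.integral_congr (g := fun _ => 0)]
      · simp
      · intro y hy
        rw [uIcc_of_ge h.le] at hy
        exact hz y fun h' => absurd h'.1 (not_lt.2 hy.2)
    · have hbx : b < x := by by_contra h'; exact hx ⟨h, not_lt.1 h'⟩
      rw [← intervalIntegral.integral_add_adjacent_intervals
        (hd.continuous.intervalIntegrable a b) (hd.continuous.intervalIntegrable b x), hab0,
        zero_add, intervalIntegral.integral_congr (g := fun _ => 0)]
      · simp
      · intro y hy
        rw [uIcc_of_le hbx.le] at hy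
        exact hz y fun h' => absurd h'.2 (not_lt.2 hy.1)
  have hts : tsupport (fun x => ∫ t in a..x, ξ t) ⊆ Icc a b :=
    closure_minimal (fun x hx => by by_contra h; exact hx (hsupp x h)) isClosed_Icc
  exact ⟨_, h1, HasCompactSupport.of_support_subset_isCompact isCompact_Icc
    (subset_closure.trans hts), hts.trans fun x hx => lt_of_lt_of_le ha hx.1, h2⟩

theorem exists_test_integral_one : ∃ θ : ℝ → ℝ, ContDiff ℝ ∞ θ ∧ HasCompactSupport θ ∧
    tsupport θ ⊆ Ioi 0 ∧ ∫ x, θ x = 1 := by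
  let f : ContDiffBump (2 : ℝ) := ⟨1 / 2, 1, by norm_num, by norm_num⟩
  refine ⟨f.normed volume, f.contDiff_normed, f.hasCompactSupport_normed, ?_, f.integral_normed⟩
  rw [f.tsupport_normed_eq, Real.closedBall_eq_Icc]
  intro x hx
  have : (2 : ℝ) - 1 ≤ x := hx.1
  show (0 : ℝ) < x
  linarith

theorem integrable_test_mul {χ : ℝ → ℝ} (hχ : Continuous χ) (hc : HasCompactSupport χ)
    (hs : tsupport χ ⊆ Ioi 0) {U : ℝ → ℂ} (hU : LocallyIntegrableOn U (Ioi (0 : ℝ)) volume) :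
    Integrable (fun x => ((χ x : ℝ) : ℂ) * U x) := by
  have h1 : IntegrableOn U (tsupport χ) := hU.integrableOn_compact_subset hs hc
  have h2 : IntegrableOn (fun x => ((χ x : ℝ) : ℂ) * U x) (tsupport χ) :=
    h1.continuousOn_mul (Complex.continuous_ofReal.comp hχ).continuousOn hc
  rw [integrableOn_iff_integrable_of_support_subset] at h2
  · exact h2
  · intro x hx
    apply subset_tsupport
    intro h
    apply hx; simp [h]

/-- The lemma of du Bois-Reymond. -/
theorem exists_isPrim_of_weak {U W : ℝ → ℂ} (hU : LocallyIntegrableOn U (Ioi (0 : ℝ)) volume)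
    (hW : LocallyIntegrableOn W (Ioi (0 : ℝ)) volume)
    (h : ∀ χ : ℝ → ℝ, ContDiff ℝ ∞ χ → HasCompactSupport χ → tsupport χ ⊆ Ioi 0 →
      ∫ x, ((deriv χ x : ℝ) : ℂ) * U x = -∫ x, ((χ x : ℝ) : ℂ) * W x) :
    ∃ Ũ : ℝ → ℂ, IsPrim Ũ W ∧ U =ᵐ[volume.restrict (Ioi (0 : ℝ))] Ũ := by
  -- `V` has weak derivative `W`, so `U - V` has weak derivative zero and must be a constant; the
  -- only candidate is its mean `c` against a fixed test function `θ` of integral one.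
  set V : ℝ → ℂ := fun x => ∫ t in (1 : ℝ)..x, W t
  have hV : IsPrim V W := isPrim_integral hW
  have hVl : LocallyIntegrableOn V (Ioi (0 : ℝ)) volume :=
    hV.continuousOn.locallyIntegrableOn measurableSet_Ioi
  obtain ⟨θ, hθd, hθc, hθs, hθ1⟩ := exists_test_integral_one
  set c : ℂ := ∫ x, ((θ x : ℝ) : ℂ) * (U x - V x)
  have hUV : LocallyIntegrableOn (fun x => U x - V x) (Ioi (0 : ℝ)) volume := hU.sub hVl
  have hcl : LocallyIntegrableOn (fun _ : ℝ => c) (Ioi (0 : ℝ)) volume :=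
    (locallyIntegrable_const c).locallyIntegrableOn _
  have hUVc : LocallyIntegrableOn (fun x => U x - V x - c) (Ioi (0 : ℝ)) volume := hUV.sub hcl
  have key := isOpen_Ioi.ae_eq_zero_of_integral_contDiff_smul_eq_zero hUVc (by
    intro ξ hd hc hs
    -- Subtracting `m θ` leaves a test function of mean zero, hence the derivative of a test
    -- function, to which the hypothesis applies.
    set m := ∫ x, ξ x
    have hz : ∫ x, (ξ x - m * θ x) = 0 := by
      rw [integral_sub (hd.continuous.integrable_of_hasCompactSupport hc)
        ((hθd.continuous.integrable_of_hasCompactSupport hθc).const_mul m),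
        integral_const_mul, hθ1, mul_one, sub_self]
    have hts : tsupport (fun x => ξ x - m * θ x) ⊆ tsupport ξ ∪ tsupport θ := by
      apply closure_minimal _ ((isClosed_tsupport _).union (isClosed_tsupport _))
      intro x hx
      by_contra hcon
      rw [mem_union, not_or] at hcon
      apply hx
      simp [image_eq_zero_of_notMem_tsupport hcon.1, image_eq_zero_of_notMem_tsupport hcon.2]
    obtain ⟨χ, h1, h2, h3, h4⟩ := exists_test_primitive (ξ := fun x => ξ x - m * θ x)
      (hd.sub (contDiff_const.mul hθd))
      (HasCompactSupport.of_support_subset_isCompact (hc.isCompact.union hθc.isCompact)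
        (subset_closure.trans hts)) (hts.trans (union_subset hs hθs)) hz
    have e1 := h χ h1 h2 h3
    rw [← hV.integral_deriv_mul h1 h2 h3, h4] at e1
    have i1 := integrable_test_mul hd.continuous hc hs hU
    have i2 := integrable_test_mul hd.continuous hc hs hVl
    have i3 := integrable_test_mul hd.continuous hc hs hUV
    have i4 := integrable_test_mul hθd.continuous hθc hθs hU
    have i5 := integrable_test_mul hθd.continuous hθc hθs hVl
    have i6 := integrable_test_mul hθd.continuous hθc hθs hUV
    have i7 := integrable_test_mul hd.continuous hc hs hcl
    have e2 : ∀ Z : ℝ → ℂ, Integrable (fun x => ((ξ x : ℝ) : ℂ) * Z x) →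
        Integrable (fun x => ((θ x : ℝ) : ℂ) * Z x) →
        ∫ x, ((ξ x - m * θ x : ℝ) : ℂ) * Z x
          = (∫ x, ((ξ x : ℝ) : ℂ) * Z x) - m * ∫ x, ((θ x : ℝ) : ℂ) * Z x := by
      intro Z j1 j2
      rw [← integral_const_mul, ← integral_sub j1 (j2.const_mul _)]
      congr 1; ext x; push_cast; ring
    rw [e2 U i1 i4, e2 V i2 i5] at e1
    have e3 : ∫ x, ((ξ x : ℝ) : ℂ) * (U x - V x) = m * c := by
      have : c = (∫ x, ((θ x : ℝ) : ℂ) * U x) - ∫ x, ((θ x : ℝ) : ℂ) * V x := by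
        rw [← integral_sub i4 i5]
        exact integral_congr_ae (Filter.Eventually.of_forall fun x => mul_sub _ _ _)
      rw [this]
      have : ∫ x, ((ξ x : ℝ) : ℂ) * (U x - V x)
          = (∫ x, ((ξ x : ℝ) : ℂ) * U x) - ∫ x, ((ξ x : ℝ) : ℂ) * V x := by
        rw [← integral_sub i1 i2]; congr 1; ext x; ring
      rw [this]
      linear_combination e1
    have e4 : ∫ x, ((ξ x : ℝ) : ℂ) * c = m * c := by
      rw [integral_mul_const, integral_complex_ofReal]
    have : ∀ x, ξ x • (U x - V x - c)
        = ((ξ x : ℝ) : ℂ) * (U x - V x) - ((ξ x : ℝ) : ℂ) * c := by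
      intro x; simp [mul_sub]
    simp_rw [this]
    rw [integral_sub i3 i7, e3, e4, sub_self])
  refine ⟨fun x => V x + c, ?_, ?_⟩
  · exact ((hV.add (IsPrim.const c)).congr fun x _ => by simp)
  · rw [Filter.EventuallyEq, ae_restrict_iff' measurableSet_Ioi]
    filter_upwards [key] with x hx hxp
    have := hx hxp
    linear_combination this

end DuBoisReymond

/-! ### The measure rⁿ dr -/

section RadialMeasure

/-- The measure `r ^ n dr` on `(0, ∞)`. -/
noncomputable def radMeas (n : ℕ) : Measure ℝ :=
  (volume.restrict (Ioi (0 : ℝ))).withDensity (fun r => ENNReal.ofReal (r ^ n))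

theorem measurable_density (n : ℕ) : Measurable fun r : ℝ => ENNReal.ofReal (r ^ n) := by fun_prop

theorem restrict_radMeas (n : ℕ) {α : ℝ} (hα : 0 ≤ α) : (radMeas n).restrict (Ioi α) =
    (volume.restrict (Ioi α)).withDensity (fun r => ENNReal.ofReal (r ^ n)) := by
  rw [radMeas, restrict_withDensity measurableSet_Ioi, Measure.restrict_restrict measurableSet_Ioi,
    inter_eq_left.2 (Ioi_subset_Ioi hα)]

theorem restrict_radMeas_zero (n : ℕ) : (radMeas n).restrict (Ioi 0) = radMeas n :=
  restrict_radMeas n le_rfl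

theorem integrableOn_radMeas_iff {E : Type*} [NormedAddCommGroup E] [NormedSpace ℝ E] {n : ℕ}
    {α : ℝ} (hα : 0 ≤ α) {f : ℝ → E} :
    IntegrableOn f (Ioi α) (radMeas n) ↔ IntegrableOn (fun r => r ^ n • f r) (Ioi α) := by
  rw [IntegrableOn, restrict_radMeas n hα, integrable_withDensity_iff_integrable_smul'
    (measurable_density n) (by simp)]
  refine integrableOn_congr_fun (fun r hr => ?_) measurableSet_Ioi
  have : 0 < r := lt_of_le_of_lt hα hr
  rw [ENNReal.toReal_ofReal (by positivity)]

theorem integral_radMeas_Ioi {E : Type*} [NormedAddCommGroup E] [NormedSpace ℝ E] {n : ℕ}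
    {α : ℝ} (hα : 0 ≤ α) (f : ℝ → E) :
    ∫ r in Ioi α, f r ∂(radMeas n) = ∫ r in Ioi α, r ^ n • f r := by
  rw [restrict_radMeas n hα, integral_withDensity_eq_integral_toReal_smul
    (measurable_density n) (by simp)]
  refine setIntegral_congr_fun measurableSet_Ioi (fun r hr => ?_)
  have : 0 < r := lt_of_le_of_lt hα hr
  rw [ENNReal.toReal_ofReal (by positivity)]

theorem integrable_radMeas_iff {E : Type*} [NormedAddCommGroup E] [NormedSpace ℝ E] {n : ℕ}
    {f : ℝ → E} : Integrable f (radMeas n) ↔ IntegrableOn (fun r => r ^ n • f r) (Ioi 0) := by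
  rw [← integrableOn_radMeas_iff le_rfl, IntegrableOn, restrict_radMeas_zero]

theorem integral_radMeas {E : Type*} [NormedAddCommGroup E] [NormedSpace ℝ E] {n : ℕ}
    (f : ℝ → E) : ∫ r, f r ∂(radMeas n) = ∫ r in Ioi 0, r ^ n • f r := by
  rw [← integral_radMeas_Ioi le_rfl, restrict_radMeas_zero]

theorem radMeas_ac (n : ℕ) : radMeas n ≪ volume.restrict (Ioi (0 : ℝ)) :=
  withDensity_absolutelyContinuous _ _

theorem ae_radMeas_pos (n : ℕ) : ∀ᵐ r ∂(radMeas n), 0 < r :=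
  (radMeas_ac n).ae_le (ae_restrict_mem measurableSet_Ioi)

end RadialMeasure

/-! ### The Cauchy–Schwarz inequality for real functions -/

section L2

variable {α : Type*} [MeasurableSpace α] {μ : Measure α}

theorem integral_mul_le_sqrt {f g : α → ℝ} (hf : MemLp f 2 μ) (hg : MemLp g 2 μ) :
    ∫ x, |f x * g x| ∂μ ≤ √(∫ x, f x ^ 2 ∂μ) * √(∫ x, g x ^ 2 ∂μ) := by
  have := integral_mul_le_Lp_mul_Lq_of_nonneg (μ := μ) Real.HolderConjugate.two_two
    (Filter.Eventually.of_forall fun x => abs_nonneg (f x))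
    (Filter.Eventually.of_forall fun x => abs_nonneg (g x))
    (by simpa using hf.norm) (by simpa using hg.norm)
  simpa [Real.sqrt_eq_rpow, abs_mul] using this

end L2

/-! ### Differential inequalities without boundary terms -/

section Calculus

/-- Writing the derivative with a factor `k / r` avoids truncated subtraction in the exponent and
keeps the power common to all terms of a product rule. -/
theorem IsPrim.pow (k : ℕ) : IsPrim (fun r : ℝ => r ^ k) (fun r => k / r * r ^ k) := by
  refine IsPrim.of_hasDerivAt (fun x hx => ?_) ?_
  · refine (hasDerivAt_pow k x).congr_deriv ?_
    rcases k with _ | k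
    · simp
    · rw [Nat.add_sub_cancel, pow_succ]; field_simp
  · exact ContinuousOn.mul (continuousOn_const.div continuousOn_id fun x hx => (ne_of_gt hx))
      (continuous_pow k).continuousOn

theorem intervalIntegral_le_of_isPrim {S S' R : ℝ → ℝ} (hS : IsPrim S S')
    (hle : ∀ᵐ r ∂(volume.restrict (Ioi (0 : ℝ))), R r ≤ S' r) {a b : ℝ} (ha : 0 < a) (hab : a ≤ b)
    (hR : IntervalIntegrable R volume a b) : S a + ∫ r in a..b, R r ≤ S b := by
  have h1 := (hS a b ha (ha.trans_le hab)).2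
  have h2 : ∫ r in a..b, R r ≤ ∫ r in a..b, S' r := by
    apply intervalIntegral.integral_mono_ae_restrict hab hR
      (hS.intervalIntegrable ha (ha.trans_le hab))
    exact ae_restrict_of_ae_restrict_of_subset (fun x hx => lt_of_lt_of_le ha hx.1) hle
  linarith

/-- Replaces the limit of S at infinity, which need not be known to exist. If the conclusion failed,
S would stay above a positive constant c for large r, so F ≥ c/r there, and 1/r is not integrable at
infinity. -/
theorem integral_Ioi_le_of_isPrim {S S' R F : ℝ → ℝ} {a : ℝ} (ha : 0 < a) (hS : IsPrim S S')
    (hle : ∀ᵐ r ∂(volume.restrict (Ioi (0 : ℝ))), R r ≤ S' r) (hR : IntegrableOn R (Ioi a))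
    (hF : IntegrableOn F (Ioi a)) (hb : ∀ r, a < r → S r ≤ r * F r) :
    ∫ r in Ioi a, R r ≤ -S a := by
  by_contra! hcon
  set I := ∫ r in Ioi a, R r
  have h1 : Filter.Tendsto (fun b => ∫ r in a..b, R r) Filter.atTop (nhds I) :=
    intervalIntegral_tendsto_integral_Ioi a hR Filter.tendsto_id
  have h2 : ∀ᶠ b in Filter.atTop, (I - S a) / 2 < ∫ r in a..b, R r :=
    h1.eventually_const_lt (by linarith)
  obtain ⟨B, hB⟩ := Filter.eventually_atTop.1 (h2.and (Filter.eventually_gt_atTop a))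
  have hBa : a < B := (hB B le_rfl).2
  -- Once the integral of `R` from `a` exceeds `(I - S a) / 2`, `S` exceeds `S a + (I - S a) / 2 =
  -- c`.
  set c := (I + S a) / 2
  have hc : 0 < c := by simp only [c]; linarith
  have h3 : ∀ r, B < r → c * r⁻¹ ≤ F r := by
    intro r hr
    have hr0 : 0 < r := by linarith
    have h4 := intervalIntegral_le_of_isPrim hS hle ha (hBa.trans hr).le
      (by rw [intervalIntegrable_iff_integrableOn_Ioc_of_le (hBa.trans hr).le]
          exact hR.mono_set Ioc_subset_Ioi_self)
    have h5 := (hB r hr.le).1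
    have h6 := hb r (hBa.trans hr)
    have h7 : c ≤ r * F r := by simp only [c]; linarith
    rw [← div_eq_mul_inv, div_le_iff₀ hr0]; linarith
  have h8 : IntegrableOn (fun r : ℝ => c * r⁻¹) (Ioi B) := by
    refine (hF.mono_set (Ioi_subset_Ioi hBa.le)).mono' (by fun_prop) ?_
    rw [ae_restrict_iff' measurableSet_Ioi]
    refine Filter.Eventually.of_forall fun r hr => ?_
    have hr0 : 0 < r := (ha.trans hBa).trans hr
    rw [Real.norm_of_nonneg (by positivity)]
    exact h3 r hr
  have h9 : IntegrableOn (fun r : ℝ => r⁻¹) (Ioi B) :=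
    (h8.const_mul c⁻¹).congr (Filter.Eventually.of_forall fun r => by simp [hc.ne'])
  exact not_integrableOn_Ioi_inv h9

theorem tendsto_integral_Ioi_zero {R : ℝ → ℝ} (hR : IntegrableOn R (Ioi 0)) :
    Filter.Tendsto (fun a => ∫ r in Ioi a, R r) (nhdsWithin 0 (Ioi 0))
      (nhds (∫ r in Ioi 0, R r)) := by
  have hc := aecover_Ioi_of_Ioi (μ := volume) (l := nhdsWithin (0 : ℝ) (Ioi 0)) (a := id)
    (A := (0 : ℝ)) (Filter.tendsto_id.mono_right nhdsWithin_le_nhds)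
  have := hc.integral_tendsto_of_countably_generated hR
  refine this.congr' ?_
  filter_upwards [self_mem_nhdsWithin] with a ha
  rw [Measure.restrict_restrict measurableSet_Ioi, id,
    inter_eq_left.2 (Ioi_subset_Ioi (le_of_lt ha))]

/-- The same argument at the other end. Were the integral `I` positive, the half-line estimate would
force `|S r| ≥ I / 2` for small `r`, hence `F ≥ I / (2 r)`, and 1/r is not integrable at 0. -/
theorem integral_nonpos_of_isPrim {S S' R F : ℝ → ℝ} (hS : IsPrim S S')
    (hle : ∀ᵐ r ∂(volume.restrict (Ioi (0 : ℝ))), R r ≤ S' r) (hR : IntegrableOn R (Ioi 0))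
    (hF : IntegrableOn F (Ioi 0)) (hb : ∀ r, 0 < r → |S r| ≤ r * F r) :
    ∫ r in Ioi 0, R r ≤ 0 := by
  by_contra! hcon
  set I := ∫ r in Ioi 0, R r
  have h2 : ∀ᶠ a in nhdsWithin 0 (Ioi 0), I / 2 < ∫ r in Ioi a, R r :=
    (tendsto_integral_Ioi_zero hR).eventually_const_lt (by linarith)
  obtain ⟨B, hB0, hB⟩ := mem_nhdsGT_iff_exists_Ioo_subset.1 h2
  have hB0 : 0 < B := hB0
  have h3 : ∀ r ∈ Ioo 0 B, I / 2 * r⁻¹ ≤ F r := by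
    intro r hr
    have h4 := integral_Ioi_le_of_isPrim hr.1 hS hle (hR.mono_set (Ioi_subset_Ioi hr.1.le))
      (hF.mono_set (Ioi_subset_Ioi hr.1.le))
      (fun x hx => (le_abs_self _).trans (hb x (hr.1.trans hx)))
    have h5 : I / 2 < ∫ r in Ioi r, R r := hB hr
    have h6 := (neg_le_abs _).trans (hb r hr.1)
    rw [← div_eq_mul_inv, div_le_iff₀ hr.1]; linarith
  have h8 : IntegrableOn (fun r : ℝ => I / 2 * r⁻¹) (Ioo 0 B) := by
    refine (hF.mono_set Ioo_subset_Ioi_self).mono' (by fun_prop) ?_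
    rw [ae_restrict_iff' measurableSet_Ioo]
    refine Filter.Eventually.of_forall fun r hr => ?_
    have hr0 : 0 < r := hr.1
    rw [Real.norm_of_nonneg (by positivity)]
    exact h3 r hr
  have h9 : IntegrableOn (fun r : ℝ => r⁻¹) (Ioo 0 B) :=
    (h8.const_mul (I / 2)⁻¹).congr (Filter.Eventually.of_forall fun r => by
      have : I ≠ 0 := hcon.ne'
      simp only; field_simp)
  have h10 : IntervalIntegrable (fun r : ℝ => r⁻¹) volume 0 B := by
    rwa [intervalIntegrable_iff_integrableOn_Ioo_of_le hB0.le]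
  rw [intervalIntegrable_inv_iff] at h10
  rcases h10 with h | h
  · exact hB0.ne h
  · exact h left_mem_uIcc

end Calculus

/-! ### Radial Hardy inequality and the multiplier estimate -/

theorem IsPrim.re_conj_mul {u v f g : ℝ → ℂ} (hu : IsPrim u v) (hf : IsPrim f g) :
    IsPrim (fun r => (u r).re * (f r).re + (u r).im * (f r).im)
      (fun r => (v r).re * (f r).re + (u r).re * (g r).re
        + ((v r).im * (f r).im + (u r).im * (g r).im)) :=
  (hu.re.mul_real hf.re).add (hu.im.mul_real hf.im)

theorem sq_norm_eq (z : ℂ) : ‖z‖ ^ 2 = z.re * z.re + z.im * z.im := by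
  rw [← Complex.normSq_eq_norm_sq, Complex.normSq_apply]

theorem abs_re_conj_mul_le (z w : ℂ) : |z.re * w.re + z.im * w.im| ≤ ‖z‖ * ‖w‖ := by
  have := Complex.abs_re_le_norm (starRingEnd ℂ z * w)
  simpa using this

theorem aesm_div {u : ℝ → ℂ} {μ : Measure ℝ} (h : AEStronglyMeasurable u μ) :
    AEStronglyMeasurable (fun r : ℝ => ‖u r‖ / r) μ :=
  h.norm.mul (by fun_prop : Measurable fun r : ℝ => r⁻¹).aestronglyMeasurable

/-- Hardy's inequality on a half line `(α, ∞)`, away from the origin. -/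
theorem hardy_away {m : ℕ} (hm : 1 ≤ m) {p v : ℝ → ℂ} (h : IsPrim p v)
    (hp : MemLp p 2 (radMeas (2 * m + 1))) (hv : MemLp v 2 (radMeas (2 * m + 1)))
    {α : ℝ} (hα : 0 < α) :
    IntegrableOn (fun r => (‖p r‖ / r) ^ 2) (Ioi α) (radMeas (2 * m + 1)) ∧
    ∫ r in Ioi α, (‖p r‖ / r) ^ 2 ∂(radMeas (2 * m + 1))
      ≤ (∫ r, ‖v r‖ ^ 2 ∂(radMeas (2 * m + 1))) / m ^ 2 := by
  set n := 2 * m + 1 with hn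
  have hpα : MemLp p 2 ((radMeas n).restrict (Ioi α)) := hp.restrict _
  have hvα : MemLp v 2 ((radMeas n).restrict (Ioi α)) := hv.restrict _
  -- Away from the origin `‖p‖ / r ≤ ‖p‖ / α`, so the left side is finite beforehand and √I can be
  -- cancelled at the end.
  have hpr : MemLp (fun r => ‖p r‖ / r) 2 ((radMeas n).restrict (Ioi α)) := by
    refine (hpα.const_mul (α⁻¹ : ℂ)).mono (aesm_div hpα.1) ?_
    rw [ae_restrict_iff' measurableSet_Ioi]
    refine Filter.Eventually.of_forall fun r hr => ?_
    have hr : α < r := hr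
    have hr0 : 0 < r := hα.trans hr
    rw [norm_div, norm_norm, Real.norm_of_nonneg hr0.le, norm_mul, norm_inv,
      Complex.norm_real, Real.norm_of_nonneg hα.le, div_eq_inv_mul]
    gcongr
  have hI := hpr.integrable_sq
  have hE := hv.norm.integrable_sq
  refine ⟨hI, ?_⟩
  set I := ∫ r in Ioi α, (‖p r‖ / r) ^ 2 ∂(radMeas n)
  set E := ∫ r, ‖v r‖ ^ 2 ∂(radMeas n)
  have hI0 : 0 ≤ I := integral_nonneg fun r => by positivity
  have hE0 : 0 ≤ E := integral_nonneg fun r => by positivity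
  have hcs := integral_mul_le_sqrt hpr hvα.norm
  have hEα : ∫ r in Ioi α, ‖v r‖ ^ 2 ∂(radMeas n) ≤ E :=
    setIntegral_le_integral hE (Filter.Eventually.of_forall fun r => by positivity)
  have hint : Integrable (fun r => ‖p r‖ / r * ‖v r‖) ((radMeas n).restrict (Ioi α)) :=
    hpr.integrable_mul hvα.norm
  have hRi : IntegrableOn (fun r => 2 * m * (‖p r‖ / r) ^ 2 - 2 * (‖p r‖ / r * ‖v r‖)) (Ioi α)
    (radMeas n) := (hI.const_mul _).sub (hint.const_mul _)
  -- Here S = r^{2m} |p|² and S' = rⁿ (2m |p|²/r² + 2 Re(p̄ v)/r). The boundary term -S(α) is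
  -- nonpositive and can be dropped, so the bound does not depend on α.
  have key := integral_Ioi_le_of_isPrim hα ((IsPrim.pow (2 * m)).mul_real (h.re_conj_mul h))
    (R := fun r => r ^ n • (2 * m * (‖p r‖ / r) ^ 2 - 2 * (‖p r‖ / r * ‖v r‖)))
    (F := fun r => r ^ n • (‖p r‖ / r) ^ 2) (by
      rw [ae_restrict_iff' measurableSet_Ioi]
      refine Filter.Eventually.of_forall fun r hr => ?_
      have hr : 0 < r := hr
      have h1 := neg_le_of_abs_le (abs_re_conj_mul_le (p r) (v r))
      have e1 : r ^ n • (2 * m * (‖p r‖ / r) ^ 2 - 2 * (‖p r‖ / r * ‖v r‖))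
          = r ^ (2 * m) * (2 * m / r * ‖p r‖ ^ 2 + 2 * -(‖p r‖ * ‖v r‖)) := by
        rw [hn, pow_succ, smul_eq_mul]; field_simp; ring
      have e2 : ((2 * m : ℕ) : ℝ) / r * r ^ (2 * m) * ((p r).re * (p r).re + (p r).im * (p r).im)
          + r ^ (2 * m) * ((v r).re * (p r).re + (p r).re * (v r).re
            + ((v r).im * (p r).im + (p r).im * (v r).im))
          = r ^ (2 * m) * (2 * m / r * ‖p r‖ ^ 2
            + 2 * ((p r).re * (v r).re + (p r).im * (v r).im)) := by
        rw [sq_norm_eq]; push_cast; ring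
      rw [e1, e2]
      gcongr)
    ((integrableOn_radMeas_iff hα.le).1 hRi) ((integrableOn_radMeas_iff hα.le).1 hI) (by
      intro r hr
      have hr : 0 < r := hα.trans hr
      rw [← sq_norm_eq, hn, pow_succ, smul_eq_mul]
      apply le_of_eq; field_simp; ring)
  rw [← integral_radMeas_Ioi hα.le, integral_sub (hI.const_mul _) (hint.const_mul _),
    integral_const_mul, integral_const_mul, ← sq_norm_eq] at key
  have h1 : ∫ r in Ioi α, ‖p r‖ / r * ‖v r‖ ∂(radMeas n) ≤ √I * √E :=
    (integral_mono hint hint.abs fun r => le_abs_self _).trans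
      (hcs.trans (by gcongr))
  have h2 : 0 ≤ α ^ (2 * m) * ‖p α‖ ^ 2 := by positivity
  have h3 : m * I ≤ √I * √E := by
    change 2 * m * I - 2 * _ ≤ _ at key
    linarith
  have hm0 : (0 : ℝ) < m := by exact_mod_cast hm
  rw [le_div_iff₀ (by positivity)]
  rcases hI0.eq_or_lt with h0 | h0
  · rw [← h0]; simpa using hE0
  have h4 : m * √I ≤ √E := by
    have : √I * (m * √I) ≤ √I * √E := by
      calc √I * (m * √I) = m * (√I * √I) := by ring
        _ = m * I := by rw [Real.mul_self_sqrt hI0]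
        _ ≤ _ := h3
    exact le_of_mul_le_mul_left this (Real.sqrt_pos.2 h0)
  calc I * m ^ 2 = (m * √I) ^ 2 := by rw [mul_pow, Real.sq_sqrt hI0]; ring
    _ ≤ √E ^ 2 := by gcongr
    _ = E := Real.sq_sqrt hE0

/-- Hardy's inequality for radial functions. -/
theorem hardy {m : ℕ} (hm : 1 ≤ m) {p v : ℝ → ℂ} (h : IsPrim p v)
    (hp : MemLp p 2 (radMeas (2 * m + 1))) (hv : MemLp v 2 (radMeas (2 * m + 1))) :
    MemLp (fun r => ‖p r‖ / r) 2 (radMeas (2 * m + 1)) ∧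
    ∫ r, (‖p r‖ / r) ^ 2 ∂(radMeas (2 * m + 1))
      ≤ (∫ r, ‖v r‖ ^ 2 ∂(radMeas (2 * m + 1))) / m ^ 2 := by
  set n := 2 * m + 1 with hn
  set E := ∫ r, ‖v r‖ ^ 2 ∂(radMeas n)
  -- Exhausting the half line by (1/(k+1), ∞) turns the uniform bounds into integrability up to the
  -- origin.
  have hc : AECover (radMeas n) Filter.atTop fun k : ℕ => Ioi (1 / ((k : ℝ) + 1)) := by
    have := aecover_Ioi_of_Ioi (μ := radMeas n) (l := Filter.atTop)
      (a := fun k : ℕ => 1 / ((k : ℝ) + 1)) (A := 0) tendsto_one_div_add_atTop_nhds_zero_nat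
    rwa [restrict_radMeas_zero] at this
  have hpos : ∀ k : ℕ, (0 : ℝ) < 1 / ((k : ℝ) + 1) := fun k => by positivity
  have hI : Integrable (fun r => (‖p r‖ / r) ^ 2) (radMeas n) := by
    refine hc.integrable_of_integral_bounded_of_nonneg_ae (E / m ^ 2)
      (fun k => (hardy_away hm h hp hv (hpos k)).1)
      (Filter.Eventually.of_forall fun r => by positivity)
      (Filter.Eventually.of_forall fun k => (hardy_away hm h hp hv (hpos k)).2)
  refine ⟨(memLp_two_iff_integrable_sq (aesm_div hp.1)).2 hI, ?_⟩
  exact le_of_tendsto' (hc.integral_tendsto_of_countably_generated hI)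
    fun k => (hardy_away hm h hp hv (hpos k)).2

/-- The multiplier estimate for the radial resolvent equation. -/
theorem radial_multiplier {n : ℕ} (hn : 2 ≤ n) {u y g : ℝ → ℂ} {κ ε : ℝ} (hε : 0 ≤ ε)
    (hu : IsPrim u (fun r => y r + Complex.I * κ * u r))
    (hy : IsPrim y (fun r => -(((n / r : ℝ) : ℂ) * y r) - Complex.I * κ * ((n / r : ℝ) : ℂ) * u r
      - Complex.I * κ * y r + ((r⁻¹ : ℝ) : ℂ) * g r - Complex.I * ((2 * ε * κ : ℝ) : ℂ) * u r))
    (hu2 : MemLp u 2 (radMeas n)) (hy2 : MemLp y 2 (radMeas n)) (hg2 : MemLp g 2 (radMeas n))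
    (hx2 : MemLp (fun r => ‖u r‖ / r) 2 (radMeas n)) :
    ∫ r, ‖y r‖ ^ 2 ∂(radMeas n) ≤
      2 * (√(∫ r, ‖y r‖ ^ 2 ∂(radMeas n)) * √(∫ r, ‖g r‖ ^ 2 ∂(radMeas n)))
      + n * (√(∫ r, (‖u r‖ / r) ^ 2 ∂(radMeas n)) * √(∫ r, ‖g r‖ ^ 2 ∂(radMeas n)))
      + 2 * ε * (√(∫ r, ‖u r‖ ^ 2 ∂(radMeas n)) * √(∫ r, ‖g r‖ ^ 2 ∂(radMeas n))) := by
  have i1 : Integrable (fun r => ‖y r‖ ^ 2) (radMeas n) := hy2.norm.integrable_sq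
  have i2 : Integrable (fun r => |‖y r‖ * ‖g r‖|) (radMeas n) := (hy2.norm.integrable_mul hg2.norm).abs
  have i3 : Integrable (fun r => |‖u r‖ / r * ‖g r‖|) (radMeas n) := (hx2.integrable_mul hg2.norm).abs
  have i4 : Integrable (fun r => |‖u r‖ * ‖g r‖|) (radMeas n) := (hu2.norm.integrable_mul hg2.norm).abs
  have j1 : Integrable (fun r => |‖u r‖ / r * ‖y r‖|) (radMeas n) := (hx2.integrable_mul hy2.norm).abs
  have j2 : Integrable (fun r => |‖u r‖ * ‖y r‖|) (radMeas n) := (hu2.norm.integrable_mul hy2.norm).abs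
  have j3 : Integrable (fun r => |‖u r‖ / r * ‖u r‖|) (radMeas n) := (hx2.integrable_mul hu2.norm).abs
  have hRi : Integrable (fun r => 2⁻¹ * ‖y r‖ ^ 2 - (|‖y r‖ * ‖g r‖|
      + n / 2 * |‖u r‖ / r * ‖g r‖| + ε * |‖u r‖ * ‖g r‖|)) (radMeas n) :=
    (i1.const_mul _).sub ((i2.add (i3.const_mul _)).add (i4.const_mul _))
  have hFi : Integrable (fun r => 2⁻¹ * ‖y r‖ ^ 2 + n / 2 * |‖u r‖ / r * ‖y r‖|
      + ε * (|‖u r‖ * ‖y r‖| + n / 2 * |‖u r‖ / r * ‖u r‖|)) (radMeas n) :=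
    ((i1.const_mul _).add (j1.const_mul _)).add ((j2.add (j3.const_mul _)).const_mul _)
  have hn1 : (2 : ℝ) ≤ n := by exact_mod_cast hn
  -- The Morawetz-type functional ½ rⁿ⁺¹|y|² + (n/2) rⁿ Re(ū y) + ε (rⁿ⁺¹ Re(ū y) + ((n-1)/2)
  -- rⁿ|u|²). The weights n/2 and (n-1)/2 are chosen so that, apart from ½ rⁿ|y|² and the terms with
  -- g, the derivative consists only of ε rⁿ times the form in `hq`.
  have hS := ((((IsPrim.pow (n + 1)).mul_real (hy.re_conj_mul hy)).const_mul_real 2⁻¹).add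
    (((IsPrim.pow n).mul_real (hu.re_conj_mul hy)).const_mul_real (n / 2))).add
    ((((IsPrim.pow (n + 1)).mul_real (hu.re_conj_mul hy)).add
    (((IsPrim.pow n).mul_real (hu.re_conj_mul hu)).const_mul_real ((n - 1) / 2))).const_mul_real ε)
  have key := integral_nonpos_of_isPrim hS
    (R := fun r => r ^ n • (2⁻¹ * ‖y r‖ ^ 2 - (|‖y r‖ * ‖g r‖|
      + n / 2 * |‖u r‖ / r * ‖g r‖| + ε * |‖u r‖ * ‖g r‖|)))
    (F := fun r => r ^ n • (2⁻¹ * ‖y r‖ ^ 2 + n / 2 * |‖u r‖ / r * ‖y r‖|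
      + ε * (|‖u r‖ * ‖y r‖| + n / 2 * |‖u r‖ / r * ‖u r‖|))) (by
      rw [ae_restrict_iff' measurableSet_Ioi]
      refine Filter.Eventually.of_forall fun r hr => ?_
      have hr : 0 < r := hr
      have h1 := neg_le_of_abs_le (abs_re_conj_mul_le (y r) (g r))
      have h2 := neg_le_of_abs_le (abs_re_conj_mul_le (u r) (g r))
      -- Completing the square in r|y| - (n/2)|u| leaves n(n-2)/4 |u|², which is where n ≥ 2 enters.
      have hq : 0 ≤ r * ‖y r‖ ^ 2 + n * ((u r).re * (y r).re + (u r).im * (y r).im)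
          + n * (n - 1) / 2 * ‖u r‖ ^ 2 / r := by
        have h3 := neg_le_of_abs_le (abs_re_conj_mul_le (u r) (y r))
        have h4 : 0 ≤ r * ‖y r‖ ^ 2 - n * (‖u r‖ * ‖y r‖) + n * (n - 1) / 2 * ‖u r‖ ^ 2 / r := by
          have : r * ‖y r‖ ^ 2 - n * (‖u r‖ * ‖y r‖) + n * (n - 1) / 2 * ‖u r‖ ^ 2 / r
              = ((r * ‖y r‖ - n / 2 * ‖u r‖) ^ 2 + n * (n - 2) / 4 * ‖u r‖ ^ 2) / r := by
            field_simp; ring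
          rw [this]
          have : (0 : ℝ) ≤ n - 2 := by linarith
          positivity
        nlinarith
      have e0 : r ^ (n + 1) = r ^ n * r := pow_succ _ _
      rw [abs_of_nonneg (by positivity : 0 ≤ ‖y r‖ * ‖g r‖),
        abs_of_nonneg (by positivity : 0 ≤ ‖u r‖ / r * ‖g r‖),
        abs_of_nonneg (by positivity : 0 ≤ ‖u r‖ * ‖g r‖)]
      have e1 : r ^ n • (2⁻¹ * ‖y r‖ ^ 2 - (‖y r‖ * ‖g r‖
          + n / 2 * (‖u r‖ / r * ‖g r‖) + ε * (‖u r‖ * ‖g r‖)))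
          ≤ r ^ n * (2⁻¹ * ‖y r‖ ^ 2 + ((y r).re * (g r).re + (y r).im * (g r).im)
          + n / (2 * r) * ((u r).re * (g r).re + (u r).im * (g r).im)
          + ε * ((r * ‖y r‖ ^ 2 + n * ((u r).re * (y r).re + (u r).im * (y r).im)
          + n * (n - 1) / 2 * ‖u r‖ ^ 2 / r) + ((u r).re * (g r).re + (u r).im * (g r).im))) := by
        rw [smul_eq_mul]
        apply mul_le_mul_of_nonneg_left _ (by positivity)
        have h5 : n / 2 * (‖u r‖ / r * ‖g r‖) = n / (2 * r) * (‖u r‖ * ‖g r‖) := by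
          field_simp
        have h6 : n / (2 * r) * -(‖u r‖ * ‖g r‖)
            ≤ n / (2 * r) * ((u r).re * (g r).re + (u r).im * (g r).im) := by gcongr
        have h7 : ε * -(‖u r‖ * ‖g r‖) ≤ ε * ((u r).re * (g r).re + (u r).im * (g r).im) := by
          gcongr
        have h8 := mul_nonneg hε hq
        rw [h5]
        linarith
      refine e1.trans (le_of_eq ?_)
      rw [sq_norm_eq, sq_norm_eq, e0]
      simp only [Complex.add_re, Complex.sub_re, Complex.neg_re, Complex.mul_re, Complex.I_re,
        Complex.I_im, Complex.ofReal_re, Complex.ofReal_im, Complex.add_im, Complex.sub_im,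
        Complex.neg_im, Complex.mul_im]
      push_cast
      field_simp
      ring)
    (integrable_radMeas_iff.1 hRi) (integrable_radMeas_iff.1 hFi) (by
      intro r hr
      have h1 := abs_re_conj_mul_le (u r) (y r)
      rw [abs_of_nonneg (by positivity : 0 ≤ ‖u r‖ / r * ‖y r‖),
        abs_of_nonneg (by positivity : 0 ≤ ‖u r‖ / r * ‖u r‖),
        abs_of_nonneg (by positivity : 0 ≤ ‖u r‖ * ‖y r‖), ← sq_norm_eq, ← sq_norm_eq,
        smul_eq_mul, pow_succ]
      have e1 : r * (r ^ n * (2⁻¹ * ‖y r‖ ^ 2 + n / 2 * (‖u r‖ / r * ‖y r‖)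
          + ε * (‖u r‖ * ‖y r‖ + n / 2 * (‖u r‖ / r * ‖u r‖))))
          = 2⁻¹ * (r ^ n * r * ‖y r‖ ^ 2) + n / 2 * (r ^ n * (‖u r‖ * ‖y r‖))
          + ε * (r ^ n * r * (‖u r‖ * ‖y r‖) + n / 2 * (r ^ n * ‖u r‖ ^ 2)) := by
        field_simp
      rw [e1]
      have hn2 : (0 : ℝ) ≤ (n - 1) / 2 := by linarith
      refine (abs_add_le _ _).trans (add_le_add ((abs_add_le _ _).trans (add_le_add ?_ ?_)) ?_)
      · rw [abs_of_nonneg (by positivity)]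
      · rw [abs_mul, abs_of_nonneg (by positivity : (0 : ℝ) ≤ n / 2), abs_mul,
          abs_of_nonneg (by positivity : (0 : ℝ) ≤ r ^ n)]
        gcongr
      · rw [abs_mul, abs_of_nonneg hε]
        refine mul_le_mul_of_nonneg_left ((abs_add_le _ _).trans (add_le_add ?_ ?_)) hε
        · rw [abs_mul, abs_of_nonneg (by positivity : (0 : ℝ) ≤ r ^ n * r)]
          gcongr
        · rw [abs_mul, abs_of_nonneg hn2,
            abs_of_nonneg (by positivity : (0 : ℝ) ≤ r ^ n * ‖u r‖ ^ 2)]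
          gcongr
          linarith)
  have k3 := i3.const_mul (n / 2 : ℝ)
  have k4 := i4.const_mul ε
  have k23 : Integrable (fun r => |‖y r‖ * ‖g r‖| + n / 2 * |‖u r‖ / r * ‖g r‖|) (radMeas n) :=
    i2.add k3
  have k234 : Integrable (fun r => |‖y r‖ * ‖g r‖| + n / 2 * |‖u r‖ / r * ‖g r‖|
    + ε * |‖u r‖ * ‖g r‖|) (radMeas n) := k23.add k4
  rw [← integral_radMeas, integral_sub (i1.const_mul _) k234, integral_add k23 k4,
    integral_add i2 k3, integral_const_mul, integral_const_mul, integral_const_mul] at key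
  have c1 := integral_mul_le_sqrt hy2.norm hg2.norm
  have c2 := mul_le_mul_of_nonneg_left (integral_mul_le_sqrt hx2 hg2.norm)
    (by positivity : (0 : ℝ) ≤ n)
  have c3 := mul_le_mul_of_nonneg_left (integral_mul_le_sqrt hu2.norm hg2.norm) hε
  linarith

/-! ### Attained minima and the quadratic inequality behind the constant -/

section Constants

theorem exists_min_of_sublevel {X : Type*} [TopologicalSpace X] {f : X → ℝ} {U C : Set X}
    (hC : IsCompact C) (hCU : C ⊆ U) (hf : ContinuousOn f C) {x₀ : X} (hx₀ : x₀ ∈ U)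
    (h : ∀ x ∈ U, f x ≤ f x₀ → x ∈ C) : ∃ x ∈ U, ∀ y ∈ U, f x ≤ f y := by
  obtain ⟨x, hx, hmin⟩ := hC.exists_isMinOn ⟨x₀, h x₀ hx₀ le_rfl⟩ hf
  refine ⟨x, hCU hx, fun y hy => ?_⟩
  by_cases hy' : f y ≤ f x₀
  · exact hmin (h y hy hy')
  · exact (hmin (h x₀ hx₀ le_rfl)).trans (not_le.1 hy').le

theorem isLeast_sInf_image {X : Type*} {f : X → ℝ} {U : Set X}
    (h : ∃ x ∈ U, ∀ y ∈ U, f x ≤ f y) : IsLeast (f '' U) (sInf (f '' U)) := by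
  obtain ⟨x, hx, hmin⟩ := h
  have : IsLeast (f '' U) (f x) := ⟨mem_image_of_mem f hx, by rintro _ ⟨y, hy, rfl⟩; exact hmin y hy⟩
  rwa [this.csInf_eq]

theorem KFun_pos {d : ℕ} (hd : 1 ≤ d) {δ γ : ℝ} (hγ : 0 < γ) : 0 < KFun d δ γ := by
  have : (0 : ℝ) < d := by exact_mod_cast hd
  unfold KFun
  positivity

/-- The linear term keeps γ√δ bounded and the term √δ/(2γ) keeps γ away from 0, so sublevel sets
stay inside compact subsets of the open half line. -/
theorem KFun_bounds {d : ℕ} (hd : 1 ≤ d) {δ γ B : ℝ} (hγ : 0 < γ)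
    (h : KFun d δ γ ≤ B) : γ * √δ ≤ 4 * d * B ∧ √δ ≤ 2 * B ^ 2 * γ := by
  have hd0 : (0 : ℝ) < d := by exact_mod_cast hd
  have hs := Real.sqrt_nonneg δ
  unfold KFun at h
  have h1 := Real.sqrt_nonneg ((8 * d + 2 + γ * √δ) ^ 2 / (16 * (d : ℝ) ^ 2) + √δ / (2 * γ))
  have h2 : 0 ≤ (8 * d + 2 + γ * √δ) / (4 * d) := by positivity
  constructor
  · have : (8 * d + 2 + γ * √δ) / (4 * d) ≤ B := by linarith
    rw [div_le_iff₀ (by positivity)] at this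
    nlinarith
  · have h3 : √((8 * d + 2 + γ * √δ) ^ 2 / (16 * (d : ℝ) ^ 2) + √δ / (2 * γ)) ≤ B := by linarith
    have hB : 0 ≤ B := h1.trans h3
    rw [Real.sqrt_le_left hB] at h3
    have h4 : √δ / (2 * γ) ≤ B ^ 2 := by
      have : 0 ≤ (8 * d + 2 + γ * √δ) ^ 2 / (16 * (d : ℝ) ^ 2) := by positivity
      linarith
    rw [div_le_iff₀ (by positivity)] at h4
    linarith

theorem continuousOn_KFun (d : ℕ) :
    ContinuousOn (fun q : ℝ × ℝ => KFun d q.1 q.2) {q | q.2 ≠ 0} := by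
  unfold KFun
  have h1 : Continuous fun q : ℝ × ℝ => (8 * (d : ℝ) + 2 + q.2 * √q.1) / (4 * d) := by fun_prop
  have h2 : Continuous fun q : ℝ × ℝ => (8 * (d : ℝ) + 2 + q.2 * √q.1) ^ 2 / (16 * (d : ℝ) ^ 2) := by
    fun_prop
  have h3 : ContinuousOn (fun q : ℝ × ℝ => √q.1 / (2 * q.2)) {q | q.2 ≠ 0} :=
    ContinuousOn.div (by fun_prop) (by fun_prop) fun q hq => mul_ne_zero two_ne_zero hq
  exact h1.continuousOn.add (h2.continuousOn.add h3).sqrt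

theorem KFun_isLeast {d : ℕ} (hd : 1 ≤ d) {δ : ℝ} (hδ : 0 < δ) :
    IsLeast (KFun d δ '' Ioi 0) (K d δ) := by
  have hs := Real.sqrt_pos.2 hδ
  have hB : 0 < KFun d δ 1 := KFun_pos hd one_pos
  have hlow : 0 < √δ / (2 * KFun d δ 1 ^ 2) := by positivity
  refine isLeast_sInf_image (exists_min_of_sublevel
    (isCompact_Icc (a := √δ / (2 * KFun d δ 1 ^ 2)) (b := 4 * d * KFun d δ 1 / √δ))
    (fun x hx => lt_of_lt_of_le hlow hx.1) ?_ (x₀ := 1) (mem_Ioi.2 one_pos) ?_)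
  · have : KFun d δ = (fun q : ℝ × ℝ => KFun d q.1 q.2) ∘ fun γ => (δ, γ) := rfl
    rw [this]
    refine (continuousOn_KFun d).comp (by fun_prop) fun x hx => ?_
    exact (lt_of_lt_of_le hlow hx.1).ne'
  · intro γ hγ h
    obtain ⟨h1, h2⟩ := KFun_bounds hd hγ h
    exact ⟨by rw [div_le_iff₀ (by positivity)]; linarith, by rwa [le_div_iff₀ hs]⟩

theorem kappa_isLeast {d : ℕ} (hd : 1 ≤ d) : IsLeast (kappaFun d '' Ioi 0) (kappa d) := by
  have hd0 : (0 : ℝ) < d := by exact_mod_cast hd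
  -- Minimising jointly in (δ, γ) avoids any continuity statement about δ ↦ `K d δ`, itself an
  -- infimum. On a sublevel set the first entry of the maximum bounds δ below by `δ₀`; the two
  -- bounds for `KFun` then confine γ, and their product bounds δ above.
  set M : ℝ × ℝ → ℝ := fun q => max ((1 + 1 / q.1) / (d : ℝ) ^ 2) (KFun d q.1 q.2 / d)
  set C := M (1, 1)
  have hC : 0 < C := lt_max_of_lt_left (by positivity)
  set δ₀ := 1 / (C * (d : ℝ) ^ 2)
  set B := C * d
  have hB : 0 < B := by positivity
  have hδ₀ : 0 < δ₀ := by positivity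
  have hs := Real.sqrt_pos.2 hδ₀
  have hlow : 0 < √δ₀ / (2 * B ^ 2) := by positivity
  obtain ⟨⟨δ, γ⟩, hmem, hmin⟩ : ∃ q ∈ Ioi (0 : ℝ) ×ˢ Ioi (0 : ℝ),
      ∀ q' ∈ Ioi (0 : ℝ) ×ˢ Ioi (0 : ℝ), M q ≤ M q' := by
    refine exists_min_of_sublevel ((isCompact_Icc (a := δ₀) (b := 2 * (2 * B ^ 2) * (4 * d * B))).prod
      (isCompact_Icc (a := √δ₀ / (2 * B ^ 2)) (b := 4 * d * B / √δ₀)))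
      (fun q hq => ⟨lt_of_lt_of_le hδ₀ hq.1.1, lt_of_lt_of_le hlow hq.2.1⟩) ?_
      (x₀ := (1, 1)) ⟨mem_Ioi.2 one_pos, mem_Ioi.2 one_pos⟩ ?_
    · apply ContinuousOn.sup
      · refine ContinuousOn.div_const (continuousOn_const.add ?_) _
        exact continuousOn_const.div continuousOn_fst fun q hq => (lt_of_lt_of_le hδ₀ hq.1.1).ne'
      · refine ContinuousOn.div_const ((continuousOn_KFun d).mono fun q hq => ?_) _
        exact (lt_of_lt_of_le hlow hq.2.1).ne'
    · rintro ⟨δ, γ⟩ ⟨hδ, hγ⟩ h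
      have hδ : 0 < δ := hδ
      have hγ : 0 < γ := hγ
      have h1 : (1 + 1 / δ) / (d : ℝ) ^ 2 ≤ C := (le_max_left _ _).trans h
      have h2 : KFun d δ γ / d ≤ C := (le_max_right _ _).trans h
      rw [div_le_iff₀ (by positivity)] at h1 h2
      obtain ⟨h3, h4⟩ := KFun_bounds hd hγ h2
      have h5 : δ₀ ≤ δ := by
        have : 1 / δ ≤ C * (d : ℝ) ^ 2 := by linarith
        rw [div_le_iff₀ hδ] at this
        rw [div_le_iff₀ (by positivity)]; linarith
      have h6 : √δ₀ ≤ √δ := Real.sqrt_le_sqrt h5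
      refine ⟨⟨h5, ?_⟩, ?_, ?_⟩
      · calc δ = √δ * √δ := (Real.mul_self_sqrt hδ.le).symm
          _ ≤ 2 * B ^ 2 * γ * √δ := by gcongr
          _ = 2 * B ^ 2 * (γ * √δ) := by ring
          _ ≤ 2 * B ^ 2 * (4 * d * B) := by gcongr
          _ ≤ _ := by nlinarith [show 0 ≤ 2 * B ^ 2 * (4 * d * B) by positivity]
      · rw [div_le_iff₀ (by positivity)]; linarith
      · rw [le_div_iff₀ hs]
        calc γ * √δ₀ ≤ γ * √δ := by gcongr
          _ ≤ _ := h3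
  refine isLeast_sInf_image ⟨δ, hmem.1, fun δ' hδ' => ?_⟩
  obtain ⟨⟨γ', hγ', hK⟩, -⟩ := KFun_isLeast hd (mem_Ioi.1 hδ')
  calc kappaFun d δ ≤ M (δ, γ) :=
        max_le_max le_rfl (div_le_div_of_nonneg_right
          ((KFun_isLeast hd hmem.1).2 (mem_image_of_mem _ hmem.2)) hd0.le)
    _ ≤ M (δ', γ') := hmin _ ⟨hδ', hγ'⟩
    _ = kappaFun d δ' := by simp only [M, kappaFun, hK]

/-- In the application e, X, Y, N are the norms of y, p/r, p, g, and k = √Re μ. The term 2εY is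
eliminated by (2εY)² ≤ δ · 2εk Y² ≤ δ X N ≤ δ e N/d and a weighted arithmetic-geometric mean. What
remains is e² ≤ 2b e N + (√δ/(2γ)) N² with 2b = 4 + 1/d + γ√δ/(2d), and `KFun` is its positive root
for N = 1. -/
theorem le_KFun_mul {d : ℕ} (hd : 1 ≤ d) {e X Y N ε k δ γ : ℝ} (he : 0 ≤ e)
    (hN : 0 ≤ N) (hε : 0 ≤ ε) (hk : 0 < k) (hδ : 0 < δ) (hγ : 0 < γ)
    (h1 : 2 * ε * k ≤ δ * k ^ 2) (h2 : 2 * ε * k * Y ^ 2 ≤ X * N) (h3 : X ≤ e / d)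
    (h4 : e ^ 2 ≤ 2 * (e * N) + (2 * d + 1) * (X * N) + 2 * ε * (Y * N)) :
    e ≤ KFun d δ γ * N := by
  have hd0 : (0 : ℝ) < d := by exact_mod_cast hd
  have hs := Real.sqrt_pos.2 hδ
  have hss := Real.sq_sqrt hδ.le
  have h5 : 2 * ε ≤ δ * k := by
    have : 2 * ε * k ≤ δ * k * k := by linarith
    exact le_of_mul_le_mul_right this hk
  have h6 : (2 * ε * Y) ^ 2 ≤ δ * (e * N / d) := by
    calc (2 * ε * Y) ^ 2 = 2 * ε * Y ^ 2 * (2 * ε) := by ring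
      _ ≤ 2 * ε * Y ^ 2 * (δ * k) := by gcongr
      _ = δ * (2 * ε * k * Y ^ 2) := by ring
      _ ≤ δ * (X * N) := by gcongr
      _ ≤ δ * (e / d * N) := by gcongr
      _ = _ := by ring
  have h7 : 2 * ε * Y ≤ √δ * (γ * e / (2 * d) + N / (2 * γ)) := by
    apply le_of_sq_le_sq _ (by positivity)
    refine h6.trans ?_
    rw [mul_pow, hss]
    have : e * N / d ≤ (γ * e / (2 * d) + N / (2 * γ)) ^ 2 := by
      -- The split into γe/(2d) and N/(2γ) is where the free parameter γ of `KFun` comes from.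
      have h8 : e * N / d = 4 * (γ * e / (2 * d)) * (N / (2 * γ)) := by field_simp; ring
      rw [h8]
      nlinarith [sq_nonneg (γ * e / (2 * d) - N / (2 * γ))]
    gcongr
  set b := (8 * d + 2 + γ * √δ) / (4 * d) with hb
  have hKF : KFun d δ γ = b + √(b ^ 2 + √δ / (2 * γ)) := by
    rw [KFun, hb, div_pow]; congr 3; ring
  have h9 : e ^ 2 ≤ 2 * b * e * N + √δ / (2 * γ) * N ^ 2 := by
    have e1 : 2 * b * e * N + √δ / (2 * γ) * N ^ 2
        = 2 * (e * N) + (2 * d + 1) * (e / d * N)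
          + √δ * (γ * e / (2 * d) + N / (2 * γ)) * N := by
      rw [hb]; field_simp; ring
    rw [e1]
    have e2 : (2 * (d : ℝ) + 1) * (X * N) ≤ (2 * d + 1) * (e / d * N) := by gcongr
    have e3 : 2 * ε * Y * N ≤ √δ * (γ * e / (2 * d) + N / (2 * γ)) * N := by gcongr
    linarith
  rw [hKF]
  have h10 : e - b * N ≤ √((b ^ 2 + √δ / (2 * γ)) * N ^ 2) := by
    apply Real.le_sqrt_of_sq_le
    nlinarith
  rw [Real.sqrt_mul (by positivity), Real.sqrt_sq hN] at h10
  linarith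

end Constants

/-! ### Korányi norm, dilations and polar coordinates -/

section Koranyi

variable {d : ℕ}

theorem koranyi_base_nonneg (p : H d) : 0 ≤ ‖p.1‖ ^ 4 + p.2 ^ 2 := by positivity

theorem koranyi_nonneg (p : H d) : 0 ≤ koranyi p := Real.rpow_nonneg (koranyi_base_nonneg p) _

theorem koranyi_pow_four (p : H d) : koranyi p ^ 4 = ‖p.1‖ ^ 4 + p.2 ^ 2 := by
  rw [koranyi, ← Real.rpow_natCast, ← Real.rpow_mul (koranyi_base_nonneg p)]
  norm_num

theorem koranyi_eq_of_pow_four {p : H d} {r : ℝ} (hr : 0 ≤ r) (h : r ^ 4 = ‖p.1‖ ^ 4 + p.2 ^ 2) :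
    koranyi p = r := by
  rw [← koranyi_pow_four] at h
  exact ((pow_left_inj₀ hr (koranyi_nonneg p) (by norm_num)).1 h).symm

theorem continuous_koranyi : Continuous (koranyi : H d → ℝ) := by
  unfold koranyi
  exact Continuous.rpow_const (by fun_prop) fun p => Or.inr (by norm_num)

theorem measurable_koranyi : Measurable (koranyi : H d → ℝ) := continuous_koranyi.measurable

theorem norm_le_koranyi (p : H d) : ‖p.1‖ ≤ koranyi p := by
  apply le_of_pow_le_pow_left₀ (n := 4) (by norm_num) (koranyi_nonneg p)
  rw [koranyi_pow_four]
  nlinarith [sq_nonneg p.2]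

theorem abs_le_koranyi_sq (p : H d) : |p.2| ≤ koranyi p ^ 2 := by
  apply abs_le_of_sq_le_sq _ (by positivity)
  have := koranyi_pow_four p
  have h4 : (koranyi p ^ 2) ^ 2 = koranyi p ^ 4 := by ring
  rw [h4, this]
  have : 0 ≤ ‖p.1‖ ^ 4 := by positivity
  linarith

theorem koranyi_eq_zero {p : H d} : koranyi p = 0 ↔ p = 0 := by
  constructor
  · intro h
    have h1 := norm_le_koranyi p
    have h2 := abs_le_koranyi_sq p
    rw [h] at h1 h2
    ext1
    · exact norm_le_zero_iff.1 h1
    · exact abs_nonpos_iff.1 (by simpa using h2)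
  · rintro rfl
    exact koranyi_eq_of_pow_four le_rfl (by simp)

theorem koranyi_pos {p : H d} (hp : p ≠ 0) : 0 < koranyi p :=
  (koranyi_nonneg p).lt_of_ne fun h => hp (koranyi_eq_zero.1 h.symm)

/-- The weight `|z|² / ρ²`, the squared length of the horizontal gradient of `ρ`. -/
noncomputable def wt (p : H d) : ℝ := ‖p.1‖ ^ 2 / koranyi p ^ 2

theorem wt_nonneg (p : H d) : 0 ≤ wt p := by unfold wt; positivity

theorem wt_le_one (p : H d) : wt p ≤ 1 := by
  unfold wt
  apply div_le_one_of_le₀ _ (by positivity)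
  exact pow_le_pow_left₀ (norm_nonneg _) (norm_le_koranyi p) 2

theorem measurable_wt : Measurable (wt : H d → ℝ) := by
  unfold wt
  exact (by fun_prop : Measurable fun p : H d => ‖p.1‖ ^ 2).div (measurable_koranyi.pow_const 2)

/-- The automorphic dilation `(z, t) ↦ (R z, R² t)`. -/
noncomputable def dil (R : ℝ) : H d →ₗ[ℝ] H d :=
  LinearMap.prodMap (R • LinearMap.id) ((R ^ 2) • LinearMap.id)

theorem dil_apply (R : ℝ) (p : H d) : dil R p = (R • p.1, R ^ 2 * p.2) := rfl

theorem koranyi_dil {R : ℝ} (hR : 0 ≤ R) (p : H d) : koranyi (dil R p) = R * koranyi p := by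
  apply koranyi_eq_of_pow_four (mul_nonneg hR (koranyi_nonneg p))
  rw [mul_pow, koranyi_pow_four, dil_apply, norm_smul, Real.norm_of_nonneg hR]
  ring

theorem wt_dil {R : ℝ} (hR : 0 < R) (p : H d) : wt (dil R p) = wt p := by
  unfold wt
  rw [koranyi_dil hR.le, dil_apply, norm_smul, Real.norm_of_nonneg hR.le, mul_pow, mul_pow,
    mul_div_mul_left _ _ (by positivity)]

theorem det_dil (R : ℝ) : LinearMap.det (dil R : H d →ₗ[ℝ] H d) = R ^ (2 * d + 2) := by
  unfold dil
  rw [LinearMap.det_prodMap, LinearMap.det_smul, LinearMap.det_smul]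
  simp
  ring

instance : (volume : Measure (H d)).IsAddHaarMeasure := by
  rw [Measure.volume_eq_prod]; infer_instance

theorem map_dil {R : ℝ} (hR : 0 < R) : Measure.map (dil R) (volume : Measure (H d))
    = ENNReal.ofReal ((R ^ (2 * d + 2))⁻¹) • volume := by
  rw [Measure.map_linearMap_addHaar_eq_smul_addHaar, det_dil, abs_of_nonneg (by positivity)]
  rw [det_dil]; positivity

theorem measurable_dil (R : ℝ) : Measurable (dil R : H d → H d) :=
  (LinearMap.continuous_of_finiteDimensional _).measurable

/-- A dilation by R carries the unit ball to the ball of radius R with Jacobian R^{2d+2}, the power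
being the homogeneous dimension, and does not change W. -/
theorem lintegral_koranyi_le {W : H d → ℝ≥0∞} (hW : Measurable W)
    (hinv : ∀ R : ℝ, 0 < R → ∀ p, W (dil R p) = W p) {R : ℝ} (hR : 0 < R) :
    ∫⁻ p in {p | koranyi p ≤ R}, W p
      = ENNReal.ofReal (R ^ (2 * d + 2)) * ∫⁻ p in {p : H d | koranyi p ≤ 1}, W p := by
  have hm : MeasurableSet {p : H d | koranyi p ≤ R} :=
    measurableSet_le measurable_koranyi measurable_const
  have h1 : ∫⁻ p in {p | koranyi p ≤ R}, W p ∂(Measure.map (dil R) volume)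
      = ∫⁻ p in {p : H d | koranyi p ≤ 1}, W p := by
    rw [setLIntegral_map hm hW (measurable_dil R)]
    have : (dil R) ⁻¹' {p : H d | koranyi p ≤ R} = {p | koranyi p ≤ 1} := by
      ext p
      simp only [mem_preimage, mem_ofPred_eq, koranyi_dil hR.le]
      rw [mul_le_iff_le_one_right hR]
    rw [this]
    simp_rw [hinv R hR]
  rw [map_dil hR, Measure.restrict_smul, lintegral_smul_measure, smul_eq_mul] at h1
  rw [← h1, ← mul_assoc, ← ENNReal.ofReal_mul (by positivity), mul_inv_cancel₀ (by positivity)]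
  simp

theorem volume_koranyi_le_lt_top : volume {p : H d | koranyi p ≤ 1} < ⊤ := by
  refine lt_of_le_of_lt (measure_mono fun p hp => ?_)
    (measure_closedBall_lt_top (x := (0 : H d)) (r := 1))
  have hp : koranyi p ≤ 1 := hp
  rw [mem_closedBall_zero_iff, Prod.norm_def]
  refine max_le ((norm_le_koranyi p).trans hp) ?_
  have := abs_le_koranyi_sq p
  rw [Real.norm_eq_abs]
  exact this.trans (pow_le_one₀ (koranyi_nonneg p) hp)

theorem radMeas_Iic (n : ℕ) {R : ℝ} (hR : 0 ≤ R) :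
    radMeas n (Iic R) = ENNReal.ofReal (R ^ (n + 1) / (n + 1)) := by
  have h1 : radMeas n (Iic R) = ∫⁻ r in Ioc 0 R, ENNReal.ofReal (r ^ n) := by
    rw [radMeas, withDensity_apply _ measurableSet_Iic, Measure.restrict_restrict measurableSet_Iic,
      inter_comm, Ioi_inter_Iic]
  rw [h1, ← ofReal_integral_eq_lintegral_ofReal, ← intervalIntegral.integral_of_le hR, integral_pow]
  · simp
  · exact ((continuous_pow n).intervalIntegrable 0 R).1
  · rw [Filter.EventuallyLE, ae_restrict_iff' measurableSet_Ioc]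
    exact Filter.Eventually.of_forall fun r hr => pow_nonneg hr.1.le n

theorem measure_ext_of_Iic {μ ν : Measure ℝ} (hfin : ∀ b, μ (Iic b) ≠ ⊤)
    (h : ∀ b, μ (Iic b) = ν (Iic b)) : μ = ν := by
  refine μ.ext_of_Ioc' ν (fun a b _ => ne_top_of_le_ne_top (hfin b)
    (measure_mono Ioc_subset_Iic_self)) fun a b hab => ?_
  rw [← Iic_sdiff_Iic, measure_sdiff (Iic_subset_Iic.2 hab.le) nullMeasurableSet_Iic (hfin a),
    measure_sdiff (Iic_subset_Iic.2 hab.le) nullMeasurableSet_Iic (h a ▸ hfin a), h a, h b]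

/-- Polar coordinates: the push-forward of a dilation invariant density by `ρ`. -/
theorem exists_map_koranyi {W : H d → ℝ≥0∞} (hW : Measurable W) (hW1 : ∀ p, W p ≤ 1)
    (hinv : ∀ R : ℝ, 0 < R → ∀ p, W (dil R p) = W p) :
    ∃ c : ℝ, 0 ≤ c ∧ Measure.map koranyi (volume.withDensity W)
      = ENNReal.ofReal c • radMeas (2 * d + 1) := by
  set I := ∫⁻ p in {p : H d | koranyi p ≤ 1}, W p
  have hI : I ≠ ⊤ := by
    refine ne_top_of_le_ne_top (volume_koranyi_le_lt_top (d := d)).ne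
      ((lintegral_mono fun p => hW1 p).trans ?_)
    simp
  refine ⟨I.toReal * (2 * d + 2), by positivity, ?_⟩
  have hm : ∀ R, Measure.map koranyi ((volume : Measure (H d)).withDensity W) (Iic R)
      = ∫⁻ p in {p : H d | koranyi p ≤ R}, W p := fun R => by
    rw [Measure.map_apply measurable_koranyi measurableSet_Iic,
      withDensity_apply _ (measurable_koranyi measurableSet_Iic)]
    rfl
  have key : ∀ R, Measure.map koranyi ((volume : Measure (H d)).withDensity W) (Iic R)
      = (ENNReal.ofReal (I.toReal * (2 * d + 2)) • radMeas (2 * d + 1)) (Iic R) := by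
    intro R
    rw [hm]
    rcases lt_or_ge 0 R with hR | hR
    · rw [lintegral_koranyi_le hW hinv hR, Measure.smul_apply, radMeas_Iic _ hR.le, smul_eq_mul,
        ← ENNReal.ofReal_mul (by positivity)]
      change ENNReal.ofReal _ * I = _
      nth_rewrite 1 [← ENNReal.ofReal_toReal hI]
      rw [← ENNReal.ofReal_mul (by positivity)]
      congr 1
      push_cast
      field_simp
      ring
    · have h1 : {p : H d | koranyi p ≤ R} ⊆ {0} := fun p hp =>
        koranyi_eq_zero.1 (le_antisymm (le_trans hp hR) (koranyi_nonneg p))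
      have h2 : radMeas (2 * d + 1) (Iic R) = 0 :=
        measure_mono_null (Iic_subset_Iic.2 hR) (by rw [radMeas_Iic _ le_rfl]; simp)
      rw [Measure.smul_apply, h2, smul_zero]
      exact setLIntegral_measure_zero _ _ (measure_mono_null h1 (measure_singleton _))
  refine measure_ext_of_Iic (fun b => ?_) key
  rw [key, Measure.smul_apply, smul_eq_mul]
  refine ENNReal.mul_ne_top ENNReal.ofReal_ne_top ?_
  refine ne_top_of_le_ne_top (?_ : radMeas (2 * d + 1) (Iic |b|) ≠ ⊤)
    (measure_mono (Iic_subset_Iic.2 (le_abs_self b)))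
  rw [radMeas_Iic _ (abs_nonneg b)]
  exact ENNReal.ofReal_ne_top

/-- The measure `|z|² / ρ² dz dt`. -/
noncomputable def wMeas (d : ℕ) : Measure (H d) :=
  volume.withDensity fun p => ENNReal.ofReal (wt p)

theorem integral_wMeas {E : Type*} [NormedAddCommGroup E] [NormedSpace ℝ E] (f : H d → E) :
    ∫ p, f p ∂(wMeas d) = ∫ p, wt p • f p := by
  rw [wMeas, integral_withDensity_eq_integral_toReal_smul measurable_wt.ennreal_ofReal (by simp)]
  simp_rw [ENNReal.toReal_ofReal (wt_nonneg _)]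

theorem integrable_wMeas_iff {E : Type*} [NormedAddCommGroup E] [NormedSpace ℝ E] {f : H d → E} :
    Integrable f (wMeas d) ↔ Integrable fun p => wt p • f p := by
  rw [wMeas, integrable_withDensity_iff_integrable_smul' measurable_wt.ennreal_ofReal (by simp)]
  simp_rw [ENNReal.toReal_ofReal (wt_nonneg _)]

theorem integral_exp_pow_four (m : ℕ) :
    ∫ r in Ioi (0 : ℝ), r ^ m * Real.exp (-r ^ 4) = 1 / 4 * Real.Gamma ((m + 1) / 4) := by
  have := integral_rpow_mul_exp_neg_rpow (p := 4) (q := m) (by norm_num)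
    (by have : (0 : ℝ) ≤ m := Nat.cast_nonneg m
        linarith)
  rw [← this]
  refine setIntegral_congr_fun measurableSet_Ioi fun r hr => ?_
  rw [Real.rpow_natCast]
  norm_cast

/-- Scaling gives existence of the constants. Their ratio comes from integrating exp(-ρ⁴) =
exp(-|z|⁴) exp(-t²) in two ways: without weight this relates c₀ Γ((d+1)/2) to Γ(d/2), and with the
factor ρ² `wt` = |z|² it relates c₁ Γ(d/2+1) to Γ((d+1)/2), with the same proportionality constant
both times. -/
theorem exists_polar (hd : 1 ≤ d) : ∃ c₀ c₁ : ℝ, 0 < c₀ ∧ 0 < c₁ ∧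
    c₀ / c₁ = d / 2 * (Real.Gamma (d / 2) / Real.Gamma ((d + 1) / 2)) ^ 2 ∧
    Measure.map koranyi (volume : Measure (H d)) = ENNReal.ofReal c₀ • radMeas (2 * d + 1) ∧
    Measure.map koranyi (wMeas d) = ENNReal.ofReal c₁ • radMeas (2 * d + 1) := by
  obtain ⟨c₀, hc₀, h0⟩ := exists_map_koranyi (d := d) (W := fun _ => 1) measurable_const
    (fun _ => le_rfl) (fun _ _ _ => rfl)
  obtain ⟨c₁, hc₁, h1⟩ := exists_map_koranyi (d := d) (W := fun p => ENNReal.ofReal (wt p))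
    measurable_wt.ennreal_ofReal (fun p => ENNReal.ofReal_le_one.2 (wt_le_one p))
    (fun R hR p => by rw [wt_dil hR])
  have hone : (volume : Measure (H d)).withDensity (fun _ => 1) = volume := withDensity_one
  rw [hone] at h0
  set σ := volume.real (Metric.ball (0 : EuclideanSpace ℝ (Idx d)) 1)
  have hσ : 0 < σ := 
    ENNReal.toReal_pos (Metric.measure_ball_pos _ _ one_pos).ne' measure_ball_lt_top.ne
  set P := ∫ t : ℝ, Real.exp (-t ^ 2)
  have hP : 0 < P := by
    have := integral_gaussian 1
    simp only [neg_mul, one_mul, div_one] at this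
    simp only [P, this]
    positivity
  have hd0 : (0 : ℝ) < d := by exact_mod_cast hd
  have hdim : Module.finrank ℝ (EuclideanSpace ℝ (Idx d)) = 2 * d := by simp; ring
  have : Nontrivial (EuclideanSpace ℝ (Idx d)) :=
    Module.nontrivial_of_finrank_pos (R := ℝ) (by omega)
  have hz : ∀ m : ℕ, ∫ p : H d, ‖p.1‖ ^ m * Real.exp (-koranyi p ^ 4)
      = 2 * d * σ * P * (1 / 4 * Real.Gamma ((m + 2 * d) / 4)) := by
    intro m
    have e1 : ∀ p : H d, ‖p.1‖ ^ m * Real.exp (-koranyi p ^ 4)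
        = (‖p.1‖ ^ m * Real.exp (-‖p.1‖ ^ 4)) * Real.exp (-p.2 ^ 2) := fun p => by
      rw [koranyi_pow_four, neg_add, Real.exp_add]; ring
    simp_rw [e1]
    rw [Measure.volume_eq_prod, integral_prod_mul
      (fun z : EuclideanSpace ℝ (Idx d) => ‖z‖ ^ m * Real.exp (-‖z‖ ^ 4))
      (fun t : ℝ => Real.exp (-t ^ 2)),
      integral_fun_norm_addHaar volume (fun r => r ^ m * Real.exp (-r ^ 4)), hdim]
    have e2 : ∫ y in Ioi (0 : ℝ), y ^ (2 * d - 1) • (y ^ m * Real.exp (-y ^ 4))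
        = 1 / 4 * Real.Gamma ((m + 2 * d) / 4) := by
      have h3 : ∀ y : ℝ, y ^ (2 * d - 1) • (y ^ m * Real.exp (-y ^ 4))
          = y ^ (m + (2 * d - 1)) * Real.exp (-y ^ 4) := fun y => by
        rw [smul_eq_mul, pow_add]; ring
      simp_rw [h3]
      rw [integral_exp_pow_four]
      congr 3
      have : (2 * d - 1 : ℕ) = (2 * d - 1 : ℝ) := by
        rw [Nat.cast_sub (by omega)]; push_cast; ring
      push_cast [this]
      ring
    rw [e2]
    simp only [nsmul_eq_mul, smul_eq_mul]
    push_cast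
    change 2 * (d : ℝ) * (σ * _) * P = _
    ring
  have hr : ∀ (c : ℝ), 0 ≤ c → ∀ (μ : Measure (H d)) (m : ℕ),
      Measure.map koranyi μ = ENNReal.ofReal c • radMeas (2 * d + 1) →
      ∫ p, koranyi p ^ m * Real.exp (-koranyi p ^ 4) ∂μ
        = c * (1 / 4 * Real.Gamma ((m + 2 * d + 2) / 4)) := by
    intro c hc μ m hμ
    have hcont : Continuous fun r : ℝ => r ^ m * Real.exp (-r ^ 4) := by fun_prop
    rw [← integral_map (f := fun r : ℝ => r ^ m * Real.exp (-r ^ 4))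
      measurable_koranyi.aemeasurable hcont.aestronglyMeasurable, hμ, integral_smul_measure,
      ENNReal.toReal_ofReal hc, integral_radMeas, smul_eq_mul]
    have h3 : ∀ y : ℝ, y ^ (2 * d + 1) • (y ^ m * Real.exp (-y ^ 4))
        = y ^ (m + (2 * d + 1)) * Real.exp (-y ^ 4) := fun y => by
      rw [smul_eq_mul, pow_add]; ring
    simp_rw [h3]
    rw [integral_exp_pow_four]
    congr 4
    push_cast
    ring
  have r0 := hr c₀ hc₀ volume 0 h0
  have r1 := hr c₁ hc₁ _ 2 h1
  have z0 := hz 0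
  have z2 := hz 2
  simp only [pow_zero] at r0 z0
  rw [r0] at z0
  have e3 : ∫ p, koranyi p ^ 2 * Real.exp (-koranyi p ^ 4) ∂(wMeas d)
      = ∫ p : H d, ‖p.1‖ ^ 2 * Real.exp (-koranyi p ^ 4) := by
    rw [integral_wMeas]
    refine integral_congr_ae (Filter.Eventually.of_forall fun p => ?_)
    simp only [wt, smul_eq_mul]
    rcases eq_or_ne p 0 with rfl | hp
    · simp
    · have := (koranyi_pos hp).ne'
      field_simp
  change ∫ p, koranyi p ^ 2 * Real.exp (-koranyi p ^ 4) ∂(wMeas d) = _ at r1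
  rw [e3] at r1
  rw [r1] at z2
  have g1 : 0 < Real.Gamma (d / 2) := Real.Gamma_pos_of_pos (by positivity)
  have g2 : 0 < Real.Gamma ((d + 1) / 2) := Real.Gamma_pos_of_pos (by positivity)
  have f1 : (((0 : ℕ) : ℝ) + 2 * d + 2) / 4 = (d + 1) / 2 := by push_cast; ring
  have f2 : (((0 : ℕ) : ℝ) + 2 * d) / 4 = d / 2 := by push_cast; ring
  have f3 : (((2 : ℕ) : ℝ) + 2 * d + 2) / 4 = d / 2 + 1 := by push_cast; ring
  have f4 : (((2 : ℕ) : ℝ) + 2 * d) / 4 = (d + 1) / 2 := by push_cast; ring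
  rw [f1, f2] at z0
  rw [f3, f4, Real.Gamma_add_one (by positivity)] at z2
  set G := Real.Gamma (d / 2)
  set G' := Real.Gamma ((d + 1) / 2)
  have k0 : c₀ = 2 * d * σ * P * G / G' := by
    rw [eq_div_iff g2.ne']; linarith
  have k1 : c₁ = 2 * d * σ * P * G' / (d / 2 * G) := by
    rw [eq_div_iff (by positivity)]; linarith
  refine ⟨c₀, c₁, by rw [k0]; positivity, by rw [k1]; positivity, ?_, h0, h1⟩
  rw [k0, k1]
  field_simp

end Koranyi

/-! ### Horizontal derivatives of functions of ρ -/

section Horizontal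

variable {d : ℕ}

/-- The linear form `p ↦ perp p.1 i`. -/
noncomputable def perpL (i : Idx d) : H d →L[ℝ] ℝ :=
  Sum.elim (fun j => (EuclideanSpace.proj (Sum.inr j)).comp (ContinuousLinearMap.fst ℝ _ ℝ))
    (fun j => -(EuclideanSpace.proj (Sum.inl j)).comp (ContinuousLinearMap.fst ℝ _ ℝ)) i

/-- The linear form `p ↦ p.1 i`. -/
noncomputable def coordL (i : Idx d) : H d →L[ℝ] ℝ :=
  (EuclideanSpace.proj i).comp (ContinuousLinearMap.fst ℝ _ ℝ)

theorem perpL_apply (i : Idx d) (p : H d) : perpL i p = perp p.1 i := by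
  rcases i with j | j <;> rfl

theorem coordL_apply (i : Idx d) (p : H d) : coordL i p = p.1 i := rfl

/-- The vertical coefficient of each field pairs a coordinate with its conjugate, so it is constant
along the field. -/
theorem perpL_field (i : Idx d) (p : H d) : perpL i (field i p) = 0 := by
  rw [perpL_apply]
  rcases i with j | j <;> simp [field, perp]

theorem coordL_field (i : Idx d) (p : H d) : coordL i (field i p) = 1 := by
  rw [coordL_apply]; simp [field]

theorem sum_sq_coord (z : EuclideanSpace ℝ (Idx d)) : ∑ i, z i ^ 2 = ‖z‖ ^ 2 := by
  rw [EuclideanSpace.norm_sq_eq]; simp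

theorem sum_sq_perp (z : EuclideanSpace ℝ (Idx d)) : ∑ i, perp z i ^ 2 = ‖z‖ ^ 2 := by
  rw [← sum_sq_coord, Fintype.sum_sum_type, Fintype.sum_sum_type, add_comm]
  simp [perp]

theorem sum_coord_perp (z : EuclideanSpace ℝ (Idx d)) : ∑ i, z i * perp z i = 0 := by
  rw [Fintype.sum_sum_type, ← Finset.sum_add_distrib]
  apply Finset.sum_eq_zero
  intro j _
  simp [perp]; ring

/-- The vector field `|z|² z + t z^⊥`, equal to `ρ³ ∇_ℍ ρ`. -/
noncomputable def bfield (i : Idx d) (p : H d) : ℝ := ‖p.1‖ ^ 2 * p.1 i + p.2 * perp p.1 i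

/-- The components of the horizontal gradient of `ρ`. -/
noncomputable def xrho (i : Idx d) (p : H d) : ℝ := bfield i p / koranyi p ^ 3

theorem bfield_eq (i : Idx d) (p : H d) : bfield i p = koranyi p ^ 3 * xrho i p := by
  unfold xrho
  rcases eq_or_ne p 0 with rfl | hp
  · simp [bfield]
  · have := (koranyi_pos hp).ne'
    field_simp

theorem sum_sq_bfield (p : H d) : ∑ i, bfield i p ^ 2 = ‖p.1‖ ^ 2 * koranyi p ^ 4 := by
  have : ∀ i, bfield i p ^ 2 = ‖p.1‖ ^ 4 * p.1 i ^ 2 + 2 * ‖p.1‖ ^ 2 * p.2 * (p.1 i * perp p.1 i)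
      + p.2 ^ 2 * perp p.1 i ^ 2 := fun i => by unfold bfield; ring
  simp_rw [this]
  rw [Finset.sum_add_distrib, Finset.sum_add_distrib, ← Finset.mul_sum, ← Finset.mul_sum,
    ← Finset.mul_sum, sum_sq_coord, sum_sq_perp, sum_coord_perp, koranyi_pow_four]
  ring

theorem sum_sq_xrho (p : H d) : ∑ i, xrho i p ^ 2 = wt p := by
  unfold xrho wt
  simp_rw [div_pow]
  rw [← Finset.sum_div, sum_sq_bfield]
  rcases eq_or_ne p 0 with rfl | hp
  · simp
  · have := (koranyi_pos hp).ne'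
    field_simp

theorem contDiff_bfield (i : Idx d) : ContDiff ℝ ∞ (bfield i : H d → ℝ) := by
  have : (bfield i : H d → ℝ) = fun p => ‖p.1‖ ^ 2 * coordL i p + p.2 * perpL i p := by
    ext p; rw [perpL_apply, coordL_apply]; rfl
  rw [this]
  exact (((contDiff_norm_sq ℝ).comp contDiff_fst).mul (coordL i).contDiff).add
    (contDiff_snd.mul (perpL i).contDiff)

theorem hasFDerivAt_normSq (p : H d) : HasFDerivAt (fun p : H d => ‖p.1‖ ^ 2)
    ((2 • innerSL ℝ p.1).comp (ContinuousLinearMap.fst ℝ _ ℝ)) p :=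
  (hasStrictFDerivAt_norm_sq p.1).hasFDerivAt.comp p hasFDerivAt_fst

theorem normSq_deriv_field (i : Idx d) (p : H d) :
    ((2 • innerSL ℝ p.1).comp (ContinuousLinearMap.fst ℝ _ ℝ)) (field i p) = 2 * p.1 i := by
  simp [field, EuclideanSpace.inner_single_right]

theorem fderiv_bfield (i : Idx d) (p : H d) : fderiv ℝ (bfield i) p (field i p)
    = 2 * p.1 i ^ 2 + ‖p.1‖ ^ 2 + 2 * perp p.1 i ^ 2 := by
  have : (bfield i : H d → ℝ) = fun p => ‖p.1‖ ^ 2 * coordL i p + p.2 * perpL i p := by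
    ext p; rw [perpL_apply, coordL_apply]; rfl
  rw [this]
  have h := ((hasFDerivAt_normSq p).mul (coordL i).hasFDerivAt).add
    ((hasFDerivAt_snd (p := p)).mul (perpL i).hasFDerivAt)
  have h' := h.fderiv
  erw [h']
  simp only [add_apply, smul_apply, smul_eq_mul, normSq_deriv_field, perpL_field, coordL_field,
    ContinuousLinearMap.coe_snd']
  simp only [perpL_apply, coordL_apply, field]
  ring

/-- Unlike ∇_ℍ ρ, the field ρ³ ∇_ℍ ρ is polynomial. Its divergence constant 2d + 4 dictates the
power of ρ used in `IsWeakHGrad.radial_test`. -/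
theorem sum_fderiv_bfield (p : H d) :
    ∑ i, fderiv ℝ (bfield i) p (field i p) = (2 * d + 4) * ‖p.1‖ ^ 2 := by
  simp_rw [fderiv_bfield]
  rw [Finset.sum_add_distrib, Finset.sum_add_distrib, ← Finset.mul_sum, ← Finset.mul_sum,
    sum_sq_coord, sum_sq_perp]
  simp
  ring

theorem hasFDerivAt_koranyi {p : H d} (hp : p ≠ 0) : ∃ L : H d →L[ℝ] ℝ,
    HasFDerivAt koranyi L p ∧ ∀ i, L (field i p) = xrho i p := by
  have hpos := koranyi_pos hp
  have hN : 0 < ‖p.1‖ ^ 4 + p.2 ^ 2 := by rw [← koranyi_pow_four]; positivity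
  have h1 := ((hasFDerivAt_normSq p).pow 2).add ((hasFDerivAt_snd (p := p)).pow 2)
  have h2 := h1.rpow_const (p := 1 / 4) (Or.inl (by
    simp only [Pi.add_apply]
    rw [← pow_mul]; exact hN.ne'))
  have he : (fun p : H d => (((fun p : H d => (‖p.1‖ ^ 2) ^ 2) + fun p : H d => p.2 ^ 2) p)
      ^ (1 / 4 : ℝ)) = koranyi := by
    ext p; simp only [Pi.add_apply, koranyi]; rw [← pow_mul]
  erw [he] at h2
  refine ⟨_, h2, fun i => ?_⟩
  have e1 : (‖p.1‖ ^ 4 + p.2 ^ 2) ^ (1 / 4 - 1 : ℝ) = (koranyi p ^ 3)⁻¹ := by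
    have : koranyi p ^ 3 = (‖p.1‖ ^ 4 + p.2 ^ 2) ^ ((1 / 4 : ℝ) * (3 : ℕ)) := by
      rw [Real.rpow_mul hN.le, Real.rpow_natCast]; rfl
    rw [this, ← Real.rpow_neg hN.le]
    norm_num
  have e2 : (‖p.1‖ ^ 2) ^ 2 = ‖p.1‖ ^ 4 := by ring
  simp only [smul_apply, add_apply, smul_eq_mul,
    normSq_deriv_field, Pi.add_apply, e2, e1, ContinuousLinearMap.coe_snd']
  simp only [xrho, bfield, field]
  field_simp
  push_cast
  ring

/-- A smooth function of `ρ` that is constant near `0` is smooth on the group. -/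
theorem contDiff_comp_koranyi {Θ : ℝ → ℝ} (hΘ : ContDiff ℝ ∞ Θ) {ε c : ℝ} (hε : 0 < ε)
    (hc : ∀ r, r < ε → Θ r = c) : ContDiff ℝ ∞ (fun p : H d => Θ (koranyi p)) := by
  rw [contDiff_iff_contDiffAt]
  intro p
  rcases eq_or_ne p 0 with rfl | hp
  · have : (fun p : H d => Θ (koranyi p)) =ᶠ[nhds 0] fun _ => c := by
      have : ∀ᶠ p : H d in nhds 0, koranyi p < ε :=
        continuous_koranyi.continuousAt.eventually_lt continuousAt_const
          (by rw [koranyi_eq_zero.2 rfl]; exact hε)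
      filter_upwards [this] with p hp using hc _ hp
    exact contDiffAt_const.congr_of_eventuallyEq this
  · have hN : ‖p.1‖ ^ 4 + p.2 ^ 2 ≠ 0 := by
      rw [← koranyi_pow_four]; exact (pow_pos (koranyi_pos hp) 4).ne'
    have h1 : ContDiff ℝ ∞ fun p : H d => ‖p.1‖ ^ 4 + p.2 ^ 2 := by
      have : (fun p : H d => ‖p.1‖ ^ 4 + p.2 ^ 2) = fun p => (‖p.1‖ ^ 2) ^ 2 + p.2 ^ 2 := by
        ext p; ring
      rw [this]
      exact (((contDiff_norm_sq ℝ).comp contDiff_fst).pow 2).add (contDiff_snd.pow 2)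
    exact hΘ.contDiffAt.comp p (h1.contDiffAt.rpow_const_of_ne hN)

theorem fderiv_comp_koranyi {Θ : ℝ → ℝ} (hΘ : ContDiff ℝ ∞ Θ) {ε c : ℝ} (hε : 0 < ε)
    (hc : ∀ r, r < ε → Θ r = c) (i : Idx d) (p : H d) :
    fderiv ℝ (fun p : H d => Θ (koranyi p)) p (field i p) = deriv Θ (koranyi p) * xrho i p := by
  rcases eq_or_ne p 0 with rfl | hp
  · have : (fun p : H d => Θ (koranyi p)) =ᶠ[nhds 0] fun _ => c := by
      have : ∀ᶠ p : H d in nhds 0, koranyi p < ε :=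
        continuous_koranyi.continuousAt.eventually_lt continuousAt_const
          (by rw [koranyi_eq_zero.2 rfl]; exact hε)
      filter_upwards [this] with p hp using hc _ hp
    rw [this.fderiv_eq]
    -- At the origin both sides are 0: the composition is locally constant and `xrho` vanishes
    -- there.
    simp [xrho, bfield]
  · obtain ⟨L, hL, hLi⟩ := hasFDerivAt_koranyi hp
    have h1 : HasDerivAt Θ (deriv Θ (koranyi p)) (koranyi p) :=
      ((hΘ.differentiable (by simp)) _).hasDerivAt
    have h2 := h1.comp_hasFDerivAt p hL
    change (fderiv ℝ (Θ ∘ koranyi) p) (field i p) = _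
    rw [h2.fderiv]
    simp [hLi]

theorem isCompact_koranyi_le (R : ℝ) : IsCompact {p : H d | koranyi p ≤ R} := by
  refine Metric.isCompact_of_isClosed_isBounded (isClosed_le continuous_koranyi continuous_const) ?_
  refine (Metric.isBounded_closedBall (x := (0 : H d)) (r := max R (R ^ 2))).subset fun p hp => ?_
  have hp : koranyi p ≤ R := hp
  rw [mem_closedBall_zero_iff, Prod.norm_def]
  refine max_le_max ((norm_le_koranyi p).trans hp) ?_
  rw [Real.norm_eq_abs]
  exact (abs_le_koranyi_sq p).trans (pow_le_pow_left₀ (koranyi_nonneg p) hp 2)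

theorem hasCompactSupport_comp_koranyi {F : Type*} [Zero F] {f : H d → F} {R : ℝ}
    (h : ∀ p, R < koranyi p → f p = 0) : HasCompactSupport f :=
  HasCompactSupport.of_support_subset_isCompact (isCompact_koranyi_le R) fun p hp => by
    by_contra hcon
    exact hp (h p (not_le.1 hcon))

theorem continuous_fderiv_field {φ : H d → ℝ} (h : ContDiff ℝ ∞ φ) (i : Idx d) :
    Continuous fun p => fderiv ℝ φ p (field i p) := by
  have h1 : Continuous (fderiv ℝ φ) := h.continuous_fderiv (by simp)
  have h2 : Continuous (field i : H d → H d) := by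
    have : (field i : H d → H d) = fun p => (EuclideanSpace.single i (1 : ℝ), 2 * perpL i p) := by
      ext1 p; rw [perpL_apply]; rfl
    rw [this]
    fun_prop
  exact h1.clm_apply h2

theorem fderiv_field_eq_zero {φ : H d → ℝ} {p : H d} (hp : p ∉ tsupport φ) (v : H d) :
    fderiv ℝ φ p v = 0 := by
  have : fderiv ℝ φ p = 0 :=
    image_eq_zero_of_notMem_tsupport fun h => hp (tsupport_fderiv_subset ℝ h)
  simp [this]

theorem hasCompactSupport_fderiv_field {φ : H d → ℝ} (hc : HasCompactSupport φ) (i : Idx d) :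
    HasCompactSupport fun p => fderiv ℝ φ p (field i p) :=
  hc.mono' fun p hp => by
    by_contra h
    exact hp (fderiv_field_eq_zero h _)

/-- The horizontal vector fields are divergence free. -/
theorem integral_fderiv_field {φ : H d → ℝ} (h : ContDiff ℝ ∞ φ) (hc : HasCompactSupport φ)
    (i : Idx d) : ∫ p, fderiv ℝ φ p (field i p) = 0 := by
  have hdiff : Differentiable ℝ φ := h.differentiable (by simp)
  have hcont : ∀ v : H d, Continuous fun p => fderiv ℝ φ p v := fun v =>
    (h.continuous_fderiv (by simp)).clm_apply continuous_const
  have hsupp : ∀ v : H d, HasCompactSupport fun p => fderiv ℝ φ p v := fun v =>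
    hc.mono' fun p hp => by
      by_contra h
      exact hp (fderiv_field_eq_zero h _)
  -- Each field is a sum of constant vectors times functions that do not vary in the direction of
  -- that vector, so integration by parts leaves nothing.
  have key : ∀ (a : H d → ℝ) (v : H d), ContDiff ℝ ∞ a → (∀ p, fderiv ℝ a p v = 0) →
      Integrable (fun p => a p * fderiv ℝ φ p v) ∧ ∫ p, a p * fderiv ℝ φ p v = 0 := by
    intro a v ha hav
    have i1 : Integrable (fun p => a p * fderiv ℝ φ p v) :=
      (ha.continuous.mul (hcont v)).integrable_of_hasCompactSupport (hsupp v).mul_left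
    refine ⟨i1, ?_⟩
    rw [integral_mul_fderiv_eq_neg_fderiv_mul_of_integrable (by simp [hav]) i1
      ((ha.continuous.mul h.continuous).integrable_of_hasCompactSupport hc.mul_left)
      (fun x _ => ha.differentiable (by simp) x) (fun x _ => hdiff x)]
    simp [hav]
  obtain ⟨i1, e1⟩ := key (fun _ => 1) (EuclideanSpace.single i 1, 0) contDiff_const (by simp)
  obtain ⟨i2, e2⟩ := key (fun p => 2 * perpL i p) (0, 1) (contDiff_const.mul (perpL i).contDiff) (by
    intro p
    rw [fderiv_const_mul (perpL i).differentiableAt, (perpL i).fderiv]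
    simp [perpL_apply]
    rcases i with j | j <;> simp [perp])
  have e3 : ∀ p, fderiv ℝ φ p (field i p) = 1 * fderiv ℝ φ p (EuclideanSpace.single i 1, 0)
      + (2 * perpL i p) * fderiv ℝ φ p (0, 1) := by
    intro p
    have : field i p = (EuclideanSpace.single i (1 : ℝ), (0 : ℝ)) + (2 * perpL i p) • ((0, 1) : H d) := by
      rw [perpL_apply]; simp [field]
    rw [this, map_add, map_smul]; simp
  simp_rw [e3]
  rw [integral_add i1 i2, e1, e2, add_zero]

end Horizontal

/-! ### Radial averages -/

section Push

variable {d n : ℕ} {c : ℝ} {μ : Measure (H d)}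

theorem aesm_smul_radMeas {E : Type*} [TopologicalSpace E] {f : ℝ → E}
    (hf : AEStronglyMeasurable f (radMeas n)) :
    AEStronglyMeasurable f (ENNReal.ofReal c • radMeas n) := hf.smul_measure _

theorem integral_comp_koranyi {E : Type*} [NormedAddCommGroup E] [NormedSpace ℝ E] (hc : 0 < c)
    (hμ : Measure.map koranyi μ = ENNReal.ofReal c • radMeas n) {f : ℝ → E}
    (hf : AEStronglyMeasurable f (radMeas n)) :
    ∫ p, f (koranyi p) ∂μ = c • ∫ r, f r ∂(radMeas n) := by
  rw [← integral_map measurable_koranyi.aemeasurable (by rw [hμ]; exact aesm_smul_radMeas hf), hμ,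
    integral_smul_measure, ENNReal.toReal_ofReal hc.le]

theorem ae_comp_koranyi
    (hμ : Measure.map koranyi μ = ENNReal.ofReal c • radMeas n) {P : ℝ → Prop} :
    (∀ᵐ r ∂(radMeas n), P r) → ∀ᵐ p ∂μ, P (koranyi p) := by
  intro h
  apply ae_of_ae_map measurable_koranyi.aemeasurable
  rw [hμ]
  exact Measure.ae_smul_measure h _

theorem aesm_comp_koranyi {E : Type*} [TopologicalSpace E]
    (hμ : Measure.map koranyi μ = ENNReal.ofReal c • radMeas n) {f : ℝ → E}
    (hf : AEStronglyMeasurable f (radMeas n)) : AEStronglyMeasurable (fun p => f (koranyi p)) μ :=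
  AEStronglyMeasurable.comp_measurable (by rw [hμ]; exact aesm_smul_radMeas hf) measurable_koranyi

theorem memLp_smul_radMeas_iff {E : Type*} [NormedAddCommGroup E] (hc : 0 < c) {q : ℝ≥0∞}
    {f : ℝ → E} : MemLp f q (ENNReal.ofReal c • radMeas n) ↔ MemLp f q (radMeas n) := by
  have h0 : ENNReal.ofReal c ≠ 0 := by simpa using hc
  refine ⟨fun h => ?_, fun h => h.smul_measure ENNReal.ofReal_ne_top⟩
  have := h.smul_measure (c := (ENNReal.ofReal c)⁻¹) (by simpa using hc)
  rwa [smul_smul, ENNReal.inv_mul_cancel h0 ENNReal.ofReal_ne_top, one_smul] at this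

theorem memLp_comp_koranyi_iff {E : Type*} [NormedAddCommGroup E] (hc : 0 < c)
    (hμ : Measure.map koranyi μ = ENNReal.ofReal c • radMeas n) {q : ℝ≥0∞} {f : ℝ → E}
    (hf : AEStronglyMeasurable f (radMeas n)) :
    MemLp (fun p => f (koranyi p)) q μ ↔ MemLp f q (radMeas n) := by
  rw [← memLp_smul_radMeas_iff hc, ← hμ]
  exact (memLp_map_measure_iff (by rw [hμ]; exact aesm_smul_radMeas hf)
    measurable_koranyi.aemeasurable).symm

theorem norm_sq_Lp {α : Type*} [MeasurableSpace α] {ν : Measure α} (f : Lp ℂ 2 ν) :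
    ‖f‖ ^ 2 = ∫ a, ‖f a‖ ^ 2 ∂ν := by
  have h : ((‖f‖ ^ 2 : ℝ) : ℂ) = inner ℂ f f := by
    rw [inner_self_eq_norm_sq_to_K]; push_cast; rfl
  rw [L2.inner_def] at h
  have h2 : ∀ a, inner ℂ (f a) (f a) = ((‖f a‖ ^ 2 : ℝ) : ℂ) := fun a => by
    rw [inner_self_eq_norm_sq_to_K]; push_cast; rfl
  simp_rw [h2] at h
  rw [integral_complex_ofReal] at h
  exact_mod_cast h

theorem wMeas_ac : wMeas d ≪ volume := withDensity_absolutelyContinuous _ _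

theorem wt_eq_sq (p : H d) : wt p = (‖p.1‖ / koranyi p) ^ 2 := by rw [wt, div_pow]

/-- A function dominated by `|z| / ρ` times an `L²` function has a radial average in `L²`. -/
theorem exists_push (hc : 0 < c) (hμ : Measure.map koranyi (wMeas d) = ENNReal.ofReal c • radMeas n)
    {h : H d → ℂ} {k : H d → ℝ} (hh : AEStronglyMeasurable h volume) (hk : MemLp k 2 volume)
    (hhk : ∀ᵐ p, ‖h p‖ ≤ ‖p.1‖ / koranyi p * k p) :
    ∃ b : ℝ → ℂ, MemLp b 2 (radMeas n) ∧ c * ∫ r, ‖b r‖ ^ 2 ∂(radMeas n) ≤ ∫ p, k p ^ 2 ∧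
      ∀ θ : ℝ → ℂ, MemLp θ 2 (radMeas n) → Integrable (fun p => θ (koranyi p) * h p) ∧
        ∫ p, θ (koranyi p) * h p = c * ∫ r, θ r * b r ∂(radMeas n) := by
  -- The density of `h` relative to `wMeas d`. Where `wt` vanishes the bound forces `h = 0`, so the
  -- value 0 of the inverse does no harm.
  set h' : H d → ℂ := fun p => ((wt p)⁻¹ : ℝ) * h p
  have hh' : AEStronglyMeasurable h' (wMeas d) :=
    ((Complex.measurable_ofReal.comp measurable_wt.inv).aestronglyMeasurable.mul hh).mono_ac
      wMeas_ac
  have hcancel : ∀ᵐ p : H d, ((wt p : ℝ) : ℂ) * h' p = h p := by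
    filter_upwards [hhk] with p hp
    simp only [h']
    rcases eq_or_ne (wt p) 0 with h0 | h0
    · have : ‖p.1‖ / koranyi p = 0 := by
        rw [wt_eq_sq] at h0; exact pow_eq_zero_iff (two_ne_zero) |>.1 h0
      rw [this, zero_mul] at hp
      rw [norm_le_zero_iff.1 hp, h0]; simp
    · have : ((wt p : ℝ) : ℂ) ≠ 0 := by exact_mod_cast h0
      push_cast
      field_simp
  have hsq : ∀ᵐ p : H d, wt p * ‖h' p‖ ^ 2 ≤ k p ^ 2 := by
    filter_upwards [hhk, hcancel] with p hp hcp
    rcases eq_or_ne (wt p) 0 with h0 | h0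
    · rw [h0, zero_mul]; positivity
    · have hw : 0 < wt p := (wt_nonneg p).lt_of_ne h0.symm
      have h1 : wt p * ‖h' p‖ = ‖h p‖ := by
        have h2 := congrArg norm hcp
        rwa [norm_mul (wt p : ℂ) (h' p), Complex.norm_real, Real.norm_of_nonneg hw.le] at h2
      have h2 : ‖h p‖ ^ 2 ≤ wt p * k p ^ 2 := by
        calc ‖h p‖ ^ 2 ≤ (‖p.1‖ / koranyi p * k p) ^ 2 := by gcongr
          _ = _ := by rw [mul_pow, wt_eq_sq]
      rw [← h1, mul_pow, pow_two, mul_assoc] at h2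
      exact le_of_mul_le_mul_left h2 hw
  have hk2 : Integrable (fun p => k p ^ 2) := hk.integrable_sq
  have hint : Integrable (fun p => ‖h' p‖ ^ 2) (wMeas d) := by
    rw [integrable_wMeas_iff]
    refine hk2.mono' ?_ ?_
    · have : AEStronglyMeasurable h' volume :=
        (Complex.measurable_ofReal.comp measurable_wt.inv).aestronglyMeasurable.mul hh
      exact measurable_wt.aestronglyMeasurable.smul (this.norm.pow 2)
    · filter_upwards [hsq] with p hp
      rw [Real.norm_of_nonneg (by have := wt_nonneg p; rw [smul_eq_mul]; positivity), smul_eq_mul]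
      exact hp
  have hmem : MemLp h' 2 (wMeas d) :=
    (memLp_two_iff_integrable_sq_norm hh').2 hint
  have hMP : MeasurePreserving (koranyi : H d → ℝ) (wMeas d) (ENNReal.ofReal c • radMeas n) :=
    ⟨measurable_koranyi, hμ⟩
  let T := Lp.compMeasurePreservingₗᵢ (E := ℂ) (p := 2) ℂ koranyi hMP
  let A := T.toContinuousLinearMap
  -- Composition with ρ is an isometry of L² spaces; its adjoint is averaging over the spheres of ρ,
  -- so it has norm at most one. This avoids disintegrating the measure.
  let b : Lp ℂ 2 (ENNReal.ofReal c • radMeas n) := ContinuousLinearMap.adjoint A (hmem.toLp h')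
  have hb : MemLp b 2 (radMeas n) := (memLp_smul_radMeas_iff hc).1 (Lp.memLp b)
  refine ⟨b, hb, ?_, ?_⟩
  · have h1 : c * ∫ r, ‖b r‖ ^ 2 ∂(radMeas n) = ‖b‖ ^ 2 := by
      rw [norm_sq_Lp, integral_smul_measure, ENNReal.toReal_ofReal hc.le, smul_eq_mul]
    have h2 : ‖b‖ ≤ ‖hmem.toLp h'‖ := by
      refine (ContinuousLinearMap.le_opNorm _ _).trans ?_
      rw [LinearIsometryEquiv.norm_map]
      have := T.norm_toContinuousLinearMap_le
      calc ‖A‖ * ‖hmem.toLp h'‖ ≤ 1 * ‖hmem.toLp h'‖ := by gcongr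
        _ = _ := one_mul _
    have h3 : ‖hmem.toLp h'‖ ^ 2 = ∫ p, ‖h' p‖ ^ 2 ∂(wMeas d) := by
      rw [norm_sq_Lp]
      refine integral_congr_ae ?_
      filter_upwards [hmem.coeFn_toLp] with p hp
      rw [hp]
    rw [h1]
    calc ‖b‖ ^ 2 ≤ ‖hmem.toLp h'‖ ^ 2 := by gcongr
      _ = ∫ p, wt p • ‖h' p‖ ^ 2 := by rw [h3, integral_wMeas]
      _ ≤ ∫ p, k p ^ 2 := integral_mono_ae (integrable_wMeas_iff.1 hint) hk2 hsq
  · intro θ hθ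
    have hθ' : MemLp (fun r => starRingEnd ℂ (θ r)) 2 (ENNReal.ofReal c • radMeas n) :=
      ((memLp_smul_radMeas_iff hc).2 hθ).star
    have hθρ : MemLp (fun p => θ (koranyi p)) 2 (wMeas d) :=
      (memLp_comp_koranyi_iff hc hμ hθ.1).2 hθ
    have hi : Integrable (fun p => θ (koranyi p) * h' p) (wMeas d) := hθρ.integrable_mul hmem
    have hcongr : (fun p => wt p • (θ (koranyi p) * h' p)) =ᵐ[volume]
        fun p => θ (koranyi p) * h p := by
      filter_upwards [hcancel] with p hp
      rw [← hp, Complex.real_smul]; ring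
    refine ⟨(integrable_congr hcongr).1 (integrable_wMeas_iff.1 hi), ?_⟩
    rw [← integral_congr_ae hcongr, ← integral_wMeas]
    have h1 : inner ℂ (hθ'.toLp _) b = inner ℂ (A (hθ'.toLp _)) (hmem.toLp h') :=
      ContinuousLinearMap.adjoint_inner_right A _ _
    rw [L2.inner_def, L2.inner_def, integral_smul_measure, ENNReal.toReal_ofReal hc.le,
      Complex.real_smul] at h1
    have h2 : ∫ r, inner ℂ ((hθ'.toLp _) r) (b r) ∂(radMeas n)
        = ∫ r, θ r * b r ∂(radMeas n) := by
      refine integral_congr_ae ?_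
      have : ∀ᵐ r ∂(radMeas n), (hθ'.toLp _) r = starRingEnd ℂ (θ r) := by
        have h0 : ENNReal.ofReal c ≠ 0 := by simpa using hc
        exact (Measure.ae_ennreal_smul_measure_iff h0).1 hθ'.coeFn_toLp
      filter_upwards [this] with r hr
      rw [hr, RCLike.inner_apply, RingHomCompTriple.comp_apply]
      simp [mul_comm]
    have h3 : ∫ p, inner ℂ ((A (hθ'.toLp _)) p) ((hmem.toLp h') p) ∂(wMeas d)
        = ∫ p, θ (koranyi p) * h' p ∂(wMeas d) := by
      refine integral_congr_ae ?_
      have e1 : ∀ᵐ p ∂(wMeas d), (A (hθ'.toLp _)) p = (hθ'.toLp _) (koranyi p) :=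
        Lp.coeFn_compMeasurePreserving (hθ'.toLp _) hMP
      have e2 : ∀ᵐ p ∂(wMeas d), (hθ'.toLp _) (koranyi p) = starRingEnd ℂ (θ (koranyi p)) := by
        refine ae_of_ae_map (p := fun r => (hθ'.toLp _) r = starRingEnd ℂ (θ r))
          measurable_koranyi.aemeasurable ?_
        rw [hμ]
        exact hθ'.coeFn_toLp
      filter_upwards [e1, e2, hmem.coeFn_toLp] with p h1 h2 h3
      rw [h1, h2, h3, RCLike.inner_apply]
      simp [mul_comm]
    rw [← h3, ← h1, h2]

end Push

/-! ### Weak horizontal gradients and layer integrals -/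

section WeakGradient

variable {d : ℕ}

theorem LocallyIntegrable.clm_comp {E F : Type*} [NormedAddCommGroup E] [NormedSpace ℂ E]
    [NormedAddCommGroup F] [NormedSpace ℂ F] {f : H d → E} (hf : LocallyIntegrable f volume)
    (L : E →L[ℂ] F) : LocallyIntegrable (fun p => L (f p)) volume := fun x => by
  obtain ⟨s, hs, h⟩ := hf x
  exact ⟨s, hs, L.integrable_comp h⟩

theorem IsWeakHGrad.ae_eq {u : H d → ℂ} {G G' : H d → EuclideanSpace ℂ (Idx d)}
    (h : IsWeakHGrad u G) (h' : IsWeakHGrad u G') : G =ᵐ[volume] G' := by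
  have key : ∀ i, ∀ᵐ p, G p i = G' p i := fun i => by
    refine ae_eq_of_integral_contDiff_smul_eq
      (LocallyIntegrable.clm_comp h.2.1 (EuclideanSpace.proj (𝕜 := ℂ) i))
      (LocallyIntegrable.clm_comp h'.2.1 (EuclideanSpace.proj (𝕜 := ℂ) i)) fun g hg hgc => ?_
    have e := (h.2.2 g hg hgc i).symm.trans (h'.2.2 g hg hgc i)
    have e2 := neg_injective e
    simpa [Complex.real_smul] using e2
  filter_upwards [ae_all_iff.2 key] with p hp
  ext i; exact hp i

theorem isWeakHGrad_hGrad {u : H d → ℂ} {G : H d → EuclideanSpace ℂ (Idx d)}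
    (h : IsWeakHGrad u G) : IsWeakHGrad u (hGrad u) := by
  have hex : ∃ G, IsWeakHGrad u G := ⟨G, h⟩
  unfold hGrad
  rw [dif_pos hex]
  exact hex.choose_spec

/-- `hGrad` is an unspecified choice; uniqueness up to null sets makes it computable from any
gradient at hand. -/
theorem hGrad_ae_eq {u : H d → ℂ} {G : H d → EuclideanSpace ℂ (Idx d)}
    (h : IsWeakHGrad u G) : hGrad u =ᵐ[volume] G := (isWeakHGrad_hGrad h).ae_eq h

theorem IsWeakHGrad.congr {u u' : H d → ℂ} {G : H d → EuclideanSpace ℂ (Idx d)}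
    (h : IsWeakHGrad u G) (hu : u =ᵐ[volume] u') : IsWeakHGrad u' G := by
  refine ⟨h.1.congr hu, h.2.1, fun φ h1 h2 i => ?_⟩
  rw [← h.2.2 φ h1 h2 i]
  refine integral_congr_ae ?_
  filter_upwards [hu] with p hp
  rw [hp]

theorem abs_xrho_le (i : Idx d) (p : H d) : |xrho i p| ≤ ‖p.1‖ / koranyi p := by
  apply abs_le_of_sq_le_sq _ (div_nonneg (norm_nonneg _) (koranyi_nonneg p))
  rw [← wt_eq_sq, ← sum_sq_xrho]
  exact Finset.single_le_sum (f := fun i => xrho i p ^ 2) (fun j _ => sq_nonneg _)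
    (Finset.mem_univ i)

theorem measurable_xrho (i : Idx d) : Measurable (xrho i : H d → ℝ) :=
  (contDiff_bfield i).continuous.measurable.div (measurable_koranyi.pow_const 3)

/-- The horizontal gradient `v(ρ) ∇_ℍ ρ` of a radial function with derivative `v`. -/
noncomputable def radGrad (v : ℝ → ℂ) (p : H d) : EuclideanSpace ℂ (Idx d) :=
  WithLp.toLp 2 fun i => v (koranyi p) * (xrho i p : ℂ)

theorem radGrad_apply (v : ℝ → ℂ) (p : H d) (i : Idx d) :
    radGrad v p i = v (koranyi p) * (xrho i p : ℂ) := rfl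

theorem inner_radGrad (v w : ℝ → ℂ) (p : H d) : inner ℂ (radGrad v p) (radGrad w p)
    = (wt p : ℂ) * (starRingEnd ℂ (v (koranyi p)) * w (koranyi p)) := by
  rw [PiLp.inner_apply]
  simp only [radGrad_apply, RCLike.inner_apply, map_mul, Complex.conj_ofReal]
  have : ∀ i, w (koranyi p) * (xrho i p : ℂ) * (starRingEnd ℂ (v (koranyi p)) * (xrho i p : ℂ))
      = ((xrho i p ^ 2 : ℝ) : ℂ) * (starRingEnd ℂ (v (koranyi p)) * w (koranyi p)) := fun i => by
    push_cast; ring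
  simp_rw [this]
  rw [← Finset.sum_mul, ← Complex.ofReal_sum, sum_sq_xrho]

theorem norm_radGrad_sq (v : ℝ → ℂ) (p : H d) :
    ‖radGrad v p‖ ^ 2 = wt p * ‖v (koranyi p)‖ ^ 2 := by
  have h := inner_radGrad v v p
  rw [inner_self_eq_norm_sq_to_K, mul_comm (starRingEnd ℂ _), Complex.mul_conj,
    Complex.normSq_eq_norm_sq] at h
  refine Complex.ofReal_injective ?_
  push_cast at h ⊢
  exact h

theorem aesm_radGrad {μ : Measure (H d)} {v : ℝ → ℂ}
    (hv : AEStronglyMeasurable (fun p : H d => v (koranyi p)) μ) :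
    AEStronglyMeasurable (radGrad v : H d → EuclideanSpace ℂ (Idx d)) μ := by
  have h1 : AEMeasurable (fun p : H d => fun i => v (koranyi p) * (xrho i p : ℂ)) μ :=
    aemeasurable_pi_lambda _ fun i =>
      hv.aemeasurable.mul (Complex.measurable_ofReal.comp (measurable_xrho i)).aemeasurable
  exact ((PiLp.continuous_toLp 2 _).measurable.comp_aemeasurable h1).aestronglyMeasurable

theorem memLp_radGrad {c₀ c₁ : ℝ} {n : ℕ} (hc₁ : 0 < c₁)
    (h₀ : Measure.map koranyi (volume : Measure (H d)) = ENNReal.ofReal c₀ • radMeas n)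
    (h₁ : Measure.map koranyi (wMeas d) = ENNReal.ofReal c₁ • radMeas n) {v : ℝ → ℂ}
    (hv : MemLp v 2 (radMeas n)) : MemLp (radGrad v : H d → _) 2 volume ∧
      ∫ p : H d, ‖radGrad v p‖ ^ 2 = c₁ * ∫ r, ‖v r‖ ^ 2 ∂(radMeas n) := by
  have hm : AEStronglyMeasurable (fun p : H d => v (koranyi p)) volume :=
    aesm_comp_koranyi h₀ hv.1
  have h2 : MemLp (fun p : H d => v (koranyi p)) 2 (wMeas d) :=
    (memLp_comp_koranyi_iff hc₁ h₁ hv.1).2 hv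
  have h3 := (memLp_two_iff_integrable_sq_norm h2.1).1 h2
  rw [integrable_wMeas_iff] at h3
  have e : ∀ p : H d, ‖radGrad v p‖ ^ 2 = wt p • ‖v (koranyi p)‖ ^ 2 := norm_radGrad_sq v
  constructor
  · rw [memLp_two_iff_integrable_sq_norm (aesm_radGrad hm)]
    simp_rw [e]; exact h3
  · simp_rw [e]
    have hm2 : AEStronglyMeasurable (fun r : ℝ => ‖v r‖ ^ 2) (radMeas n) := hv.1.norm.pow 2
    rw [← integral_wMeas, integral_comp_koranyi hc₁ h₁ hm2, smul_eq_mul]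

theorem integrableOn_of_memLp_radMeas {n : ℕ} {f : ℝ → ℂ} (hf : MemLp f 2 (radMeas n)) (R : ℝ) :
    IntegrableOn (fun r => r ^ n • f r) (Ioc 0 R) := by
  have hfin : radMeas n (Ioc 0 R) ≠ ⊤ := by
    refine ne_top_of_le_ne_top (?_ : radMeas n (Iic |R|) ≠ ⊤)
      (measure_mono fun x hx => hx.2.trans (le_abs_self R))
    rw [radMeas_Iic _ (abs_nonneg R)]; exact ENNReal.ofReal_ne_top
  have : IsFiniteMeasure ((radMeas n).restrict (Ioc 0 R)) := isFiniteMeasure_restrict.2 hfin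
  have h1 : Integrable f ((radMeas n).restrict (Ioc 0 R)) := (hf.restrict _).integrable (by norm_num)
  have h2 : IntegrableOn ((Ioc 0 R).indicator f) (Ioi 0) (radMeas n) :=
    ((integrable_indicator_iff measurableSet_Ioc).2 h1).integrableOn
  rw [integrableOn_radMeas_iff le_rfl] at h2
  refine (h2.mono_set Ioc_subset_Ioi_self).congr_fun (fun r hr => ?_) measurableSet_Ioc
  simp only [indicator_of_mem hr]

theorem locallyIntegrableOn_of_memLp_radMeas {n : ℕ} {f : ℝ → ℂ} (hf : MemLp f 2 (radMeas n)) :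
    LocallyIntegrableOn (fun r => r ^ n • f r) (Ioi 0) ∧ LocallyIntegrableOn f (Ioi 0) := by
  have h1 : LocallyIntegrableOn (fun r => r ^ n • f r) (Ioi 0) := fun x hx => by
    have hx : 0 < x := hx
    refine ⟨Ioc 0 (x + 1), mem_nhdsWithin_of_mem_nhds (Ioc_mem_nhds hx (by linarith)), ?_⟩
    exact integrableOn_of_memLp_radMeas hf (x + 1)
  refine ⟨h1, ?_⟩
  have h2 : ContinuousOn (fun r : ℝ => (r ^ n)⁻¹) (Ioi 0) :=
    (continuous_pow n).continuousOn.inv₀ fun x hx => (pow_pos hx n).ne'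
  have h3 := h1.continuousOn_smul isOpen_Ioi.isLocallyClosed h2
  rw [locallyIntegrableOn_iff isOpen_Ioi.isLocallyClosed] at h3 ⊢
  intro k hk hkc
  refine (h3 k hk hkc).congr_fun (fun r hr => ?_) hkc.measurableSet
  have : r ^ n ≠ 0 := (pow_pos (hk hr) n).ne'
  simp only [smul_smul, inv_mul_cancel₀ this, one_smul]

theorem volume_koranyi_lt_le {c₀ : ℝ} {n : ℕ} (hc₀ : 0 < c₀)
    (h₀ : Measure.map koranyi (volume : Measure (H d)) = ENNReal.ofReal c₀ • radMeas n) {s : ℝ}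
    (hs : 0 ≤ s) : volume {p : H d | koranyi p < s} ≤ ENNReal.ofReal (c₀ * (s ^ (n + 1) / (n + 1))) := by
  have h1 : {p : H d | koranyi p < s} ⊆ koranyi ⁻¹' (Iic s) := fun p hp => by
    have hp : koranyi p < s := hp
    exact hp.le
  refine (measure_mono h1).trans ?_
  rw [← Measure.map_apply measurable_koranyi measurableSet_Iic, h₀, Measure.smul_apply,
    radMeas_Iic _ hs, smul_eq_mul, ← ENNReal.ofReal_mul hc₀.le]

/-- Fubini on the region ρ < s: a radial function is a superposition of indicators of balls. The
volume of the ball grows like sⁿ⁺¹, which explains the integrability required of V. -/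
theorem integral_layer_swap {c₀ : ℝ} {n : ℕ} (hc₀ : 0 < c₀)
    (h₀ : Measure.map koranyi (volume : Measure (H d)) = ENNReal.ofReal c₀ • radMeas n)
    {ψ : H d → ℂ} (hψ : Continuous ψ) (hψc : HasCompactSupport ψ) {V : ℝ → ℂ}
    (hV : AEStronglyMeasurable V volume) (hV0 : ∀ s ≤ 0, V s = 0)
    (hVi : Integrable fun s => s ^ (n + 1) • V s) :
    ∫ p, ψ p * ∫ s in Ioi (koranyi p), V s
      = ∫ s, V s * ∫ p in {p | koranyi p < s}, ψ p := by
  set A : Set (H d × ℝ) := {q | koranyi q.1 < q.2}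
  have hA : MeasurableSet A :=
    measurableSet_lt (measurable_koranyi.comp measurable_fst) measurable_snd
  obtain ⟨C, hC⟩ := hψ.bounded_above_of_compact_support hψc
  have hC0 : 0 ≤ C := (norm_nonneg _).trans (hC 0)
  set F : H d × ℝ → ℂ := A.indicator fun q => ψ q.1 * V q.2
  have hFm : AEStronglyMeasurable F (volume.prod volume) :=
    ((hψ.aestronglyMeasurable.comp_fst).mul hV.comp_snd).indicator hA
  have hset : ∀ s : ℝ, MeasurableSet {p : H d | koranyi p < s} := fun s =>
    measurableSet_lt measurable_koranyi measurable_const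
  have hFs : ∀ s : ℝ, (fun p => F (p, s)) = {p : H d | koranyi p < s}.indicator
      fun p => ψ p * V s := fun s => by
    ext p
    by_cases hp : koranyi p < s
    · rw [indicator_of_mem (show p ∈ {p : H d | koranyi p < s} from hp)]
      exact indicator_of_mem (show (p, s) ∈ A from hp) _
    · rw [indicator_of_notMem (show p ∉ {p : H d | koranyi p < s} from hp)]
      exact indicator_of_notMem (show (p, s) ∉ A from hp) _
  have hψi : Integrable ψ := hψ.integrable_of_hasCompactSupport hψc
  have hF : Integrable F (volume.prod volume) := by
    rw [integrable_prod_iff' hFm]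
    constructor
    · refine Filter.Eventually.of_forall fun s => ?_
      rw [hFs]
      exact (hψi.mul_const _).indicator (hset s)
    · refine (hVi.norm.const_mul (C * (c₀ / (n + 1)))).mono' hFm.norm.prod_swap.integral_prod_right' ?_
      refine Filter.Eventually.of_forall fun s => ?_
      rw [Real.norm_of_nonneg (integral_nonneg fun _ => norm_nonneg _)]
      rcases le_or_gt s 0 with hs | hs
      · have : ∀ p, ‖F (p, s)‖ = 0 := fun p => by
          have : F (p, s) = _ := congrFun (hFs s) p
          rw [this, hV0 s hs]; simp
        simp_rw [this]
        simp only [integral_zero]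
        positivity
      · have h1 : ∀ p, ‖F (p, s)‖ ≤ {p : H d | koranyi p < s}.indicator (fun _ => C * ‖V s‖) p := by
          intro p
          have : F (p, s) = _ := congrFun (hFs s) p
          rw [this]
          by_cases hp : p ∈ {p : H d | koranyi p < s}
          · rw [indicator_of_mem hp, indicator_of_mem hp, norm_mul]
            gcongr; exact hC p
          · rw [indicator_of_notMem hp, indicator_of_notMem hp]; simp
        have hfin := volume_koranyi_lt_le hc₀ h₀ hs.le
        have hne : volume {p : H d | koranyi p < s} ≠ ⊤ :=
          ne_top_of_le_ne_top ENNReal.ofReal_ne_top hfin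
        calc ∫ p, ‖F (p, s)‖ ≤ ∫ p, {p : H d | koranyi p < s}.indicator (fun _ => C * ‖V s‖) p := by
              refine integral_mono_of_nonneg (Filter.Eventually.of_forall fun _ => norm_nonneg _)
                ?_ (Filter.Eventually.of_forall h1)
              rw [integrable_indicator_iff (hset s)]
              exact integrableOn_const hne
          _ = (volume {p : H d | koranyi p < s}).toReal * (C * ‖V s‖) := by
              rw [integral_indicator (hset s), setIntegral_const, smul_eq_mul]; rfl
          _ ≤ (c₀ * (s ^ (n + 1) / (n + 1))) * (C * ‖V s‖) := by
              gcongr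
              exact ENNReal.toReal_le_of_le_ofReal (by positivity) hfin
          _ = C * (c₀ / (n + 1)) * ‖s ^ (n + 1) • V s‖ := by
              rw [norm_smul, Real.norm_of_nonneg (by positivity)]; ring
  have hsw := integral_integral_swap (f := fun p s => F (p, s)) hF
  have e1 : ∀ p, ∫ s, F (p, s) = ψ p * ∫ s in Ioi (koranyi p), V s := fun p => by
    rw [← integral_const_mul, ← integral_indicator measurableSet_Ioi]
    congr 1
  have e2 : ∀ s, ∫ p, F (p, s) = V s * ∫ p in {p | koranyi p < s}, ψ p := fun s => by
    rw [hFs, integral_indicator (hset s), ← integral_const_mul]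
    simp_rw [mul_comm]
  simp_rw [e1, e2] at hsw
  exact hsw

end WeakGradient

/-! ### From a profile to a weak gradient on the group -/

section RadialGradient

variable {d : ℕ}

theorem exists_koranyi_bound {φ : H d → ℝ} (hc : HasCompactSupport φ) :
    ∃ R : ℝ, 0 < R ∧ ∀ p, R ≤ koranyi p → p ∉ tsupport φ := by
  obtain ⟨C, hC⟩ := hc.isCompact.bddAbove_image continuous_koranyi.continuousOn
  refine ⟨|C| + 1, by positivity, fun p hp hps => ?_⟩
  have h1 : koranyi p ≤ C := hC (mem_image_of_mem _ hps)
  have := le_abs_self C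
  linarith

theorem aesm_layer {ψ : H d → ℂ} (hψ : Continuous ψ) :
    AEStronglyMeasurable (fun s : ℝ => ∫ p in {p : H d | koranyi p < s}, ψ p) volume := by
  set A : Set (ℝ × H d) := {q | koranyi q.2 < q.1}
  have hA : MeasurableSet A :=
    measurableSet_lt (measurable_koranyi.comp measurable_snd) measurable_fst
  have hF : AEStronglyMeasurable (A.indicator fun q => ψ q.2) (volume.prod volume) :=
    (hψ.aestronglyMeasurable.comp_snd).indicator hA
  refine hF.integral_prod_right'.congr (Filter.Eventually.of_forall fun s => ?_)
  simp only
  rw [← integral_indicator (measurableSet_lt measurable_koranyi measurable_const)]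
  rfl

theorem integrable_test_smul {φ : H d → ℝ} (hφ : Continuous φ) (hc : HasCompactSupport φ)
    {u : H d → ℂ} (hu : LocallyIntegrable u volume) :
    Integrable fun p => ((φ p : ℝ) : ℂ) * u p := by
  have := hu.integrable_smul_left_of_hasCompactSupport hφ hc
  simpa [Complex.real_smul] using this

theorem integral_Ioi_test {η : ℝ → ℝ} (hd : ContDiff ℝ ∞ η) (hc : HasCompactSupport η) {a b : ℝ}
    (hs : tsupport η ⊆ Ioo a b) (r : ℝ) :
    ∫ s in Ioi r, ((η s : ℝ) : ℂ) = -((∫ t in b..r, η t : ℝ) : ℂ) := by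
  have hi : Integrable η := hd.continuous.integrable_of_hasCompactSupport hc
  have h0 : ∫ s in Ioi b, η s = 0 := by
    apply setIntegral_eq_zero_of_forall_eq_zero
    intro x hx
    exact (eq_zero_of_notMem_Ioo hs fun h => absurd hx (not_lt.2 h.2.le)).1
  rw [integral_complex_ofReal, ← intervalIntegral.integral_Ioi_sub_Ioi' hi.integrableOn
    hi.integrableOn, h0]
  push_cast; ring

/-- The layer integrals of `X_i φ` are the density of the push-forward of `φ X_i ρ`. -/
theorem exists_layer_density {c₀ c₁ : ℝ} {n : ℕ} (hc₀ : 0 < c₀) (hc₁ : 0 < c₁)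
    (h₀ : Measure.map koranyi (volume : Measure (H d)) = ENNReal.ofReal c₀ • radMeas n)
    (h₁ : Measure.map koranyi (wMeas d) = ENNReal.ofReal c₁ • radMeas n)
    {φ : H d → ℝ} (hφ : ContDiff ℝ ∞ φ) (hφc : HasCompactSupport φ) (i : Idx d) :
    ∃ b : ℝ → ℂ, MemLp b 2 (radMeas n) ∧
      (∀ θ : ℝ → ℂ, MemLp θ 2 (radMeas n) →
        ∫ p, θ (koranyi p) * ((φ p * xrho i p : ℝ) : ℂ) = c₁ * ∫ r, θ r * b r ∂(radMeas n)) ∧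
      ∀ᵐ s ∂volume, s ∈ Ioi (0 : ℝ) →
        ∫ p in {p | koranyi p < s}, ((fderiv ℝ φ p (field i p) : ℝ) : ℂ) = c₁ * (s ^ n • b s) := by
  have hxm : Measurable (xrho i : H d → ℝ) := measurable_xrho i
  obtain ⟨b, hb, -, hθ⟩ := exists_push (n := n) hc₁ h₁
    (h := fun p : H d => ((φ p * xrho i p : ℝ) : ℂ)) (k := fun p => |φ p|)
    (Complex.measurable_ofReal.comp (hφ.continuous.measurable.mul hxm)).aestronglyMeasurable
    ((hφ.continuous.memLp_of_hasCompactSupport hφc).norm)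
    (Filter.Eventually.of_forall fun p => by
      rw [Complex.norm_real, Real.norm_eq_abs, abs_mul, mul_comm]
      exact mul_le_mul_of_nonneg_right (abs_xrho_le i p) (abs_nonneg _))
  refine ⟨b, hb, fun θ h => (hθ θ h).2, ?_⟩
  set ψ : H d → ℂ := fun p => ((fderiv ℝ φ p (field i p) : ℝ) : ℂ) with hψdef
  have hψ : Continuous ψ := Complex.continuous_ofReal.comp (continuous_fderiv_field hφ i)
  have hψc : HasCompactSupport ψ := by
    refine (hasCompactSupport_fderiv_field hφc i).mono fun p hp h0 => hp ?_
    have h0' : fderiv ℝ φ p (field i p) = 0 := h0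
    simp only [ψ]
    rw [h0', Complex.ofReal_zero]
  have hψi : Integrable ψ := hψ.integrable_of_hasCompactSupport hψc
  have hΦ : LocallyIntegrableOn (fun s : ℝ => ∫ p in {p : H d | koranyi p < s}, ψ p) (Ioi 0)
      volume := by
    refine LocallyIntegrable.locallyIntegrableOn ?_ _
    rw [locallyIntegrable_iff]
    intro k hk
    refine Measure.integrableOn_of_bounded (M := ∫ p, ‖ψ p‖) hk.measure_lt_top.ne (aesm_layer hψ)
      (Filter.Eventually.of_forall fun s => ?_)
    exact (norm_integral_le_integral_norm _).trans (setIntegral_le_integral hψi.norm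
      (Filter.Eventually.of_forall fun _ => norm_nonneg _))
  have hβ : LocallyIntegrableOn (fun s : ℝ => (c₁ : ℂ) * (s ^ n • b s)) (Ioi 0) volume :=
    (locallyIntegrableOn_of_memLp_radMeas hb).1.continuousOn_mul continuousOn_const
      isOpen_Ioi.isLocallyClosed
  have key := isOpen_Ioi.ae_eq_zero_of_integral_contDiff_smul_eq_zero
    (f := fun s : ℝ => (∫ p in {p : H d | koranyi p < s}, ψ p) - (c₁ : ℂ) * (s ^ n • b s))
    (hΦ.sub hβ) (by
    intro η hd hc hs
    obtain ⟨a, B, ha, haB, hsub⟩ := exists_Icc_of_tsupport hc hs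
    -- A primitive of η based at the right end of its support is constant near 0, so Θ(ρ) is smooth
    -- across the origin, and it equals minus the tail integral of η. Integrating X_i(φ Θ(ρ)) to
    -- zero then gives the divergence theorem on balls in weak form.
    obtain ⟨hΘ, hΘ'⟩ := contDiff_integral hd B
    set Θ : ℝ → ℝ := fun x => ∫ t in B..x, η t with hΘdef
    have hconst : ∀ r, r < a → Θ r = ∫ t in B..a, η t := by
      intro r hr
      simp only [hΘdef]
      rw [← intervalIntegral.integral_add_adjacent_intervals
        (hd.continuous.intervalIntegrable B a) (hd.continuous.intervalIntegrable a r),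
        intervalIntegral.integral_congr (g := fun _ => 0) (a := a)]
      · simp
      · intro y hy
        rw [uIcc_of_ge hr.le] at hy
        exact (eq_zero_of_notMem_Ioo hsub fun h' => absurd h'.1 (not_lt.2 hy.2)).1
    have hΘρ := contDiff_comp_koranyi (d := d) hΘ ha hconst
    have hz := integral_fderiv_field (hφ.mul hΘρ) hφc.mul_right i
    have hder : ∀ p, fderiv ℝ (fun p => φ p * Θ (koranyi p)) p (field i p)
        = φ p * (η (koranyi p) * xrho i p) + Θ (koranyi p) * fderiv ℝ φ p (field i p) := by
      intro p
      have h1 : DifferentiableAt ℝ φ p := hφ.differentiable (by simp) p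
      have h2 : DifferentiableAt ℝ (fun p : H d => Θ (koranyi p)) p :=
        hΘρ.differentiable (by simp) p
      rw [fderiv_fun_mul h1 h2, add_apply, smul_apply, smul_apply,
        fderiv_comp_koranyi hΘ ha hconst, hΘ']
      simp
    have hηL : MemLp (fun r => ((η r : ℝ) : ℂ)) 2 (radMeas n) := by
      have : MemLp η 2 (radMeas n) := by
        obtain ⟨C, hC⟩ := hd.continuous.bounded_above_of_compact_support hc
        rw [memLp_two_iff_integrable_sq (hd.continuous.aestronglyMeasurable),
          integrable_radMeas_iff]
        refine Integrable.integrableOn ?_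
        refine Continuous.integrable_of_hasCompactSupport
          ((continuous_pow n).smul (hd.continuous.pow 2)) ?_
        refine hc.mono fun x hx hx0 => hx ?_
        simp [hx0]
      exact this.ofReal
    have e1 := (hθ _ hηL).2
    have i1 := (hθ _ hηL).1
    have i2 : Integrable fun p => ((Θ (koranyi p) : ℝ) : ℂ) * ψ p := by
      refine Continuous.integrable_of_hasCompactSupport
        ((Complex.continuous_ofReal.comp hΘρ.continuous).mul hψ) hψc.mul_left
    have e2 : (∫ p, ((η (koranyi p) : ℝ) : ℂ) * ((φ p * xrho i p : ℝ) : ℂ))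
        + ∫ p, ((Θ (koranyi p) : ℝ) : ℂ) * ψ p = 0 := by
      rw [← integral_add i1 i2]
      have : ∫ p, ((fderiv ℝ (fun p => φ p * Θ (koranyi p)) p (field i p) : ℝ) : ℂ) = 0 := by
        rw [integral_complex_ofReal]; exact_mod_cast hz
      rw [← this]
      refine integral_congr_ae (Filter.Eventually.of_forall fun p => ?_)
      simp only [hψdef]
      rw [hder]; push_cast; ring
    have hη0 : ∀ s : ℝ, s ≤ 0 → ((η s : ℝ) : ℂ) = 0 := fun s hs0 => by
      rw [(eq_zero_of_notMem_Ioo hsub fun h => absurd h.1 (not_lt.2 (hs0.trans ha.le))).1]; rfl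
    have e3 := integral_layer_swap hc₀ h₀ hψ hψc (V := fun s => ((η s : ℝ) : ℂ))
      (Complex.continuous_ofReal.comp hd.continuous).aestronglyMeasurable hη0 (by
        refine Continuous.integrable_of_hasCompactSupport ((continuous_pow (n + 1)).smul
          (Complex.continuous_ofReal.comp hd.continuous)) ?_
        refine hc.mono fun x hx hx0 => hx ?_
        simp [hx0])
    simp_rw [integral_Ioi_test hd hc hsub] at e3
    have e4 : ∫ p, ψ p * -((∫ t in B..koranyi p, η t : ℝ) : ℂ)
        = ∫ p, ((η (koranyi p) : ℝ) : ℂ) * ((φ p * xrho i p : ℝ) : ℂ) := by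
      rw [eq_neg_of_add_eq_zero_left e2, ← integral_neg]
      refine integral_congr_ae (Filter.Eventually.of_forall fun p => ?_)
      simp only [hΘdef]; ring
    have e6 : ∫ s in Ioi (0 : ℝ), ((η s : ℝ) : ℂ) * ∫ p in {p : H d | koranyi p < s}, ψ p
        = ∫ s, ((η s : ℝ) : ℂ) * ∫ p in {p : H d | koranyi p < s}, ψ p :=
      setIntegral_eq_integral_of_forall_compl_eq_zero (fun s hs0 => by
        rw [hη0 s (not_lt.1 hs0), zero_mul])
    rw [e4, e1, integral_radMeas, ← e6] at e3
    have j1 := integrable_test_mul hd.continuous hc hs hΦ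
    have j2 := integrable_test_mul hd.continuous hc hs hβ
    have e5 : ∀ s, η s • ((∫ p in {p : H d | koranyi p < s}, ψ p) - (c₁ : ℂ) * (s ^ n • b s))
        = ((η s : ℝ) : ℂ) * (∫ p in {p : H d | koranyi p < s}, ψ p)
          - ((η s : ℝ) : ℂ) * ((c₁ : ℂ) * (s ^ n • b s)) := fun s => by
      rw [Complex.real_smul, mul_sub]
    simp_rw [e5]
    rw [← setIntegral_eq_integral_of_forall_compl_eq_zero (s := Ioi (0 : ℝ)) (fun s hs0 => by
      rw [hη0 s (not_lt.1 hs0), zero_mul, zero_mul, sub_zero]),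
      integral_sub j1.integrableOn j2.integrableOn, ← e3, sub_eq_zero, ← integral_const_mul]
    refine integral_congr_ae (Filter.Eventually.of_forall fun s => ?_)
    simp only [Complex.real_smul]; ring)
  filter_upwards [key] with s hs hs0
  exact sub_eq_zero.1 (hs hs0)

/-- The weak horizontal gradient of a radial function. -/
theorem isWeakHGrad_radial {c₀ c₁ : ℝ} {n : ℕ} (hc₀ : 0 < c₀) (hc₁ : 0 < c₁)
    (h₀ : Measure.map koranyi (volume : Measure (H d)) = ENNReal.ofReal c₀ • radMeas n)
    (h₁ : Measure.map koranyi (wMeas d) = ENNReal.ofReal c₁ • radMeas n)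
    {u v : ℝ → ℂ} (h : IsPrim u v) (hu : MemLp u 2 (radMeas n)) (hv : MemLp v 2 (radMeas n)) :
    IsWeakHGrad (fun p : H d => u (koranyi p)) (radGrad v) := by
  have hul : LocallyIntegrable (fun p : H d => u (koranyi p)) volume :=
    ((memLp_comp_koranyi_iff hc₀ h₀ hu.1).2 hu).locallyIntegrable (by norm_num)
  refine ⟨hul, (memLp_radGrad hc₁ h₀ h₁ hv).1.locallyIntegrable (by norm_num), ?_⟩
  intro φ hφ hφc i
  obtain ⟨b, hb, hθ, hlay⟩ := exists_layer_density hc₀ hc₁ h₀ h₁ hφ hφc i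
  obtain ⟨R, hR, hφR⟩ := exists_koranyi_bound hφc
  -- Cut off beyond the support of φ: for ρ < R the tail integral of V is u(R) - u(ρ), and the
  -- constant u(R) disappears because X_i φ has integral zero. No value or bound of u at the origin
  -- is needed.
  set V : ℝ → ℂ := (Ioo 0 R).indicator v
  have hVL : MemLp V 2 (radMeas n) := hv.indicator measurableSet_Ioo
  have hvm : AEStronglyMeasurable v (volume.restrict (Ioi (0 : ℝ))) := h.aestronglyMeasurable_right
  have hVm : AEStronglyMeasurable V volume := by
    rw [aestronglyMeasurable_indicator_iff measurableSet_Ioo]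
    exact hvm.mono_measure (Measure.restrict_mono Ioo_subset_Ioi_self le_rfl)
  have hVi : Integrable fun s => s ^ (n + 1) • V s := by
    have h1 := (integrableOn_of_memLp_radMeas hv R).mono_set Ioo_subset_Ioc_self
    have h2 : IntegrableOn (fun s : ℝ => s • (s ^ n • v s)) (Ioo 0 R) := by
      refine (h1.norm.const_mul R).mono' (measurable_id.aestronglyMeasurable.smul h1.1) ?_
      rw [ae_restrict_iff' measurableSet_Ioo]
      refine Filter.Eventually.of_forall fun s hs => ?_
      rw [norm_smul, Real.norm_of_nonneg hs.1.le]
      exact mul_le_mul_of_nonneg_right hs.2.le (norm_nonneg _)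
    have h3 := (integrable_indicator_iff measurableSet_Ioo).2 h2
    refine h3.congr (Filter.Eventually.of_forall fun s => ?_)
    simp only [V, indicator]
    split_ifs
    · rw [pow_succ, smul_smul, mul_comm]
    · simp
  set ψ : H d → ℂ := fun p => ((fderiv ℝ φ p (field i p) : ℝ) : ℂ)
  have hψ : Continuous ψ := Complex.continuous_ofReal.comp (continuous_fderiv_field hφ i)
  have hψc : HasCompactSupport ψ := by
    refine (hasCompactSupport_fderiv_field hφc i).mono fun p hp h0 => hp ?_
    have h0' : fderiv ℝ φ p (field i p) = 0 := h0
    simp only [ψ]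
    rw [h0', Complex.ofReal_zero]
  have hψi : Integrable ψ := hψ.integrable_of_hasCompactSupport hψc
  have hψ0 : ∫ p, ψ p = 0 := by
    simp only [ψ]
    rw [integral_complex_ofReal, integral_fderiv_field hφ hφc]; rfl
  have hV0 : ∀ s : ℝ, s ≤ 0 → V s = 0 := fun s hs =>
    indicator_of_notMem (fun h => absurd h.1 (not_lt.2 hs)) _
  have e1 := integral_layer_swap hc₀ h₀ hψ hψc hVm hV0 hVi
  have hne : ∀ᵐ p : H d, p ≠ 0 := by simp [ae_iff]
  have hVint : ∀ p : H d, p ≠ 0 → koranyi p < R →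
      ∫ s in Ioi (koranyi p), V s = u R - u (koranyi p) := fun p hp hpR => by
    have hpos := koranyi_pos hp
    rw [(h (koranyi p) R hpos hR).2, intervalIntegral.integral_of_le hpR.le,
      integral_Ioc_eq_integral_Ioo, setIntegral_indicator measurableSet_Ioo]
    congr 2
    ext s
    exact ⟨fun hs => ⟨hs.1, hs.2.2⟩, fun hs => ⟨hs.1, hpos.trans hs.1, hs.2⟩⟩
  have e2 : ∀ᵐ p : H d, ψ p * ∫ s in Ioi (koranyi p), V s
      = ψ p * u R - ψ p * u (koranyi p) := by
    filter_upwards [hne] with p hp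
    rcases lt_or_ge (koranyi p) R with hpR | hpR
    · rw [hVint p hp hpR, mul_sub]
    · have : ψ p = 0 := by
        simp only [ψ]; rw [fderiv_field_eq_zero (hφR p hpR)]; rfl
      simp [this]
  rw [integral_congr_ae e2, integral_sub (hψi.mul_const _)
    (integrable_test_smul (continuous_fderiv_field hφ i) (hasCompactSupport_fderiv_field hφc i) hul),
    integral_mul_const, hψ0, zero_mul, zero_sub] at e1
  have e3 : ∫ s, V s * ∫ p in {p | koranyi p < s}, ψ p = c₁ * ∫ r, V r * b r ∂(radMeas n) := by
    have e6 : ∫ s in Ioi (0 : ℝ), V s * ∫ p in {p : H d | koranyi p < s}, ψ p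
        = ∫ s, V s * ∫ p in {p : H d | koranyi p < s}, ψ p :=
      setIntegral_eq_integral_of_forall_compl_eq_zero (fun s hs0 => by
        rw [hV0 s (not_lt.1 hs0), zero_mul])
    rw [integral_radMeas, ← integral_const_mul, ← e6]
    refine setIntegral_congr_ae measurableSet_Ioi ?_
    filter_upwards [hlay] with s hs hs0
    rw [hs hs0, Complex.real_smul, Complex.real_smul]; ring
  rw [e3, ← hθ V hVL] at e1
  change ∫ p, ψ p * u (koranyi p) = _
  rw [neg_eq_iff_eq_neg.1 e1]
  congr 1
  refine integral_congr_ae ?_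
  filter_upwards [hne] with p hp
  rw [radGrad_apply]
  rcases lt_or_ge (koranyi p) R with hpR | hpR
  · have : V (koranyi p) = v (koranyi p) := indicator_of_mem
      (show koranyi p ∈ Ioo 0 R from ⟨koranyi_pos hp, hpR⟩) _
    rw [this]; push_cast; ring
  · rw [image_eq_zero_of_notMem_tsupport (hφR p hpR)]; simp

end RadialGradient

/-! ### Descent of measurability along a continuous map -/

section ImageMeasurability

variable {X Y : Type*} [TopologicalSpace X] [T2Space X] [MeasurableSpace X] [BorelSpace X]
  [TopologicalSpace Y] [T2Space Y] [MeasurableSpace Y] [BorelSpace Y] {μ : Measure X} {f : X → Y}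

/-- A null measurable preimage contains the preimage of a measurable set, up to a null set. -/
theorem exists_measurableSet_subset_of_preimage [IsFiniteMeasure μ]
    [μ.InnerRegularCompactLTTop] (hf : Continuous f) {T : Set Y}
    (hT : NullMeasurableSet (f ⁻¹' T) μ) :
    ∃ S, MeasurableSet S ∧ S ⊆ T ∧ μ (f ⁻¹' T \ f ⁻¹' S) = 0 := by
  obtain ⟨E, hET, hE, hEe⟩ := hT.exists_measurable_subset_ae_eq
  -- Inner regularity is essential: the image of a measurable set may fail to be Borel, but the
  -- image of a compact set is compact.
  have h1 : ∀ n : ℕ, ∃ K ⊆ E, IsCompact K ∧ μ (E \ K) < ((n : ℝ≥0∞) + 1)⁻¹ := fun n =>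
    hE.exists_isCompact_sdiff_lt (measure_ne_top μ E) (by simp)
  choose K hKE hK hKm using h1
  refine ⟨⋃ n, f '' K n, MeasurableSet.iUnion fun n => ((hK n).image hf).measurableSet,
    iUnion_subset fun n => (image_mono ((hKE n).trans hET)).trans (image_preimage_subset f T), ?_⟩
  have h2 : μ (f ⁻¹' T \ E) = 0 := ae_le_set.1 hEe.symm.le
  have h3 : μ (E \ f ⁻¹' ⋃ n, f '' K n) = 0 := by
    refine le_antisymm (ENNReal.le_of_forall_pos_le_add fun ε hε _ => ?_) zero_le
    obtain ⟨n, hn⟩ := ENNReal.exists_inv_nat_lt (a := (ε : ℝ≥0∞)) (by simpa using hε.ne')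
    rw [zero_add]
    calc μ (E \ f ⁻¹' ⋃ n, f '' K n) ≤ μ (E \ K n) := measure_mono
          (sdiff_subset_sdiff_right ((subset_preimage_image f _).trans
            (preimage_mono (subset_iUnion (fun n => f '' K n) n))))
      _ ≤ ((n : ℝ≥0∞) + 1)⁻¹ := (hKm n).le
      _ ≤ (n : ℝ≥0∞)⁻¹ := ENNReal.inv_le_inv.2 le_self_add
      _ ≤ ε := hn.le
  refine measure_mono_null (fun x hx => ?_) (measure_union_null h2 h3)
  by_cases hxE : x ∈ E
  · exact Or.inr ⟨hxE, hx.2⟩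
  · exact Or.inl ⟨hx.1, hxE⟩

/-- Approximating both T and its complement from inside squeezes T between two Borel sets with the
same image measure. -/
theorem nullMeasurableSet_map_of_preimage [IsFiniteMeasure μ]
    [μ.InnerRegularCompactLTTop] (hf : Continuous f) {T : Set Y}
    (hT : NullMeasurableSet (f ⁻¹' T) μ) : NullMeasurableSet T (μ.map f) := by
  obtain ⟨S, hS, hST, h1⟩ := exists_measurableSet_subset_of_preimage hf hT
  obtain ⟨S', hS', hST', h2⟩ := exists_measurableSet_subset_of_preimage (T := Tᶜ) hf hT.compl
  have h3 : μ.map f (T \ S) = 0 := by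
    refine measure_mono_null (t := S'ᶜ \ S) (sdiff_subset_sdiff_left fun x hx hx' => hST' hx' hx) ?_
    rw [Measure.map_apply hf.measurable (hS'.compl.diff hS)]
    refine measure_mono_null (fun x hx => ?_) (measure_union_null h1 h2)
    by_cases hxT : f x ∈ T
    · exact Or.inl ⟨hxT, hx.2⟩
    · exact Or.inr ⟨hxT, hx.1⟩
  refine hS.nullMeasurableSet.congr (Filter.EventuallyEq.symm ?_)
  exact (ae_le_set.2 h3).antisymm (LE.le.eventuallyLE hST)


end ImageMeasurability

/-! ### From a radial function in H¹ to its profile -/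

section RadialProfile

variable {d : ℕ}

/-- Radiality supplies an arbitrary function `u₀`; only its composition with ρ is known to be
measurable. -/
theorem aestronglyMeasurable_profile {c₀ : ℝ} {n : ℕ} (hc₀ : 0 < c₀)
    (h₀ : Measure.map koranyi (volume : Measure (H d)) = ENNReal.ofReal c₀ • radMeas n)
    {u : H d → ℂ} (hu : AEStronglyMeasurable u volume) {u₀ : ℝ → ℂ}
    (h : ∀ᵐ p : H d, u p = u₀ (koranyi p)) : AEStronglyMeasurable u₀ (radMeas n) := by
  have h1 : AEMeasurable (fun p : H d => u₀ (koranyi p)) volume := hu.aemeasurable.congr h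
  -- A finite measure with the same null sets stands in for Lebesgue measure.
  have h2 : NullMeasurable u₀ ((volume : Measure (H d)).toFinite.map koranyi) := fun s hs =>
    nullMeasurableSet_map_of_preimage continuous_koranyi
      ((h1.nullMeasurable hs).mono_ac (toFinite_absolutelyContinuous _))
  have h3 : AEMeasurable u₀ (Measure.map koranyi (volume : Measure (H d))) :=
    h2.aemeasurable.mono_ac ((absolutelyContinuous_toFinite _).map measurable_koranyi)
  rw [h₀] at h3
  have h4 : radMeas n ≪ ENNReal.ofReal c₀ • radMeas n :=
    Measure.absolutelyContinuous_smul (by simpa using hc₀)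
  exact (h3.mono_ac h4).aestronglyMeasurable

theorem memLp_radMeas_of_continuous {n : ℕ} {η : ℝ → ℝ} (hη : Continuous η)
    (hc : HasCompactSupport η) : MemLp (fun r => ((η r : ℝ) : ℂ)) 2 (radMeas n) := by
  have : MemLp η 2 (radMeas n) := by
    rw [memLp_two_iff_integrable_sq hη.aestronglyMeasurable, integrable_radMeas_iff]
    refine Integrable.integrableOn ?_
    refine Continuous.integrable_of_hasCompactSupport ((continuous_pow n).smul (hη.pow 2)) ?_
    refine hc.mono fun x hx hx0 => hx ?_
    simp [hx0]
  exact this.ofReal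

theorem notMem_tsupport_of_nonpos {χ : ℝ → ℝ} (hs : tsupport χ ⊆ Ioi 0) {r : ℝ} (hr : r ≤ 0) :
    r ∉ tsupport χ := fun h => absurd (hs h) (not_lt.2 hr)

theorem contDiff_mul_inv_pow {χ : ℝ → ℝ} (hd : ContDiff ℝ ∞ χ) (hs : tsupport χ ⊆ Ioi 0) (m : ℕ) :
    ContDiff ℝ ∞ fun r => χ r * (r ^ m)⁻¹ := by
  rw [contDiff_iff_contDiffAt]
  intro r
  rcases le_or_gt r 0 with hr | hr
  · have h := notMem_tsupport_iff_eventuallyEq.1 (notMem_tsupport_of_nonpos hs hr)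
    refine (contDiffAt_const (c := (0 : ℝ))).congr_of_eventuallyEq ?_
    filter_upwards [h] with x hx
    simp [hx]
  · exact hd.contDiffAt.mul ((contDiffAt_id.pow m).inv (pow_pos hr m).ne')

theorem deriv_mul_inv_pow {χ : ℝ → ℝ} (hd : ContDiff ℝ ∞ χ) (hs : tsupport χ ⊆ Ioi 0) (m : ℕ)
    (r : ℝ) : deriv (fun r => χ r * (r ^ m)⁻¹) r
      = deriv χ r * (r ^ m)⁻¹ - m * (χ r * (r ^ (m + 1))⁻¹) := by
  rcases le_or_gt r 0 with hr | hr
  · have h0 := notMem_tsupport_of_nonpos hs hr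
    have h := notMem_tsupport_iff_eventuallyEq.1 h0
    have h1 : (fun r => χ r * (r ^ m)⁻¹) =ᶠ[nhds r] fun _ => (0 : ℝ) := by
      filter_upwards [h] with x hx
      simp [hx]
    have h2 : χ =ᶠ[nhds r] fun _ => (0 : ℝ) := h
    rw [h1.deriv_eq, h2.deriv_eq, h.self_of_nhds]
    simp
  · have h1 := ((hd.differentiable (by simp)) r).hasDerivAt.mul
      ((hasDerivAt_pow m r).inv (pow_pos hr m).ne')
    have h2 : deriv (fun r => χ r * (r ^ m)⁻¹) r = _ := h1.deriv
    rw [h2]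
    rcases m with _ | m
    · simp
    · simp only [Pi.inv_apply, Nat.add_sub_cancel]
      field_simp
      ring

/-- The weak gradient equation tested with multiples of `ρ³ ∇_ℍ ρ`. -/
theorem IsWeakHGrad.radial_test {u : H d → ℂ} {G : H d → EuclideanSpace ℂ (Idx d)}
    (h : IsWeakHGrad u G) {χ : ℝ → ℝ} (hd : ContDiff ℝ ∞ χ) (hc : HasCompactSupport χ)
    (hs : tsupport χ ⊆ Ioi 0) :
    ∫ p, wt p • (((deriv χ (koranyi p) * (koranyi p ^ (2 * d + 1))⁻¹ : ℝ) : ℂ) * u p)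
      = -∫ p, ((χ (koranyi p) * (koranyi p ^ (2 * d + 1))⁻¹ : ℝ) : ℂ)
          * ∑ i, (xrho i p : ℂ) * G p i := by
  obtain ⟨a, b, ha, hab, hsub⟩ := exists_Icc_of_tsupport hc hs
  -- With this power the divergence of Θ(ρ) ρ³ ∇_ℍ ρ has no undifferentiated χ: the derivative of
  -- the power cancels (2d+4)|z|². What is left, `wt` χ' ρ^{-(2d+1)}, compensates the density
  -- r^{2d+1} of polar coordinates.
  set Θ : ℝ → ℝ := fun r => χ r * (r ^ (2 * d + 4))⁻¹ with hΘdef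
  have hΘ : ContDiff ℝ ∞ Θ := contDiff_mul_inv_pow hd hs _
  have hconst : ∀ r, r < a → Θ r = 0 := fun r hr => by
    simp [hΘdef, (eq_zero_of_notMem_Ioo hsub fun h' => absurd h'.1 (not_lt.2 hr.le)).1]
  have hΘρ := contDiff_comp_koranyi (d := d) hΘ ha hconst
  set φ : Idx d → H d → ℝ := fun i p => Θ (koranyi p) * bfield i p with hφdef
  have hφ : ∀ i, ContDiff ℝ ∞ (φ i) := fun i => hΘρ.mul (contDiff_bfield i)
  have hφc : ∀ i, HasCompactSupport (φ i) := fun i =>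
    hasCompactSupport_comp_koranyi (R := b) fun p hp => by
      simp [hφdef, hΘdef,
        (eq_zero_of_notMem_Ioo hsub fun h' => absurd h'.2 (not_lt.2 hp.le)).1]
  have hder : ∀ i p, fderiv ℝ (φ i) p (field i p) = deriv Θ (koranyi p) * xrho i p * bfield i p
      + Θ (koranyi p) * fderiv ℝ (bfield i) p (field i p) := fun i p => by
    have h1 : DifferentiableAt ℝ (fun p : H d => Θ (koranyi p)) p :=
      hΘρ.differentiable (by simp) p
    have h2 : DifferentiableAt ℝ (bfield i : H d → ℝ) p :=
      (contDiff_bfield i).differentiable (by simp) p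
    have h3 : fderiv ℝ (φ i) p = _ := fderiv_fun_mul h1 h2
    rw [h3, add_apply, smul_apply, smul_apply, fderiv_comp_koranyi hΘ ha hconst]
    simp only [smul_eq_mul]
    ring
  have hsum : ∀ p, ∑ i, fderiv ℝ (φ i) p (field i p)
      = wt p * (deriv χ (koranyi p) * (koranyi p ^ (2 * d + 1))⁻¹) := fun p => by
    simp_rw [hder]
    rw [Finset.sum_add_distrib, ← Finset.mul_sum, sum_fderiv_bfield]
    have e1 : ∀ i, deriv Θ (koranyi p) * xrho i p * bfield i p
        = deriv Θ (koranyi p) * koranyi p ^ 3 * xrho i p ^ 2 := fun i => by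
      rw [bfield_eq]; ring
    simp_rw [e1]
    rw [← Finset.mul_sum, sum_sq_xrho, hΘdef, deriv_mul_inv_pow hd hs]
    rcases eq_or_ne p 0 with rfl | hp
    · simp [wt]
    · have hk := (koranyi_pos hp).ne'
      simp only [wt]
      push_cast
      field_simp
      ring
  have hbf : ∀ i p, φ i p = χ (koranyi p) * (koranyi p ^ (2 * d + 1))⁻¹ * xrho i p := fun i p => by
    simp only [hφdef, hΘdef]
    rw [bfield_eq]
    rcases eq_or_ne p 0 with rfl | hp
    · simp [xrho, bfield]
    · have hk := (koranyi_pos hp).ne'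
      field_simp
      ring
  have i1 : ∀ i, Integrable fun p => ((fderiv ℝ (φ i) p (field i p) : ℝ) : ℂ) * u p := fun i =>
    integrable_test_smul (continuous_fderiv_field (hφ i) i)
      (hasCompactSupport_fderiv_field (hφc i) i) h.1
  have i2 : ∀ i, Integrable fun p => ((φ i p : ℝ) : ℂ) * G p i := fun i =>
    integrable_test_smul (hφ i).continuous (hφc i)
      (LocallyIntegrable.clm_comp h.2.1 (EuclideanSpace.proj (𝕜 := ℂ) i))
  calc ∫ p, wt p • (((deriv χ (koranyi p) * (koranyi p ^ (2 * d + 1))⁻¹ : ℝ) : ℂ) * u p)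
      = ∫ p, ∑ i, ((fderiv ℝ (φ i) p (field i p) : ℝ) : ℂ) * u p := by
        refine integral_congr_ae (Filter.Eventually.of_forall fun p => ?_)
        simp only
        rw [← Finset.sum_mul, ← Complex.ofReal_sum, hsum, Complex.real_smul]
        push_cast; ring
    _ = ∑ i, -∫ p, ((φ i p : ℝ) : ℂ) * G p i := by
        rw [integral_finsetSum _ fun i _ => i1 i]
        exact Finset.sum_congr rfl fun i _ => h.2.2 (φ i) (hφ i) (hφc i) i
    _ = _ := by
        rw [Finset.sum_neg_distrib, ← integral_finsetSum _ fun i _ => i2 i]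
        congr 1
        refine integral_congr_ae (Filter.Eventually.of_forall fun p => ?_)
        simp only
        rw [Finset.mul_sum]
        refine Finset.sum_congr rfl fun i _ => ?_
        rw [hbf]; push_cast; ring

theorem norm_sum_xrho_mul_le (p : H d) (g : EuclideanSpace ℂ (Idx d)) :
    ‖∑ i, (xrho i p : ℂ) * g i‖ ≤ ‖p.1‖ / koranyi p * ‖g‖ := by
  calc ‖∑ i, (xrho i p : ℂ) * g i‖ ≤ ∑ i, |xrho i p| * ‖g i‖ := by
        refine (norm_sum_le _ _).trans (Finset.sum_le_sum fun i _ => ?_)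
        rw [norm_mul, Complex.norm_real, Real.norm_eq_abs]
    _ ≤ √(∑ i, |xrho i p| ^ 2) * √(∑ i, ‖g i‖ ^ 2) :=
        Real.sum_mul_le_sqrt_mul_sqrt _ _ _
    _ = _ := by
        simp_rw [sq_abs]
        rw [sum_sq_xrho, wt_eq_sq, Real.sqrt_sq (div_nonneg (norm_nonneg _) (koranyi_nonneg p)),
          EuclideanSpace.norm_eq g]

/-- A radial function in `H¹` has an absolutely continuous profile. -/
theorem exists_profile {c₀ c₁ : ℝ} (hc₀ : 0 < c₀) (hc₁ : 0 < c₁)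
    (h₀ : Measure.map koranyi (volume : Measure (H d)) = ENNReal.ofReal c₀ • radMeas (2 * d + 1))
    (h₁ : Measure.map koranyi (wMeas d) = ENNReal.ofReal c₁ • radMeas (2 * d + 1))
    {u : H d → ℂ} (hu : MemH1 u) (hr : IsRadial u) :
    ∃ p v : ℝ → ℂ, IsPrim p v ∧ MemLp p 2 (radMeas (2 * d + 1)) ∧
      MemLp v 2 (radMeas (2 * d + 1)) ∧ (u =ᵐ[volume] fun q => p (koranyi q)) ∧
      hGrad u =ᵐ[volume] radGrad v := by
  obtain ⟨hu2, G, hG, hG2⟩ := hu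
  obtain ⟨u₀, hu₀⟩ := hr
  have hm := aestronglyMeasurable_profile hc₀ h₀ hu2.1 hu₀
  have hu₀2 : MemLp u₀ 2 (radMeas (2 * d + 1)) :=
    (memLp_comp_koranyi_iff hc₀ h₀ hm).1 (hu2.ae_eq hu₀)
  -- The average of ⟨∇_ℍ ρ, G⟩ is the candidate for the derivative of the profile.
  obtain ⟨b, hb, -, hθ⟩ := exists_push hc₁ h₁ (h := fun p => ∑ i, (xrho i p : ℂ) * G p i)
    (k := fun p => ‖G p‖) (by
      refine Finset.aestronglyMeasurable_fun_sum _ fun i _ => ?_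
      exact (Complex.measurable_ofReal.comp (measurable_xrho i)).aestronglyMeasurable.mul
        ((EuclideanSpace.proj (𝕜 := ℂ) i).continuous.comp_aestronglyMeasurable hG2.1))
    hG2.norm (Filter.Eventually.of_forall fun p => norm_sum_xrho_mul_le p (G p))
  have hweak : ∀ χ : ℝ → ℝ, ContDiff ℝ ∞ χ → HasCompactSupport χ → tsupport χ ⊆ Ioi 0 →
      ∫ x, ((deriv χ x : ℝ) : ℂ) * u₀ x = -∫ x, ((χ x : ℝ) : ℂ) * b x := by
    intro χ hd hc hs
    have h0 : ∀ x, x ≤ 0 → χ x = 0 ∧ deriv χ x = 0 := fun x hx =>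
      ⟨image_eq_zero_of_notMem_tsupport (notMem_tsupport_of_nonpos hs hx),
        image_eq_zero_of_notMem_tsupport fun h' =>
          notMem_tsupport_of_nonpos hs hx (tsupport_deriv_subset h')⟩
    have e := hG.radial_test hd hc hs
    have hcont : ContDiff ℝ ∞ fun r => χ r * (r ^ (2 * d + 1))⁻¹ := contDiff_mul_inv_pow hd hs _
    have hcs : HasCompactSupport fun r => χ r * (r ^ (2 * d + 1))⁻¹ := hc.mul_right
    have hθL : MemLp (fun r => ((χ r * (r ^ (2 * d + 1))⁻¹ : ℝ) : ℂ)) 2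
        (radMeas (2 * d + 1)) := memLp_radMeas_of_continuous hcont.continuous hcs
    rw [(hθ _ hθL).2] at e
    have e2 : ∫ p, wt p • (((deriv χ (koranyi p) * (koranyi p ^ (2 * d + 1))⁻¹ : ℝ) : ℂ) * u p)
        = c₁ * ∫ r, ((deriv χ r * (r ^ (2 * d + 1))⁻¹ : ℝ) : ℂ) * u₀ r
            ∂(radMeas (2 * d + 1)) := by
      have hm2 : AEStronglyMeasurable (fun r => ((deriv χ r * (r ^ (2 * d + 1))⁻¹ : ℝ) : ℂ) * u₀ r)
          (radMeas (2 * d + 1)) := by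
        refine AEStronglyMeasurable.mul ?_ hm
        exact (Complex.measurable_ofReal.comp ((hd.continuous_deriv (by simp)).measurable.mul
          (measurable_id.pow_const _).inv)).aestronglyMeasurable
      have e3 := integral_comp_koranyi hc₁ h₁ hm2
      rw [integral_wMeas, Complex.real_smul] at e3
      rw [← e3]
      refine integral_congr_ae ?_
      filter_upwards [hu₀] with p hp
      rw [hp]
    rw [e2, ← mul_neg, mul_right_inj' (by exact_mod_cast hc₁.ne'), integral_radMeas,
      integral_radMeas] at e
    rw [← setIntegral_eq_integral_of_forall_compl_eq_zero (s := Ioi (0 : ℝ))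
        (f := fun x => ((deriv χ x : ℝ) : ℂ) * u₀ x) (fun x hx => by
          rw [(h0 x (not_lt.1 hx)).2]; simp),
      ← setIntegral_eq_integral_of_forall_compl_eq_zero (s := Ioi (0 : ℝ))
        (f := fun x => ((χ x : ℝ) : ℂ) * b x) (fun x hx => by
          rw [(h0 x (not_lt.1 hx)).1]; simp)]
    have key : ∀ (f : ℝ → ℝ) (g : ℝ → ℂ), ∫ r in Ioi (0 : ℝ),
        r ^ (2 * d + 1) • (((f r * (r ^ (2 * d + 1))⁻¹ : ℝ) : ℂ) * g r)
        = ∫ r in Ioi (0 : ℝ), ((f r : ℝ) : ℂ) * g r := fun f g => by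
      refine setIntegral_congr_fun measurableSet_Ioi fun r hr => ?_
      have hr : 0 < r := hr
      have : (r : ℂ) ≠ 0 := by exact_mod_cast hr.ne'
      simp only [Complex.real_smul]
      push_cast
      field_simp
    rw [key, key] at e
    exact e
  obtain ⟨p, hp, hpu⟩ := exists_isPrim_of_weak
    (locallyIntegrableOn_of_memLp_radMeas hu₀2).2 (locallyIntegrableOn_of_memLp_radMeas hb).2 hweak
  have hpu' : ∀ᵐ r ∂(radMeas (2 * d + 1)), u₀ r = p r := radMeas_ac _ hpu
  have hp2 : MemLp p 2 (radMeas (2 * d + 1)) := hu₀2.ae_eq hpu'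
  have hup : u =ᵐ[volume] fun q => p (koranyi q) := by
    filter_upwards [hu₀, ae_comp_koranyi h₀ hpu'] with q h1 h2
    rw [h1, h2]
  exact ⟨p, b, hp, hp2, hb, hup,
    hGrad_ae_eq ((isWeakHGrad_radial hc₀ hc₁ h₀ h₁ hp hp2 hb).congr hup.symm)⟩

end RadialProfile

/-! ### Bounds for the radial equation -/

section RadialEstimates

variable {d : ℕ} {p v g : ℝ → ℂ} {μ : ℂ}

theorem isPrim_exp (κ : ℝ) : IsPrim (fun r : ℝ => Complex.exp (-(Complex.I * (κ * r : ℝ))))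
    (fun r => -(Complex.I * κ) * Complex.exp (-(Complex.I * (κ * r : ℝ)))) := by
  refine IsPrim.of_hasDerivAt (fun x _ => ?_) (by fun_prop)
  have h1 : HasDerivAt (fun r : ℝ => -(Complex.I * ((κ * r : ℝ) : ℂ))) (-(Complex.I * κ)) x := by
    have := ((((hasDerivAt_id x).const_mul κ).ofReal_comp).const_mul Complex.I).neg
    exact this.congr_deriv (by simp)
  exact h1.cexp.congr_deriv (mul_comm _ _)

theorem norm_exp_neg_I_mul (x : ℝ) : ‖Complex.exp (-(Complex.I * (x : ℝ)))‖ = 1 := by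
  have : -(Complex.I * (x : ℂ)) = ((-x : ℝ) : ℂ) * Complex.I := by push_cast; ring
  rw [this, Complex.norm_exp_ofReal_mul_I]

theorem IsPrim.gauge (h : IsPrim p v) (κ : ℝ) :
    IsPrim (fun r => Complex.exp (-(Complex.I * (κ * r : ℝ))) * p r)
      (fun r => Complex.exp (-(Complex.I * (κ * r : ℝ))) * (v r - Complex.I * κ * p r)) :=
  ((isPrim_exp κ).mul h).congr fun r _ => by ring

theorem memLp_gauge {q : ℝ → ℂ} {ν : Measure ℝ} (hq : MemLp q 2 ν) (κ : ℝ) :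
    MemLp (fun r => Complex.exp (-(Complex.I * (κ * r : ℝ))) * q r) 2 ν := by
  have hc : Continuous fun r : ℝ => Complex.exp (-(Complex.I * (κ * r : ℝ))) := by fun_prop
  refine hq.mono (hc.aestronglyMeasurable.mul hq.1) (Filter.Eventually.of_forall fun r => ?_)
  rw [norm_mul, norm_exp_neg_I_mul, one_mul]

/-- Hardy's inequality applied to e^{-iκr} p, which has the modulus of p and a derivative of modulus
|v - iκp|. -/
theorem hardy_gauge (hd : 1 ≤ d) (h : IsPrim p v) (hp : MemLp p 2 (radMeas (2 * d + 1)))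
    (hv : MemLp v 2 (radMeas (2 * d + 1))) (κ : ℝ) :
    √(∫ r, (‖p r‖ / r) ^ 2 ∂(radMeas (2 * d + 1)))
      ≤ √(∫ r, ‖v r - Complex.I * κ * p r‖ ^ 2 ∂(radMeas (2 * d + 1))) / d := by
  have h2 := (hardy hd (h.gauge κ) (memLp_gauge hp κ)
    (memLp_gauge (hv.sub (hp.const_mul (Complex.I * κ))) κ)).2
  simp_rw [norm_mul (Complex.exp _), norm_exp_neg_I_mul, one_mul] at h2
  refine (Real.sqrt_le_sqrt h2).trans_eq ?_
  rw [Real.sqrt_div' _ (by positivity), Real.sqrt_sq (by positivity)]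

theorem norm_energy_pairing_le {n : ℕ} (hx : MemLp (fun r => ‖p r‖ / r) 2 (radMeas n))
    (hg : MemLp g 2 (radMeas n)) :
    ‖∫ r, starRingEnd ℂ (p r) * ((r⁻¹ : ℝ) : ℂ) * g r ∂(radMeas n)‖
      ≤ √(∫ r, (‖p r‖ / r) ^ 2 ∂(radMeas n)) * √(∫ r, ‖g r‖ ^ 2 ∂(radMeas n)) := by
  refine (norm_integral_le_integral_norm _).trans ?_
  refine le_trans (le_of_eq ?_) (integral_mul_le_sqrt hx hg.norm)
  refine integral_congr_ae ?_
  filter_upwards [ae_radMeas_pos n] with r hr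
  rw [norm_mul, norm_mul, RCLike.norm_conj, Complex.norm_real, Real.norm_of_nonneg (by positivity),
    abs_of_nonneg (by positivity), div_eq_mul_inv]

/-- The bound in the regime away from the positive half line. -/
theorem sqrt_energy_le_of_lt (hd : 1 ≤ d) (h : IsPrim p v) (hp : MemLp p 2 (radMeas (2 * d + 1)))
    (hv : MemLp v 2 (radMeas (2 * d + 1))) (hg : MemLp g 2 (radMeas (2 * d + 1)))
    (hE : -((∫ r, ‖v r‖ ^ 2 ∂(radMeas (2 * d + 1)) : ℝ) : ℂ)
        + μ * ((∫ r, ‖p r‖ ^ 2 ∂(radMeas (2 * d + 1)) : ℝ) : ℂ)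
      = ∫ r, starRingEnd ℂ (p r) * ((r⁻¹ : ℝ) : ℂ) * g r ∂(radMeas (2 * d + 1)))
    {δ : ℝ} (hδ : 0 < δ) (hμ : δ * μ.re < |μ.im|) :
    √(∫ r, ‖v r‖ ^ 2 ∂(radMeas (2 * d + 1)))
      ≤ (1 + 1 / δ) / d * √(∫ r, ‖g r‖ ^ 2 ∂(radMeas (2 * d + 1))) := by
  have hx := (hardy hd h hp hv).1
  have hxe := hardy_gauge hd h hp hv 0
  simp only [Complex.ofReal_zero, mul_zero, zero_mul, sub_zero] at hxe
  have hpair := norm_energy_pairing_le hx hg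
  rw [← hE] at hpair
  set E := ∫ r, ‖v r‖ ^ 2 ∂(radMeas (2 * d + 1))
  set Y := ∫ r, ‖p r‖ ^ 2 ∂(radMeas (2 * d + 1))
  set X := √(∫ r, (‖p r‖ / r) ^ 2 ∂(radMeas (2 * d + 1)))
  set N := √(∫ r, ‖g r‖ ^ 2 ∂(radMeas (2 * d + 1)))
  have hE0 : 0 ≤ E := integral_nonneg fun _ => by positivity
  have hY0 : 0 ≤ Y := integral_nonneg fun _ => by positivity
  have hN0 : 0 ≤ N := Real.sqrt_nonneg _
  -- The real part gives E ≤ X N + Re μ · Y and the imaginary part gives |Im μ| Y ≤ X N.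
  have hre := (Complex.abs_re_le_norm _).trans hpair
  have him := (Complex.abs_im_le_norm _).trans hpair
  simp at hre him
  have hd0 : (0 : ℝ) < d := by exact_mod_cast hd
  have h1 : μ.re * Y ≤ 1 / δ * (X * N) := by
    rw [abs_of_nonneg hY0] at him
    have h2 : μ.re ≤ 1 / δ * |μ.im| := by
      rw [one_div, ← div_eq_inv_mul, le_div_iff₀ hδ]; linarith
    calc μ.re * Y ≤ 1 / δ * |μ.im| * Y := by gcongr
      _ = 1 / δ * (|μ.im| * Y) := by ring
      _ ≤ _ := by gcongr
  have h3 : E ≤ (1 + 1 / δ) * (X * N) := by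
    have := (abs_le.1 hre).1
    linarith
  have h4 : √E * √E ≤ (1 + 1 / δ) / d * N * √E := by
    rw [Real.mul_self_sqrt hE0]
    calc E ≤ (1 + 1 / δ) * (X * N) := h3
      _ ≤ (1 + 1 / δ) * (√E / d * N) := by gcongr
      _ = _ := by ring
  rcases (Real.sqrt_nonneg E).eq_or_lt with h5 | h5
  · rw [← h5]; positivity
  · exact le_of_mul_le_mul_right h4 h5

/-- The bound for the gauge transformed function in the regime near the positive half line. -/
theorem sqrt_gauge_energy_le (hd : 1 ≤ d) (h : IsPrim p v)
    (hp : MemLp p 2 (radMeas (2 * d + 1)))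
    (hv : MemLp v 2 (radMeas (2 * d + 1))) (hg : MemLp g 2 (radMeas (2 * d + 1)))
    (hvp : IsPrim v fun r => -((((2 * d + 1 : ℕ) / r : ℝ) : ℂ) * v r) + ((r⁻¹ : ℝ) : ℂ) * g r
      - μ * p r)
    (hE : -((∫ r, ‖v r‖ ^ 2 ∂(radMeas (2 * d + 1)) : ℝ) : ℂ)
        + μ * ((∫ r, ‖p r‖ ^ 2 ∂(radMeas (2 * d + 1)) : ℝ) : ℂ)
      = ∫ r, starRingEnd ℂ (p r) * ((r⁻¹ : ℝ) : ℂ) * g r ∂(radMeas (2 * d + 1)))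
    {δ γ : ℝ} (hδ : 0 < δ) (hγ : 0 < γ) (hμ : |μ.im| ≤ δ * μ.re) {κ : ℝ}
    (hκ : κ = sgn μ.im * √μ.re) :
    √(∫ r, ‖v r - Complex.I * κ * p r‖ ^ 2 ∂(radMeas (2 * d + 1)))
      ≤ KFun d δ γ * √(∫ r, ‖g r‖ ^ 2 ∂(radMeas (2 * d + 1))) := by
  set n := 2 * d + 1 with hn
  set k := √μ.re with hk
  -- Chosen so that 2εκ = Im μ and μ = κ² + 2iεκ. If k = 0 the regime forces Im μ = 0, and the
  -- division by zero returns the right value ε = 0.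
  set ε := |μ.im| / (2 * k) with hε
  have hre0 : 0 ≤ μ.re := nonneg_of_mul_nonneg_right ((abs_nonneg _).trans hμ) hδ
  have hk2 : k ^ 2 = μ.re := Real.sq_sqrt hre0
  have hk0 : 0 ≤ k := Real.sqrt_nonneg _
  have hε0 : 0 ≤ ε := by positivity
  have h2εk : 2 * ε * k = |μ.im| := by
    rcases hk0.eq_or_lt with h0 | h0
    · have : μ.re = 0 := by rw [← hk2, ← h0]; norm_num
      rw [this, mul_zero] at hμ
      rw [← h0, mul_zero]
      exact le_antisymm (abs_nonneg _) hμ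
    · simp only [hε]; field_simp
  have hs : sgn μ.im * |μ.im| = μ.im := by
    unfold sgn
    split_ifs with h0
    · simp [h0]
    · have := abs_ne_zero.2 h0; field_simp
  have hs2 : sgn μ.im ^ 2 = 1 := by
    unfold sgn
    split_ifs with h0
    · simp
    · have := abs_ne_zero.2 h0
      rw [div_pow, sq_abs, div_self (by positivity)]
  have h2εκ : 2 * ε * κ = μ.im := by
    calc 2 * ε * κ = sgn μ.im * (2 * ε * k) := by rw [hκ]; ring
      _ = μ.im := by rw [h2εk, hs]
  have hκ2 : κ ^ 2 = μ.re := by rw [hκ, mul_pow, hs2, hk2, one_mul]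
  have hμeq : μ = (κ : ℂ) ^ 2 + Complex.I * ((2 * ε * κ : ℝ) : ℂ) := by
    rw [h2εκ, ← Complex.ofReal_pow, hκ2, mul_comm, Complex.re_add_im]
  set y : ℝ → ℂ := fun r => v r - Complex.I * κ * p r with hy
  have hy2 : MemLp y 2 (radMeas n) := hv.sub (hp.const_mul (Complex.I * κ))
  have hpy : IsPrim p (fun r => y r + Complex.I * κ * p r) := h.congr fun r _ => by
    simp only [hy]; ring
  have hyp : IsPrim y (fun r => -(((n / r : ℝ) : ℂ) * y r) - Complex.I * κ * ((n / r : ℝ) : ℂ) * p r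
      - Complex.I * κ * y r + ((r⁻¹ : ℝ) : ℂ) * g r - Complex.I * ((2 * ε * κ : ℝ) : ℂ) * p r) := by
    refine ((hvp.add (h.const_mul (-(Complex.I * κ)))).congr_left fun r _ => ?_).congr fun r _ => ?_
    · simp only [hy]; ring
    · simp only [hy]
      rw [hμeq]
      linear_combination (-(κ : ℂ) ^ 2 * p r) * Complex.I_sq
  have hx := (hardy hd h hp hv).1
  have hmul := radial_multiplier (by omega) hε0 hpy hyp hp hy2 hg hx
  have hpair := norm_energy_pairing_le hx hg
  rw [← hE] at hpair
  have him := (Complex.abs_im_le_norm _).trans hpair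
  simp at him
  have hxe := hardy_gauge hd h hp hv κ
  have hY0 : 0 ≤ ∫ r, ‖p r‖ ^ 2 ∂(radMeas n) := integral_nonneg fun _ => by positivity
  rw [abs_of_nonneg hY0] at him
  have hX0 := Real.sqrt_nonneg (∫ r, (‖p r‖ / r) ^ 2 ∂(radMeas n))
  have hN0 := Real.sqrt_nonneg (∫ r, ‖g r‖ ^ 2 ∂(radMeas n))
  have h4 : √(∫ r, ‖y r‖ ^ 2 ∂(radMeas n)) ^ 2
      ≤ 2 * (√(∫ r, ‖y r‖ ^ 2 ∂(radMeas n)) * √(∫ r, ‖g r‖ ^ 2 ∂(radMeas n)))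
      + (2 * d + 1) * (√(∫ r, (‖p r‖ / r) ^ 2 ∂(radMeas n)) * √(∫ r, ‖g r‖ ^ 2 ∂(radMeas n)))
      + 2 * ε * (√(∫ r, ‖p r‖ ^ 2 ∂(radMeas n)) * √(∫ r, ‖g r‖ ^ 2 ∂(radMeas n))) := by
    rw [Real.sq_sqrt (integral_nonneg fun _ => by positivity)]
    refine hmul.trans (le_of_eq ?_)
    rw [hn]; push_cast; ring
  -- For k = 0 the ε-terms are absent, and any positive number, here 1, may serve as k.
  rcases hk0.eq_or_lt with h0 | h0
  · have hεz : ε = 0 := by simp [hε, ← h0]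
    exact le_KFun_mul hd (Real.sqrt_nonneg _) hN0 hε0 one_pos hδ hγ (by rw [hεz]; linarith)
      (by rw [hεz]; simp only [mul_zero, zero_mul]; positivity) hxe h4
  · exact le_KFun_mul hd (Real.sqrt_nonneg _) hN0 hε0 h0 hδ hγ (by rw [h2εk, hk2]; exact hμ)
      (by rw [h2εk, Real.sq_sqrt hY0]; exact him) hxe h4

end RadialEstimates

/-! ### Reduction of the weak equation to an ordinary differential equation -/

section RadialEquation

variable {d : ℕ} {c₀ c₁ : ℝ} {p v : ℝ → ℂ} {u f : H d → ℂ} {F : (H d → ℂ) → ℂ} {lam : ℂ}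

theorem ae_fst_ne_zero (hd : 1 ≤ d) : ∀ᵐ q : H d, q.1 ≠ 0 := by
  have : Nonempty (Idx d) := ⟨Sum.inl ⟨0, hd⟩⟩
  have h : ∀ᵐ z : EuclideanSpace ℝ (Idx d), z ≠ 0 := by simp [ae_iff]
  exact Measure.quasiMeasurePreserving_fst.ae h

theorem koranyi_pos_of_fst {q : H d} (hq : q.1 ≠ 0) : 0 < koranyi q :=
  koranyi_pos fun h => hq (by rw [h]; rfl)

/-- A radial profile in `L²` with derivative in `L²` gives an element of `H¹`. -/
theorem memH1_radial (hc₀ : 0 < c₀) (hc₁ : 0 < c₁) {n : ℕ}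
    (h₀ : Measure.map koranyi (volume : Measure (H d)) = ENNReal.ofReal c₀ • radMeas n)
    (h₁ : Measure.map koranyi (wMeas d) = ENNReal.ofReal c₁ • radMeas n)
    (h : IsPrim p v) (hp : MemLp p 2 (radMeas n)) (hv : MemLp v 2 (radMeas n))
    (hu : u =ᵐ[volume] fun q => p (koranyi q)) : MemH1 u ∧ hGrad u =ᵐ[volume] radGrad v := by
  have hw := (isWeakHGrad_radial hc₀ hc₁ h₀ h₁ h hp hv).congr hu.symm
  exact ⟨⟨((memLp_comp_koranyi_iff hc₀ h₀ hp.1).2 hp).ae_eq hu.symm, radGrad v, hw,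
    (memLp_radGrad hc₁ h₀ h₁ hv).1⟩, hGrad_ae_eq hw⟩

/-- The weak equation tested with a radial function. -/
theorem radial_weak_identity (hd : 1 ≤ d) (hc₀ : 0 < c₀) (hc₁ : 0 < c₁)
    (h₀ : Measure.map koranyi (volume : Measure (H d)) = ENNReal.ofReal c₀ • radMeas (2 * d + 1))
    (h₁ : Measure.map koranyi (wMeas d) = ENNReal.ofReal c₁ • radMeas (2 * d + 1))
    (hp : MemLp p 2 (radMeas (2 * d + 1))) (hv : MemLp v 2 (radMeas (2 * d + 1)))
    (hup : u =ᵐ[volume] fun q => p (koranyi q)) (hgr : hGrad u =ᵐ[volume] radGrad v)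
    (hsol : IsWeakSolution lam F u) (hF : Represents F f) {g : ℝ → ℂ}
    (hg : ∀ θ : ℝ → ℂ, MemLp θ 2 (radMeas (2 * d + 1)) →
      ∫ q, θ (koranyi q) * ((koranyi q : ℂ) * f q) = c₁ * ∫ r, θ r * g r ∂(radMeas (2 * d + 1)))
    {η ζ : ℝ → ℂ} (h : IsPrim η ζ) (hη : MemLp η 2 (radMeas (2 * d + 1)))
    (hζ : MemLp ζ 2 (radMeas (2 * d + 1))) :
    -(∫ r, starRingEnd ℂ (ζ r) * v r ∂(radMeas (2 * d + 1)))
      + lam * ((c₀ / c₁ : ℝ) : ℂ) * ∫ r, starRingEnd ℂ (η r) * p r ∂(radMeas (2 * d + 1))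
      = ∫ r, starRingEnd ℂ (η r) * ((r⁻¹ : ℝ) : ℂ) * g r ∂(radMeas (2 * d + 1)) := by
  obtain ⟨hH, hG⟩ := memH1_radial (u := fun q : H d => η (koranyi q)) hc₀ hc₁ h₀ h₁ h hη hζ
    Filter.EventuallyEq.rfl
  have e := hsol.2 _ hH
  rw [(hF.2 _ hH).2] at e
  have e1 : ∫ q, inner ℂ (hGrad (fun q : H d => η (koranyi q)) q) (hGrad u q)
      = c₁ * ∫ r, starRingEnd ℂ (ζ r) * v r ∂(radMeas (2 * d + 1)) := by
    have hm : AEStronglyMeasurable (fun r => starRingEnd ℂ (ζ r) * v r) (radMeas (2 * d + 1)) :=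
      (Complex.continuous_conj.comp_aestronglyMeasurable hζ.1).mul hv.1
    have e2 := integral_comp_koranyi hc₁ h₁ hm
    rw [integral_wMeas, Complex.real_smul] at e2
    rw [← e2]
    refine integral_congr_ae ?_
    filter_upwards [hG, hgr] with q h1 h2
    rw [h1, h2, inner_radGrad, Complex.real_smul]
  have e3 : ∫ q, starRingEnd ℂ (η (koranyi q)) * u q
      = c₀ * ∫ r, starRingEnd ℂ (η r) * p r ∂(radMeas (2 * d + 1)) := by
    have hm : AEStronglyMeasurable (fun r => starRingEnd ℂ (η r) * p r) (radMeas (2 * d + 1)) :=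
      (Complex.continuous_conj.comp_aestronglyMeasurable hη.1).mul hp.1
    have e2 := integral_comp_koranyi hc₀ h₀ hm
    rw [Complex.real_smul] at e2
    rw [← e2]
    refine integral_congr_ae ?_
    filter_upwards [hup] with q h1
    rw [h1]
  -- Since g represents ρ f, the test profile must be divided by r; Hardy's inequality keeps it in
  -- L².
  have hθ : MemLp (fun r => starRingEnd ℂ (η r) * ((r⁻¹ : ℝ) : ℂ)) 2 (radMeas (2 * d + 1)) := by
    refine (hardy hd h hη hζ).1.mono ((Complex.continuous_conj.comp_aestronglyMeasurable hη.1).mul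
      (Complex.measurable_ofReal.comp measurable_inv).aestronglyMeasurable)
      (Filter.Eventually.of_forall fun r => ?_)
    simp [div_eq_mul_inv]
  have e4 : ∫ q, starRingEnd ℂ (η (koranyi q)) * f q
      = c₁ * ∫ r, starRingEnd ℂ (η r) * ((r⁻¹ : ℝ) : ℂ) * g r ∂(radMeas (2 * d + 1)) := by
    rw [← hg _ hθ]
    refine integral_congr_ae ?_
    filter_upwards [ae_fst_ne_zero hd] with q hq
    have : (koranyi q : ℂ) ≠ 0 := by exact_mod_cast (koranyi_pos_of_fst hq).ne'
    push_cast
    field_simp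
  rw [e1, e3, e4] at e
  have hc : (c₁ : ℂ) ≠ 0 := by exact_mod_cast hc₁.ne'
  apply mul_left_cancel₀ hc
  rw [← e]
  push_cast
  field_simp

theorem isPrim_inv_pow (n : ℕ) : IsPrim (fun r : ℝ => (r ^ n)⁻¹) fun r => -(n / r) * (r ^ n)⁻¹ := by
  refine IsPrim.of_hasDerivAt (fun x hx => ?_) ?_
  · refine ((hasDerivAt_pow n x).inv (pow_pos hx n).ne').congr_deriv ?_
    rcases n with _ | n
    · simp
    · simp only [Nat.add_sub_cancel]; field_simp; ring
  · refine ContinuousOn.mul (continuousOn_const.div continuousOn_id fun x hx => (ne_of_gt hx)).neg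
      ((continuous_pow n).continuousOn.inv₀ fun x hx => (pow_pos hx n).ne')

/-- The weak form of the radial equation. -/
theorem exists_isPrim_of_weak_equation {n : ℕ} {g : ℝ → ℂ} {μ : ℂ}
    (hp : MemLp p 2 (radMeas n)) (hv : MemLp v 2 (radMeas n)) (hg : MemLp g 2 (radMeas n))
    (h : ∀ χ : ℝ → ℝ, ContDiff ℝ ∞ χ → HasCompactSupport χ → tsupport χ ⊆ Ioi 0 →
      -(∫ r, ((deriv χ r : ℝ) : ℂ) * v r ∂(radMeas n))
        + μ * ∫ r, ((χ r : ℝ) : ℂ) * p r ∂(radMeas n)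
      = ∫ r, ((χ r : ℝ) : ℂ) * ((r⁻¹ : ℝ) : ℂ) * g r ∂(radMeas n)) :
    ∃ w : ℝ → ℂ, IsPrim w (fun r => -(((n / r : ℝ) : ℂ) * w r) + ((r⁻¹ : ℝ) : ℂ) * g r - μ * p r) ∧
      v =ᵐ[volume.restrict (Ioi (0 : ℝ))] w := by
  have hU := (locallyIntegrableOn_of_memLp_radMeas hv).1
  have hgl : LocallyIntegrableOn (fun r : ℝ => r⁻¹ • (r ^ n • g r)) (Ioi 0) :=
    (locallyIntegrableOn_of_memLp_radMeas hg).1.continuousOn_smul isOpen_Ioi.isLocallyClosed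
      (continuousOn_inv₀.mono fun x hx => (ne_of_gt hx))
  have hpl : LocallyIntegrableOn (fun r : ℝ => μ * (r ^ n • p r)) (Ioi 0) :=
    (locallyIntegrableOn_of_memLp_radMeas hp).1.continuousOn_mul continuousOn_const
      isOpen_Ioi.isLocallyClosed
  -- In divergence form the equation says that rⁿ v has weak derivative rⁿ (g/r - μ p); dividing by
  -- rⁿ produces the term -(n/r) w.
  obtain ⟨V, hV, hVv⟩ := exists_isPrim_of_weak hU (hgl.sub hpl) (by
    intro χ hd hc hs
    have e := h χ hd hc hs
    have h0 : ∀ x, x ∉ Ioi (0 : ℝ) → χ x = 0 ∧ deriv χ x = 0 := fun x hx =>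
      ⟨image_eq_zero_of_notMem_tsupport fun h' => hx (hs h'),
        image_eq_zero_of_notMem_tsupport fun h' => hx (hs (tsupport_deriv_subset h'))⟩
    have k1 := integrable_test_mul hd.continuous hc hs hgl
    have k2 := integrable_test_mul hd.continuous hc hs hpl
    rw [integral_radMeas, integral_radMeas, integral_radMeas,
      setIntegral_eq_integral_of_forall_compl_eq_zero (fun x hx => by rw [(h0 x hx).2]; simp),
      setIntegral_eq_integral_of_forall_compl_eq_zero (fun x hx => by rw [(h0 x hx).1]; simp),
      setIntegral_eq_integral_of_forall_compl_eq_zero (fun x hx => by rw [(h0 x hx).1]; simp)] at e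
    have e1 : ∫ x, ((χ x : ℝ) : ℂ) * (x⁻¹ • (x ^ n • g x) - μ * (x ^ n • p x))
        = (∫ x, ((χ x : ℝ) : ℂ) * (x⁻¹ • (x ^ n • g x)))
          - ∫ x, ((χ x : ℝ) : ℂ) * (μ * (x ^ n • p x)) := by
      rw [← integral_sub k1 k2]
      simp_rw [mul_sub]
    have e2 : ∫ x, ((χ x : ℝ) : ℂ) * (x⁻¹ • (x ^ n • g x))
        = ∫ x : ℝ, x ^ n • (((χ x : ℝ) : ℂ) * ((x⁻¹ : ℝ) : ℂ) * g x) := by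
      congr 1; ext x; simp only [Complex.real_smul]; ring
    have e3 : ∫ x, ((χ x : ℝ) : ℂ) * (μ * (x ^ n • p x))
        = μ * ∫ x : ℝ, x ^ n • (((χ x : ℝ) : ℂ) * p x) := by
      rw [← integral_const_mul]
      congr 1; ext x; simp only [Complex.real_smul]; ring
    have e4 : ∫ x, ((deriv χ x : ℝ) : ℂ) * (x ^ n • v x)
        = ∫ x : ℝ, x ^ n • (((deriv χ x : ℝ) : ℂ) * v x) := by
      congr 1; ext x; simp only [Complex.real_smul]; ring
    simp only [Pi.sub_apply]
    rw [e1, e2, e3, e4]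
    linear_combination -e)
  refine ⟨fun r => (((r ^ n)⁻¹ : ℝ) : ℂ) * V r,
    ((isPrim_inv_pow n).ofReal.mul hV).congr fun r hr => ?_, ?_⟩
  · have hr0 : (r : ℂ) ≠ 0 := by exact_mod_cast hr.ne'
    simp only [Pi.sub_apply, Complex.real_smul]
    push_cast
    field_simp
    ring
  · filter_upwards [hVv, ae_restrict_mem measurableSet_Ioi] with r h1 hr
    have hr : 0 < r := hr
    have hr0 : (r : ℂ) ≠ 0 := by exact_mod_cast hr.ne'
    rw [← h1, Complex.real_smul]
    push_cast
    field_simp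

/-- The profile of a radial weak solution solves an ordinary differential equation. -/
theorem exists_radial_equation (hd : 1 ≤ d) (hc₀ : 0 < c₀) (hc₁ : 0 < c₁)
    (h₀ : Measure.map koranyi (volume : Measure (H d)) = ENNReal.ofReal c₀ • radMeas (2 * d + 1))
    (h₁ : Measure.map koranyi (wMeas d) = ENNReal.ofReal c₁ • radMeas (2 * d + 1))
    (h : IsPrim p v)
    (hp : MemLp p 2 (radMeas (2 * d + 1))) (hv : MemLp v 2 (radMeas (2 * d + 1)))
    (hup : u =ᵐ[volume] fun q => p (koranyi q)) (hgr : hGrad u =ᵐ[volume] radGrad v)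
    (hsol : IsWeakSolution lam F u) (hF : Represents F f)
    (hf : MemLp (fun q : H d => ((koranyi q ^ 2 / ‖q.1‖ : ℝ) : ℂ) * f q) 2 volume) :
    ∃ w g : ℝ → ℂ, IsPrim p w ∧ MemLp w 2 (radMeas (2 * d + 1)) ∧
      MemLp g 2 (radMeas (2 * d + 1)) ∧ (v =ᵐ[volume.restrict (Ioi (0 : ℝ))] w) ∧
      c₁ * ∫ r, ‖g r‖ ^ 2 ∂(radMeas (2 * d + 1))
        ≤ ∫ q : H d, ‖((koranyi q ^ 2 / ‖q.1‖ : ℝ) : ℂ) * f q‖ ^ 2 ∧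
      IsPrim w (fun r => -((((2 * d + 1 : ℕ) / r : ℝ) : ℂ) * w r) + ((r⁻¹ : ℝ) : ℂ) * g r
        - lam * ((c₀ / c₁ : ℝ) : ℂ) * p r) ∧
      -((∫ r, ‖w r‖ ^ 2 ∂(radMeas (2 * d + 1)) : ℝ) : ℂ)
        + lam * ((c₀ / c₁ : ℝ) : ℂ) * ((∫ r, ‖p r‖ ^ 2 ∂(radMeas (2 * d + 1)) : ℝ) : ℂ)
      = ∫ r, starRingEnd ℂ (p r) * ((r⁻¹ : ℝ) : ℂ) * g r ∂(radMeas (2 * d + 1)) := by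
  obtain ⟨g, hg2, hgN, hg⟩ := exists_push hc₁ h₁ (h := fun q => (koranyi q : ℂ) * f q)
    (k := fun q => ‖((koranyi q ^ 2 / ‖q.1‖ : ℝ) : ℂ) * f q‖)
    ((Complex.measurable_ofReal.comp measurable_koranyi).aestronglyMeasurable.mul hF.1) hf.norm (by
      filter_upwards [ae_fst_ne_zero hd] with q hq
      have h1 := koranyi_pos_of_fst hq
      have h2 := norm_pos_iff.2 hq
      rw [norm_mul, norm_mul, Complex.norm_real, Complex.norm_real, Real.norm_of_nonneg h1.le,
        Real.norm_of_nonneg (by positivity)]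
      apply le_of_eq
      field_simp)
  have hid := fun {η ζ : ℝ → ℂ} => radial_weak_identity (η := η) (ζ := ζ) hd hc₀ hc₁ h₀ h₁ hp hv
    hup hgr hsol hF (fun θ hθ => (hg θ hθ).2)
  obtain ⟨w, hw, hvw⟩ := exists_isPrim_of_weak_equation hp hv hg2 (μ := lam * ((c₀ / c₁ : ℝ) : ℂ))
    (by
      intro χ hd hc hs
      have e := hid (isPrim_of_contDiff hd).ofReal (memLp_radMeas_of_continuous hd.continuous hc)
        (memLp_radMeas_of_continuous (hd.continuous_deriv (by simp)) hc.deriv)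
      simpa only [Complex.conj_ofReal] using e)
  refine ⟨w, g, h.congr_ae hvw, hv.ae_eq (radMeas_ac _ hvw), hg2, hvw, hgN, hw, ?_⟩
  -- Testing with p itself, admissible because u is in H¹, is the energy identity.
  have e := hid h hp hv
  have k : ∀ z : ℂ, starRingEnd ℂ z * z = ((‖z‖ ^ 2 : ℝ) : ℂ) := fun z => by
    rw [mul_comm, Complex.mul_conj, Complex.normSq_eq_norm_sq]
  simp_rw [k] at e
  rw [integral_complex_ofReal, integral_complex_ofReal] at e
  rw [← e]
  congr 3
  refine integral_congr_ae ?_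
  filter_upwards [radMeas_ac _ hvw] with r hr
  rw [hr]

end RadialEquation

/-! ### The weighted norm as an infimum -/

section Norms

variable {α E : Type*} [MeasurableSpace α] [NormedAddCommGroup E] {ν : Measure α}

theorem eLpNorm_two_eq_ofReal_sqrt {f : α → E} (hf : MemLp f 2 ν) :
    eLpNorm f 2 ν = ENNReal.ofReal (√(∫ a, ‖f a‖ ^ 2 ∂ν)) := by
  rw [hf.eLpNorm_eq_integral_rpow_norm two_ne_zero (by norm_num), Real.sqrt_eq_rpow]
  congr 1
  simp

variable {d : ℕ}

/-- Reduces to representing functions of finite norm. Positivity of C matters: with an infinite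
norm, 0 · ∞ would be 0. -/
theorem le_mul_weightedNorm {A : ℝ≥0∞} {C : ℝ} (hC : 0 < C) {F : (H d → ℂ) → ℂ}
    (h : ∀ f : H d → ℂ, Represents F f →
      MemLp (fun q : H d => ((koranyi q ^ 2 / ‖q.1‖ : ℝ) : ℂ) * f q) 2 volume →
      A ≤ ENNReal.ofReal C *
        eLpNorm (fun q : H d => ((koranyi q ^ 2 / ‖q.1‖ : ℝ) : ℂ) * f q) 2 volume) :
    A ≤ ENNReal.ofReal C * weightedNorm F := by
  have hC0 : ENNReal.ofReal C ≠ 0 := by simpa using hC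
  rw [mul_comm, ← ENNReal.div_le_iff hC0 ENNReal.ofReal_ne_top]
  refine le_iInf₂ fun f hf => ?_
  rw [ENNReal.div_le_iff hC0 ENNReal.ofReal_ne_top, mul_comm]
  by_cases htop : eLpNorm (fun q : H d => ((koranyi q ^ 2 / ‖q.1‖ : ℝ) : ℂ) * f q) 2 volume = ⊤
  · rw [htop, ENNReal.mul_top hC0]; exact le_top
  · refine h f hf ⟨?_, lt_top_iff_ne_top.2 htop⟩
    exact (Complex.measurable_ofReal.comp ((measurable_koranyi.pow_const 2).div
      measurable_fst.norm)).aestronglyMeasurable.mul hf.1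

end Norms

/-! ### Assembly of the theorem -/

section Main

variable {d : ℕ} {c₀ c₁ : ℝ}

/-- The Gamma factor in the phase is √(c₀/c₁), so the phase is κρ with κ built from μ; a positive
factor does not change the sign of the imaginary part. -/
theorem phase_eq (hd : 1 ≤ d) (hc₀ : 0 < c₀) (hc₁ : 0 < c₁)
    (hc : c₀ / c₁ = (d : ℝ) / 2 *
      (Real.Gamma ((d : ℝ) / 2) / Real.Gamma (((d : ℝ) + 1) / 2)) ^ 2)
    {lam : ℂ} (hl : 0 ≤ lam.re) (q : H d) :
    phase lam q = sgn (lam * ((c₀ / c₁ : ℝ) : ℂ)).im * √(lam * ((c₀ / c₁ : ℝ) : ℂ)).re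
      * koranyi q := by
  have ha : 0 < c₀ / c₁ := div_pos hc₀ hc₁
  have hd0 : (0 : ℝ) < d := by exact_mod_cast hd
  have hΓ : 0 < Real.Gamma ((d : ℝ) / 2) / Real.Gamma (((d : ℝ) + 1) / 2) :=
    div_pos (Real.Gamma_pos_of_pos (by positivity)) (Real.Gamma_pos_of_pos (by positivity))
  have h1 : sgn (lam.im * (c₀ / c₁)) = sgn lam.im := by
    unfold sgn
    by_cases h : lam.im = 0
    · simp [h]
    · rw [if_neg h, if_neg (mul_ne_zero h ha.ne'), abs_mul, abs_of_pos ha, mul_div_mul_right _ _ ha.ne']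
  rw [Complex.im_mul_ofReal, Complex.re_mul_ofReal, h1, Real.sqrt_mul hl, hc,
    Real.sqrt_mul (by positivity), Real.sqrt_sq hΓ.le, phase, abs_of_nonneg hl]
  ring

theorem weighted_norm_radial (hc₁ : 0 < c₁)
    (h₀ : Measure.map koranyi (volume : Measure (H d)) = ENNReal.ofReal c₀ • radMeas (2 * d + 1))
    (h₁ : Measure.map koranyi (wMeas d) = ENNReal.ofReal c₁ • radMeas (2 * d + 1))
    {p : ℝ → ℂ} {u : H d → ℂ} (hp : MemLp p 2 (radMeas (2 * d + 1)))
    (hx : MemLp (fun r => ‖p r‖ / r) 2 (radMeas (2 * d + 1)))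
    (hup : u =ᵐ[volume] fun q => p (koranyi q)) :
    eLpNorm (fun q : H d => ((‖q.1‖ / koranyi q ^ 2 : ℝ) : ℂ) * u q) 2 volume
      = ENNReal.ofReal (√c₁ * √(∫ r, (‖p r‖ / r) ^ 2 ∂(radMeas (2 * d + 1)))) := by
  have hx' : MemLp (fun r => ((r⁻¹ : ℝ) : ℂ) * p r) 2 (radMeas (2 * d + 1)) := by
    refine hx.mono ((Complex.measurable_ofReal.comp measurable_inv).aestronglyMeasurable.mul hp.1)
      (Filter.Eventually.of_forall fun r => ?_)
    simp [div_eq_mul_inv, mul_comm]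
  -- (|z|/ρ²)|u| = (|z|/ρ)|p/r| is the length of a radial gradient field with coefficient p/r.
  have hn : (fun q : H d => ‖((‖q.1‖ / koranyi q ^ 2 : ℝ) : ℂ) * u q‖)
      =ᵐ[volume] fun q => ‖radGrad (fun r => ((r⁻¹ : ℝ) : ℂ) * p r) q‖ := by
    filter_upwards [hup] with q hq
    rw [← sq_eq_sq₀ (norm_nonneg _) (norm_nonneg _), norm_radGrad_sq, hq, norm_mul, norm_mul,
      Complex.norm_real, Complex.norm_real, mul_pow, mul_pow, wt_eq_sq, Real.norm_eq_abs,
      Real.norm_eq_abs, sq_abs, sq_abs]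
    ring
  obtain ⟨hm, hi⟩ := memLp_radGrad hc₁ h₀ h₁ hx'
  rw [eLpNorm_congr_norm_ae hn, eLpNorm_two_eq_ofReal_sqrt hm, hi, Real.sqrt_mul hc₁.le]
  congr 4
  ext r
  rw [norm_mul, Complex.norm_real, mul_pow, div_pow, Real.norm_eq_abs, sq_abs]
  ring

end Main

end Heis

open Heis in
theorem theorem2p1 (d : ℕ) (hd : 1 ≤ d) :
    (∀ δ : ℝ, 0 < δ → IsLeast (Heis.KFun d δ '' Set.Ioi 0) (Heis.K d δ)) ∧
    IsLeast (Heis.kappaFun d '' Set.Ioi 0) (Heis.kappa d) ∧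
    ∀ (lam : ℂ) (f : (Heis.H d → ℂ) → ℂ) (u : Heis.H d → ℂ),
      Heis.IsHMinusOne f → Heis.IsWeakSolution lam f u → Heis.IsRadial u →
      (∀ δ : ℝ, 0 < δ →
        (δ * lam.re < |lam.im| →
          eLpNorm (Heis.hGrad u) 2 volume
            ≤ ENNReal.ofReal ((1 + 1 / δ) / d) * Heis.weightedNorm f) ∧
        (|lam.im| ≤ δ * lam.re →
          Heis.MemH1 (Heis.uMinus lam u) ∧
          eLpNorm (Heis.hGrad (Heis.uMinus lam u)) 2 volume
            ≤ ENNReal.ofReal (Heis.K d δ) * Heis.weightedNorm f)) ∧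
      eLpNorm (fun p => ((‖p.1‖ / Heis.koranyi p ^ 2 : ℝ) : ℂ) * u p) 2 volume
        ≤ ENNReal.ofReal (Heis.kappa d) * Heis.weightedNorm f := by
  have hK := fun δ hδ => KFun_isLeast (d := d) (δ := δ) hd hδ
  have hκ := kappa_isLeast (d := d) hd
  refine ⟨hK, hκ, fun lam F u _ hsol hrad => ?_⟩
  have hd0 : (0 : ℝ) < d := by exact_mod_cast hd
  obtain ⟨c₀, c₁, hc₀, hc₁, hc, h₀, h₁⟩ := exists_polar hd
  obtain ⟨p, v, hpv, hp, hv, hup, hgr⟩ := exists_profile hc₀ hc₁ h₀ h₁ hsol.1 hrad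
  set μ : ℂ := lam * ((c₀ / c₁ : ℝ) : ℂ) with hμdef
  have ha : 0 < c₀ / c₁ := div_pos hc₀ hc₁
  have hre : μ.re = lam.re * (c₀ / c₁) := Complex.re_mul_ofReal _ _
  have him : μ.im = lam.im * (c₀ / c₁) := Complex.im_mul_ofReal _ _
  have hx := (hardy hd hpv hp hv).1
  have hlt : ∀ δ : ℝ, δ * lam.re < |lam.im| → δ * μ.re < |μ.im| := fun δ h => by
    rw [hre, him, abs_mul, abs_of_pos ha, ← mul_assoc]
    exact mul_lt_mul_of_pos_right h ha
  have hle : ∀ δ : ℝ, |lam.im| ≤ δ * lam.re → |μ.im| ≤ δ * μ.re := fun δ h => by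
    rw [hre, him, abs_mul, abs_of_pos ha, ← mul_assoc]
    exact mul_le_mul_of_nonneg_right h ha.le
  set n := 2 * d + 1 with hn
  set κ : ℝ := sgn μ.im * √μ.re with hκdef
  -- Written with `v`, so that `e` and `E` do not depend on the function representing the right-hand
  -- side; the absolutely continuous derivative attached to that function agrees with `v` almost
  -- everywhere.
  set e : ℝ := √(∫ r, ‖v r - Complex.I * κ * p r‖ ^ 2 ∂(radMeas n)) with hedef
  set E : ℝ := √(∫ r, ‖v r‖ ^ 2 ∂(radMeas n)) with hEdef
  set X : ℝ := √(∫ r, (‖p r‖ / r) ^ 2 ∂(radMeas n)) with hXdef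
  have hs := Real.sqrt_nonneg c₁
  have hgrE : eLpNorm (hGrad u) 2 volume = ENNReal.ofReal (√c₁ * E) := by
    obtain ⟨hm, hi⟩ := memLp_radGrad hc₁ h₀ h₁ hv
    rw [eLpNorm_congr_ae hgr, eLpNorm_two_eq_ofReal_sqrt hm, hi, Real.sqrt_mul hc₁.le]
  have hX := weighted_norm_radial hc₁ h₀ h₁ hp hx hup
  have hXE : X ≤ E / d := by
    have := hardy_gauge hd hpv hp hv 0
    simpa only [Complex.ofReal_zero, mul_zero, zero_mul, sub_zero] using this
  have hXe : X ≤ e / d := hardy_gauge hd hpv hp hv κ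
  have key : ∀ f : H d → ℂ, Represents F f →
      MemLp (fun q : H d => ((koranyi q ^ 2 / ‖q.1‖ : ℝ) : ℂ) * f q) 2 volume →
      ∃ N : ℝ, 0 ≤ N ∧ eLpNorm (fun q : H d => ((koranyi q ^ 2 / ‖q.1‖ : ℝ) : ℂ) * f q) 2 volume
          = ENNReal.ofReal N ∧
        (∀ δ : ℝ, 0 < δ → δ * lam.re < |lam.im| → √c₁ * E ≤ (1 + 1 / δ) / d * N) ∧
        ∀ δ : ℝ, 0 < δ → |lam.im| ≤ δ * lam.re → √c₁ * e ≤ K d δ * N := by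
    intro f hF hf
    obtain ⟨w, g, hw, hw2, hg2, hvw, hgN, hwp, hE⟩ :=
      exists_radial_equation hd hc₀ hc₁ h₀ h₁ hpv hp hv hup hgr hsol hF hf
    have hvw' : v =ᵐ[radMeas n] w := radMeas_ac _ hvw
    have hEw : E = √(∫ r, ‖w r‖ ^ 2 ∂(radMeas n)) := by
      rw [hEdef]; congr 1
      exact integral_congr_ae (hvw'.mono fun r hr => by simp only [hr])
    have hew : e = √(∫ r, ‖w r - Complex.I * κ * p r‖ ^ 2 ∂(radMeas n)) := by
      rw [hedef]; congr 1
      exact integral_congr_ae (hvw'.mono fun r hr => by simp only [hr])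
    refine ⟨_, Real.sqrt_nonneg _, eLpNorm_two_eq_ofReal_sqrt hf, fun δ hδ h => ?_,
      fun δ hδ h => ?_⟩
    · have h2 := sqrt_energy_le_of_lt hd hw hp hw2 hg2 hE hδ (hlt δ h)
      rw [← hEw] at h2
      calc √c₁ * E ≤ √c₁ * ((1 + 1 / δ) / d * √(∫ r, ‖g r‖ ^ 2 ∂(radMeas n))) := by gcongr
        _ = (1 + 1 / δ) / d * √(c₁ * ∫ r, ‖g r‖ ^ 2 ∂(radMeas n)) := by
          rw [Real.sqrt_mul hc₁.le]; ring
        _ ≤ _ := by gcongr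
    -- The bound holds for every γ; taking a minimiser gives exactly `K d δ`.
    · obtain ⟨γ, hγ, hγK⟩ := (hK δ hδ).1
      have h2 := sqrt_gauge_energy_le hd hw hp hw2 hg2 hwp hE hδ hγ (hle δ h) hκdef
      rw [← hew, hγK] at h2
      have hK0 : 0 ≤ K d δ := by rw [← hγK]; exact (KFun_pos hd hγ).le
      calc √c₁ * e ≤ √c₁ * (K d δ * √(∫ r, ‖g r‖ ^ 2 ∂(radMeas n))) := by gcongr
        _ = K d δ * √(c₁ * ∫ r, ‖g r‖ ^ 2 ∂(radMeas n)) := by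
          rw [Real.sqrt_mul hc₁.le]; ring
        _ ≤ _ := by gcongr
  have hKpos : ∀ δ : ℝ, 0 < δ → 0 < K d δ := fun δ hδ => by
    obtain ⟨γ, hγ, hγK⟩ := (hK δ hδ).1
    rw [← hγK]; exact KFun_pos hd hγ
  refine ⟨fun δ hδ => ⟨fun h => ?_, fun h => ?_⟩, ?_⟩
  · refine le_mul_weightedNorm (by positivity) fun f hF hf => ?_
    obtain ⟨N, hN, hNf, h1, -⟩ := key f hF hf
    rw [hgrE, hNf, ← ENNReal.ofReal_mul (by positivity)]
    exact ENNReal.ofReal_le_ofReal (h1 δ hδ h)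
  · have hl : 0 ≤ lam.re := nonneg_of_mul_nonneg_right ((abs_nonneg _).trans h) hδ
    have hum : uMinus lam u
        =ᵐ[volume] fun q : H d => Complex.exp (-(Complex.I * (κ * koranyi q : ℝ)))
          * p (koranyi q) := by
      filter_upwards [hup] with q hq
      rw [uMinus, phase_eq hd hc₀ hc₁ hc hl, hq]
    have hy2 : MemLp (fun r => Complex.exp (-(Complex.I * (κ * r : ℝ)))
        * (v r - Complex.I * κ * p r)) 2 (radMeas n) :=
      memLp_gauge (hv.sub (hp.const_mul (Complex.I * κ))) κ
    obtain ⟨hH, hG⟩ := memH1_radial hc₀ hc₁ h₀ h₁ (hpv.gauge κ) (memLp_gauge hp κ) hy2 hum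
    refine ⟨hH, le_mul_weightedNorm (hKpos δ hδ) fun f hF hf => ?_⟩
    obtain ⟨N, hN, hNf, -, h2⟩ := key f hF hf
    obtain ⟨hm, hi⟩ := memLp_radGrad hc₁ h₀ h₁ hy2
    simp_rw [norm_mul (Complex.exp _), norm_exp_neg_I_mul, one_mul] at hi
    rw [eLpNorm_congr_ae hG, eLpNorm_two_eq_ofReal_sqrt hm, hNf,
      ← ENNReal.ofReal_mul (hKpos δ hδ).le]
    refine ENNReal.ofReal_le_ofReal ?_
    refine le_trans (le_of_eq ?_) (h2 δ hδ h)
    rw [hedef, ← Real.sqrt_mul hc₁.le]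
    exact congrArg _ hi
  -- At a minimising δ the two regimes cover every λ, and Hardy's inequality in the matching gauge
  -- costs the extra factor 1/d.
  · obtain ⟨δ, hδ, hδκ⟩ := hκ.1
    have hδ : 0 < δ := hδ
    have hk1 : (1 + 1 / δ) / (d : ℝ) ^ 2 ≤ kappa d := hδκ ▸ le_max_left _ _
    have hk2 : K d δ / d ≤ kappa d := hδκ ▸ le_max_right _ _
    have hkpos : 0 < kappa d := lt_of_lt_of_le (by positivity) hk1
    refine le_mul_weightedNorm hkpos fun f hF hf => ?_
    obtain ⟨N, hN, hNf, h1, h2⟩ := key f hF hf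
    rw [hX, hNf, ← ENNReal.ofReal_mul hkpos.le]
    refine ENNReal.ofReal_le_ofReal ?_
    rcases lt_or_ge (δ * lam.re) |lam.im| with h | h
    · calc √c₁ * X ≤ √c₁ * (E / d) := by gcongr
        _ = √c₁ * E / d := by ring
        _ ≤ (1 + 1 / δ) / d * N / d := div_le_div_of_nonneg_right (h1 δ hδ h) hd0.le
        _ = (1 + 1 / δ) / (d : ℝ) ^ 2 * N := by ring
        _ ≤ kappa d * N := by gcongr
    · calc √c₁ * X ≤ √c₁ * (e / d) := by gcongr
        _ = √c₁ * e / d := by ring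
        _ ≤ K d δ * N / d := div_le_div_of_nonneg_right (h2 δ hδ h) hd0.le
        _ = K d δ / d * N := by ring
        _ ≤ kappa d * N := by gcongr
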